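/- **Proposition 3.6.** Let $\mathcal G$ be a three-dimensional nilpotent Lie group (its Lie algebra is nilpotent; the abelian case is allowed), $M$ a one-dimensional smooth manifold and $\pi:P\to M$ a smooth principal $\mathcal G$-bundle. Let $\bar g(t)$ be $\mathcal G$-invariant Riemannian metrics and $\bar H(t)$ $\mathcal G$-invariant closed three-forms on $P$, depending smoothly on $(t,p)$, where $t$ ranges over an open set $J\subset\mathbb R$ of times. *Notation.* At a fixed time let $\bar A$ be the principal connection whose horizontal spaces are the $\bar g$-orthogonal complements of the vertical spaces, and let $\mathfrak G\to M$ be the adjoint bundle. Sections of $\mathcal E=\mathfrak G\oplus TM$ are identified with invariant vector fields on $P$ (sections of $\mathfrak G$ with vertical ones, vector fields on $M$ with their horizontal lifts). Under this identification $\bar g=G\oplus g$, with $G$ a metric on $\mathfrak G$ and $g$ a metric on $M$; $\bar H$ becomes $H\in\Gamma(\Lambda^3\mathcal E^*)$; $[\cdot,\cdot]$ is the Lie bracket of invariant vector fields, $d$ the exterior derivative of invariant forms, $\pi_{\mathfrak G}$ and $\pi_{TM}$ are the projections of $\mathcal E$; $D_v\eta=[v,\eta]$ is the induced connection on $\mathfrak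 G$, extended to $\mathcal E$ by the Levi-Civita connection of $g$; $F(v,w)\in\mathfrak G$ is the curvature of $\bar A$, that is, minus the vertical part of the bracket of the horizontal lifts of $v,w$; $\partial A/\partial t\in\Gamma(T^*M\otimes\mathfrak G)$ corresponds to $\partial\bar A/\partial t$; $H^2(X,Y)=\langle i_XH,i_YH\rangle=\sum_{a,b}H(X,e_a,e_b)H(Y,e_a,e_b)$ over an orthonormal basis $(e_a)$ of $\mathcal E$. Repeated dots $\cdot,\cdot_1,\cdot_2,\dots$ are traced with $g$ or $G$, and $*$ denotes free arguments. Norms of tensors are sums of squares of all their components in orthonormal bases; for example $|[,]|^2=\sum_{i,j}|[\eta_i,\eta_j]|_G^2$ and $|H^{\mathfrak G}|^2=\sum_{i,j,k}H(\eta_i,\eta_j,\eta_k)^2$ for an orthonormal basis $(\eta_i)$ of $\mathfrak G$. $\Delta$ is the Laplacian of $g(t)$ on $M$. *Hypothesis.* $(\bar g(t),\bar H(t))$ satisfies the generalized Ricci flow equations in the canonical gauge: for $\eta,\eta_1,\eta_2\in\mathfrak G$ and $v,v_1,v_2\in TM$, $$\begin{aligned} \tfrac{\partial G}{\partial t}(\eta_1,\eta_2)&=(D_\cdot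 DG)_\cdot(\eta_1,\eta_2)-D_{\cdot_2}G(\eta_1,\cdot_1)D_{\cdot_2}G(\cdot_1,\eta_2)-\tfrac12G(F(\cdot_1,\cdot_2),\eta_1)G(F(\cdot_1,\cdot_2),\eta_2)\\ &\quad+\mathrm{tr}_G\,G([\cdot,\eta_1],[\cdot,\eta_2])-\tfrac12\mathrm{tr}_G\,G([\cdot_1,\cdot_2],\eta_1)G([\cdot_1,\cdot_2],\eta_2)+\tfrac12H^2(\eta_1,\eta_2),\\ G\big(\tfrac{\partial A}{\partial t}v,\eta\big)&=-G(D_\cdot F(v,\cdot),\eta)-D_\cdot G(F(v,\cdot),\eta)+\mathrm{tr}_G\,D_vG([\cdot,\eta],\cdot)+\tfrac12H^2(v,\eta),\\ \tfrac{\partial g}{\partial t}(v_1,v_2)&=-2\mathrm{Rc}_g(v_1,v_2)+\tfrac12D_{v_1}G(\cdot_1,\cdot_2)D_{v_2}G(\cdot_1,\cdot_2)+G(F(v_1,\cdot),F(v_2,\cdot))+\tfrac12H^2(v_1,v_2), \end{aligned}$$ and $\partial\bar H/\partial t$ corresponds to $dB$, where $$B=D_\cdot H(\cdot,*,*)-D_{\cdot_1}G(\cdot_2,\pi_{\mathfrak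 G}*)\wedge H(\cdot_1,\cdot_2,*)-\tfrac12G(F(\cdot_1,\cdot_2),\pi_{\mathfrak G}*)\wedge H(\cdot_1,\cdot_2,*)+\tfrac12\mathrm{tr}_G\,G([\cdot_1,\cdot_2],\pi_{\mathfrak G}*)\wedge H(\cdot_1,\cdot_2,*).$$ (In $\mathrm{tr}_G$ terms both dots run over $\mathfrak G$; in the $F$-terms both run over $TM$; in $D_{\cdot_1}G(\cdot_2,\pi_{\mathfrak G}*)\wedge H(\cdot_1,\cdot_2,*)$, $\cdot_1$ runs over $TM$ and $\cdot_2$ over $\mathfrak G$.) *Conclusion.* The function $|DG|^2+\mathrm{tr}_gH^2$ is smooth on $J\times M$ and $$\frac{\partial}{\partial t}\big(|DG|^2+\mathrm{tr}_gH^2\big)=\Delta\big(|DG|^2+\mathrm{tr}_gH^2\big)-\tfrac12\big(|DG|^2+\mathrm{tr}_gH^2\big)^2-S_B,$$ where, at each point $m\in M$ and time $t\in J$, with $v\in T_mM$ such that $g(v,v)=1$ and $(\eta_1,\eta_2,\eta_3)$ a $G$-orthonormal basis of $\mathfrak G|_m$ such that $\eta_3$ lies in the centre of the Lie algebra $\mathfrak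 G|_m$, $$\begin{aligned} S_B=\;&2\big|(D_\cdot DG)_\cdot(*_1,*_2)-D_{\cdot_1}G(*_1,\cdot_2)D_{\cdot_1}G(*_2,\cdot_2)+H(v,*_1,\cdot)H(v,*_2,\cdot)\big|^2\\ &+2\big|D_\cdot H(\cdot,*_1,*_2)+H(v,\cdot,*_1)D_vG(\cdot,*_2)-H(v,\cdot,*_2)D_vG(\cdot,*_1)\big|^2\\ &+|[,]|^2\big(D_vG(\cdot,\cdot)-2D_vG(\eta_3,\eta_3)\big)^2+2|[,]|^2\big(D_vG(\cdot,\eta_3)D_vG(\cdot,\eta_3)-D_vG(\eta_3,\eta_3)^2\big)\\ &+2\big|D_vG([\cdot,*],\cdot)\big|^2+2\big|D_vG([\cdot,*],\cdot)+H^2(v,\pi_{\mathfrak G}*)\big|^2\\ &+2\big|H(\pi_{TM}*,\cdot_1,\cdot_2)[\cdot_1,\cdot_2]\big|^2+\tfrac13|H^{\mathfrak G}|^2\big(D_vG(\cdot,\cdot)\big)^2 . \end{aligned}$$ This does not depend on the choice of $v$ and $(\eta_i)$. -/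

import Mathlib

open scoped Manifold ContDiff
open VectorField

noncomputable section

namespace GRFlow

section LieGroups

/-- A (real, finite-dimensional) Lie group is called nilpotent when its Lie algebra is. -/
def IsNilpotentLieGroup {E : Type*} [NormedAddCommGroup E] [NormedSpace ℝ E] [CompleteSpace E]
    (K : Type*) [TopologicalSpace K] [ChartedSpace E K] [Group K] [LieGroup 𝓘(ℝ, E) ∞ K] : Prop :=
  haveI : LieGroup 𝓘(ℝ, E) (minSmoothness ℝ 3) K :=
    LieGroup.of_le (n := ∞) (by rw [minSmoothness_of_isRCLikeNormedField]; exact WithTop.coe_le_coe.2 le_top)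
  LieRing.IsNilpotent (GroupLieAlgebra 𝓘(ℝ, E) K)

end LieGroups

section Defs

variable (EK : Type*) [NormedAddCommGroup EK] [NormedSpace ℝ EK]
  (K : Type*) [TopologicalSpace K] [Group K] [ChartedSpace EK K]
  (EM : Type*) [NormedAddCommGroup EM] [NormedSpace ℝ EM]
  {M : Type*} [TopologicalSpace M] [ChartedSpace EM M]
  (EP : Type*) [NormedAddCommGroup EP] [NormedSpace ℝ EP]
  {P : Type*} [TopologicalSpace P] [ChartedSpace EP P] [MulAction Kᵐᵒᵖ P]

/-! ### Principal bundles

A right action of `K` on `P` is a `MulAction` of `Kᵐᵒᵖ`: `p · a` is `MulOpposite.op a • p`. -/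

/-- `π : P → M` is a smooth principal `K`-bundle for the given right action: the action and `π`
are smooth, and over a neighbourhood `U` of every point of `M` there is a diffeomorphism
`φ : U × K → π⁻¹(U)` over `U` that is equivariant for right multiplication on `K`
(its inverse is `p ↦ (π p, ψ p)`). -/
structure IsPrincipalBundle (π : P → M) : Prop where
  smooth_proj : ContMDiff 𝓘(ℝ, EP) 𝓘(ℝ, EM) ∞ π
  smooth_action : ContMDiff (𝓘(ℝ, EP).prod 𝓘(ℝ, EK)) 𝓘(ℝ, EP) ∞
    (fun z : P × K => MulOpposite.op z.2 • z.1)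
  locally_trivial : ∀ x : M, ∃ (U : Set M) (φ : M × K → P) (ψ : P → K),
    IsOpen U ∧ x ∈ U ∧
    ContMDiffOn (𝓘(ℝ, EM).prod 𝓘(ℝ, EK)) 𝓘(ℝ, EP) ∞ φ (U ×ˢ Set.univ) ∧
    ContMDiffOn 𝓘(ℝ, EP) 𝓘(ℝ, EK) ∞ ψ (π ⁻¹' U) ∧
    (∀ y ∈ U, ∀ a : K, π (φ (y, a)) = y ∧ ψ (φ (y, a)) = a) ∧
    (∀ p ∈ π ⁻¹' U, φ (π p, ψ p) = p) ∧
    (∀ y ∈ U, ∀ a b : K, φ (y, a * b) = MulOpposite.op b • φ (y, a))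

variable {EP} [IsManifold 𝓘(ℝ, EP) ∞ P]

/-! ### Vector fields, metrics, three-forms on the total space -/

/-- (Not necessarily continuous) vector fields on `P`. -/
abbrev VField (EP : Type*) [NormedAddCommGroup EP] [NormedSpace ℝ EP]
    (P : Type*) [TopologicalSpace P] [ChartedSpace EP P] : Type _ :=
  ∀ p : P, TangentSpace 𝓘(ℝ, EP) p

/-- Fields of bilinear forms on `P`. -/
abbrev BilinField (EP : Type*) [NormedAddCommGroup EP] [NormedSpace ℝ EP]
    (P : Type*) [TopologicalSpace P] [ChartedSpace EP P] : Type _ :=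
  ∀ p : P, TangentSpace 𝓘(ℝ, EP) p →L[ℝ] TangentSpace 𝓘(ℝ, EP) p →L[ℝ] ℝ

/-- Three-forms on `P`. -/
abbrev ThreeForm (EP : Type*) [NormedAddCommGroup EP] [NormedSpace ℝ EP]
    (P : Type*) [TopologicalSpace P] [ChartedSpace EP P] : Type _ :=
  ∀ p : P, TangentSpace 𝓘(ℝ, EP) p [⋀^Fin 3]→L[ℝ] ℝ

/-- `X` is smooth on `W`. -/
def SmoothFieldOn (X : VField EP P) (W : Set P) : Prop :=
  ContMDiffOn 𝓘(ℝ, EP) 𝓘(ℝ, EP).tangent ∞ (fun p => (⟨p, X p⟩ : TangentBundle 𝓘(ℝ, EP) P)) W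

/-- `X` is invariant under the right translations by `K`, at the points of `W`. -/
def InvariantFieldOn (X : VField EP P) (W : Set P) : Prop :=
  ∀ a : K, ∀ p ∈ W,
    mfderiv 𝓘(ℝ, EP) 𝓘(ℝ, EP) (fun q : P => MulOpposite.op a • q) p (X p)
      = X (MulOpposite.op a • p)

/-- The derivative `X[f]` of a function along a vector field. -/
def along (X : VField EP P) (f : P → ℝ) : P → ℝ :=
  fun p => (mfderiv 𝓘(ℝ, EP) 𝓘(ℝ, ℝ) f p (X p) : ℝ)

/-- The function `b(X, Y)`. -/
def ev₂ (b : BilinField EP P) (X Y : VField EP P) : P → ℝ := fun p => b p (X p) (Y p)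

/-- The function `H(X, Y, Z)`. -/
def ev₃ (H : ThreeForm EP P) (X Y Z : VField EP P) : P → ℝ := fun p => H p ![X p, Y p, Z p]

/-- The Lie bracket of vector fields on `P`. On invariant fields, this is the bracket of sections
of `𝔊 ⊕ TM`. -/
def brk (X Y : VField EP P) : VField EP P := mlieBracket 𝓘(ℝ, EP) X Y

/-- The exterior derivative of a 2-form, `(X, Y) ↦ σ X Y`. -/
def extD₂ (σ : VField EP P → VField EP P → P → ℝ) (X Y Z : VField EP P) : P → ℝ := fun p =>
  along X (σ Y Z) p - along Y (σ X Z) p + along Z (σ X Y) p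
    - σ (brk X Y) Z p + σ (brk X Z) Y p - σ (brk Y Z) X p

/-- The exterior derivative of a 3-form, `(X, Y, Z) ↦ σ X Y Z`. -/
def extD₃ (σ : VField EP P → VField EP P → VField EP P → P → ℝ) (X Y Z V : VField EP P) :
    P → ℝ := fun p =>
  along X (σ Y Z V) p - along Y (σ X Z V) p + along Z (σ X Y V) p - along V (σ X Y Z) p
    - σ (brk X Y) Z V p + σ (brk X Z) Y V p - σ (brk X V) Y Z p
    - σ (brk Y Z) X V p + σ (brk Y V) X Z p - σ (brk Z V) X Y p

/-- `gbar t`, `t ∈ J`, is a family of `K`-invariant Riemannian metrics on `P`, depending smoothly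
on `(t, p)`. -/
structure IsInvariantMetricFamily (J : Set ℝ) (gbar : ℝ → BilinField EP P) : Prop where
  symm : ∀ t ∈ J, ∀ p (v w : TangentSpace 𝓘(ℝ, EP) p), gbar t p v w = gbar t p w v
  pos : ∀ t ∈ J, ∀ p (v : TangentSpace 𝓘(ℝ, EP) p), v ≠ 0 → 0 < gbar t p v v
  invariant : ∀ t ∈ J, ∀ (a : K) (p : P) (v w : TangentSpace 𝓘(ℝ, EP) p),
    gbar t (MulOpposite.op a • p)
        (mfderiv 𝓘(ℝ, EP) 𝓘(ℝ, EP) (fun q : P => MulOpposite.op a • q) p v)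
        (mfderiv 𝓘(ℝ, EP) 𝓘(ℝ, EP) (fun q : P => MulOpposite.op a • q) p w)
      = gbar t p v w
  smooth : ∀ (W : Set P) (X Y : VField EP P), IsOpen W →
    SmoothFieldOn X W → SmoothFieldOn Y W →
    ContMDiffOn (𝓘(ℝ, ℝ).prod 𝓘(ℝ, EP)) 𝓘(ℝ, ℝ) ∞
      (fun z : ℝ × P => ev₂ (gbar z.1) X Y z.2) (J ×ˢ W)

/-- `Hbar t`, `t ∈ J`, is a family of closed `K`-invariant three-forms on `P`, depending smoothly
on `(t, p)`. -/
structure IsInvariantClosedThreeFormFamily (J : Set ℝ) (Hbar : ℝ → ThreeForm EP P) : Prop where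
  invariant : ∀ t ∈ J, ∀ (a : K) (p : P) (u v w : TangentSpace 𝓘(ℝ, EP) p),
    Hbar t (MulOpposite.op a • p)
        ![mfderiv 𝓘(ℝ, EP) 𝓘(ℝ, EP) (fun q : P => MulOpposite.op a • q) p u,
          mfderiv 𝓘(ℝ, EP) 𝓘(ℝ, EP) (fun q : P => MulOpposite.op a • q) p v,
          mfderiv 𝓘(ℝ, EP) 𝓘(ℝ, EP) (fun q : P => MulOpposite.op a • q) p w]
      = Hbar t p ![u, v, w]
  closed : ∀ t ∈ J, ∀ (W : Set P) (X Y Z V : VField EP P), IsOpen W →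
    SmoothFieldOn X W → SmoothFieldOn Y W → SmoothFieldOn Z W → SmoothFieldOn V W →
    ∀ p ∈ W, extD₃ (ev₃ (Hbar t)) X Y Z V p = 0
  smooth : ∀ (W : Set P) (X Y Z : VField EP P), IsOpen W →
    SmoothFieldOn X W → SmoothFieldOn Y W → SmoothFieldOn Z W →
    ContMDiffOn (𝓘(ℝ, ℝ).prod 𝓘(ℝ, EP)) 𝓘(ℝ, ℝ) ∞
      (fun z : ℝ × P => ev₃ (Hbar z.1) X Y Z z.2) (J ×ˢ W)

/-- The vertical part of `Z ∈ T_pP` with respect to the metric `b`: the vertical vector `w` such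
that `Z - w` is `b`-orthogonal to the vertical space `ker dπ_p`. If `Ā` is the connection of `b`
(the one whose horizontal space is the orthogonal complement of the vertical space), this is the
value at `p` of the fundamental vector field of `Ā(Z)`. -/
def vertPart (π : P → M) (b : BilinField EP P) (p : P) (Z : TangentSpace 𝓘(ℝ, EP) p) :
    TangentSpace 𝓘(ℝ, EP) p :=
  Classical.epsilon fun w : TangentSpace 𝓘(ℝ, EP) p =>
    mfderiv 𝓘(ℝ, EP) 𝓘(ℝ, EM) π p w = 0 ∧
    ∀ u : TangentSpace 𝓘(ℝ, EP) p, mfderiv 𝓘(ℝ, EP) 𝓘(ℝ, EM) π p u = 0 → b p (Z - w) u = 0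

/-- The horizontal part of `Z ∈ T_pP` with respect to `b`, that is, the horizontal lift at `p`
of `dπ(Z)`. -/
def horPart (π : P → M) (b : BilinField EP P) (p : P) (Z : TangentSpace 𝓘(ℝ, EP) p) :
    TangentSpace 𝓘(ℝ, EP) p :=
  Z - vertPart EM π b p Z

/-! ### Adapted orthonormal frames and tensor calculus on `𝔊 ⊕ TM`

Sections of `𝔊 ⊕ TM` over `U ⊆ M` are identified with invariant vector fields on `π⁻¹(U)`
(sections of the adjoint bundle `𝔊` with the vertical ones, vector fields on `U` with their
horizontal lifts), functions on `U` with invariant functions on `π⁻¹(U)`. -/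

/-- An orthonormal frame over the open set `U ⊆ M` of `TM ⊕ 𝔊`, for the metric `g ⊕ G` that is
induced by the invariant metric `b`: `hor α` are the horizontal lifts of an orthonormal frame
of `(TM, g)` and `ver i` is an orthonormal frame of `(𝔊, G)`. -/
structure AdaptedFrame (π : P → M) (b : BilinField EP P) (m n : ℕ) (U : Set M) where
  hor : Fin m → VField EP P
  ver : Fin n → VField EP P
  isOpen : IsOpen U
  hor_smooth : ∀ α, SmoothFieldOn (hor α) (π ⁻¹' U)
  ver_smooth : ∀ i, SmoothFieldOn (ver i) (π ⁻¹' U)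
  hor_invariant : ∀ α, InvariantFieldOn K (hor α) (π ⁻¹' U)
  ver_invariant : ∀ i, InvariantFieldOn K (ver i) (π ⁻¹' U)
  hor_horizontal : ∀ α, ∀ p ∈ π ⁻¹' U, ∀ w : TangentSpace 𝓘(ℝ, EP) p,
    mfderiv 𝓘(ℝ, EP) 𝓘(ℝ, EM) π p w = 0 → b p (hor α p) w = 0
  ver_vertical : ∀ i, ∀ p ∈ π ⁻¹' U, mfderiv 𝓘(ℝ, EP) 𝓘(ℝ, EM) π p (ver i p) = 0
  hor_orthonormal : ∀ α β, ∀ p ∈ π ⁻¹' U, b p (hor α p) (hor β p) = if α = β then 1 else 0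
  ver_orthonormal : ∀ i j, ∀ p ∈ π ⁻¹' U, b p (ver i p) (ver j p) = if i = j then 1 else 0
  complete : ∀ p ∈ π ⁻¹' U,
    Submodule.span ℝ (Set.range (fun α => hor α p) ∪ Set.range (fun i => ver i p)) = ⊤

namespace AdaptedFrame

variable {K EM} {π : P → M} {b : BilinField EP P} {m n : ℕ} {U : Set M}
  (F : AdaptedFrame K EM π b m n U) (H : ThreeForm EP P)

/-- The whole frame of `TM ⊕ 𝔊`. -/
def all : Fin m ⊕ Fin n → VField EP P := Sum.elim F.hor F.ver

/-- The projection of `𝔊 ⊕ TM` to `𝔊`. -/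
def vert (Y : VField EP P) : VField EP P := fun p => ∑ i, ev₂ b Y (F.ver i) p • F.ver i p

/-- The projection of `𝔊 ⊕ TM` to `TM`. -/
def horiz (Y : VField EP P) : VField EP P := fun p => ∑ α, ev₂ b Y (F.hor α) p • F.hor α p

/-- The Levi-Civita connection `∇_X Y` of the metric `g` on `M` (`X`, `Y` horizontal lifts),
from the Koszul formula. -/
def nabla (X Y : VField EP P) : VField EP P := fun p => ∑ α, (1 / 2 *
    (along X (ev₂ b Y (F.hor α)) p + along Y (ev₂ b X (F.hor α)) p
      - along (F.hor α) (ev₂ b X Y) p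
      + ev₂ b (brk X Y) (F.hor α) p - ev₂ b (brk X (F.hor α)) Y p
      - ev₂ b (brk Y (F.hor α)) X p) : ℝ) • F.hor α p

/-- The connection `D ⊕ ∇` on `𝔊 ⊕ TM`, where `D_X η = [X, η]` on `𝔊` (`X` horizontal). -/
def D (X Y : VField EP P) : VField EP P := brk X (F.vert Y) + F.nabla X (F.horiz Y)

/-- `(D_X G)(η, ζ)`, for `X` horizontal and `η`, `ζ` vertical. -/
def DG (X η ζ : VField EP P) : P → ℝ := fun p =>
  along X (ev₂ b η ζ) p - ev₂ b (F.D X η) ζ p - ev₂ b η (F.D X ζ) p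

/-- `(D_X DG)_Y(η, ζ)`, for `X`, `Y` horizontal and `η`, `ζ` vertical. -/
def DDG (X Y η ζ : VField EP P) : P → ℝ := fun p =>
  along X (F.DG Y η ζ) p - F.DG (F.nabla X Y) η ζ p - F.DG Y (F.D X η) ζ p - F.DG Y η (F.D X ζ) p

/-- The trace `(D_· DG)_·(η, ζ)`. -/
def lapG (η ζ : VField EP P) : P → ℝ := fun p => ∑ α, F.DDG (F.hor α) (F.hor α) η ζ p

/-- The curvature `F(X, Y) ∈ 𝔊` of the connection, for `X`, `Y` horizontal: minus the vertical
part of `[X, Y]`. -/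
def curv (X Y : VField EP P) : VField EP P := -F.vert (brk X Y)

/-- `(D_X F)(Y, Z)`, for `X`, `Y`, `Z` horizontal. -/
def Dcurv (X Y Z : VField EP P) : VField EP P :=
  F.D X (F.curv Y Z) - F.curv (F.nabla X Y) Z - F.curv Y (F.nabla X Z)

/-- The Ricci tensor of `g`. -/
def Ric (X Y : VField EP P) : P → ℝ := fun p => ∑ α,
  ev₂ b (F.nabla (F.hor α) (F.nabla X Y) - F.nabla X (F.nabla (F.hor α) Y)
    - F.nabla (F.horiz (brk (F.hor α) X)) Y) (F.hor α) p

/-- `H²(X, Y) = ⟨i_X H, i_Y H⟩`, the sum over all pairs of frame vectors of `𝔊 ⊕ TM`. -/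
def Hsq (X Y : VField EP P) : P → ℝ := fun p =>
  ∑ a, ∑ c, ev₃ H X (F.all a) (F.all c) p * ev₃ H Y (F.all a) (F.all c) p

/-- `(D_X H)(Y₁, Y₂, Y₃)`, for `X` horizontal. -/
def DH (X Y₁ Y₂ Y₃ : VField EP P) : P → ℝ := fun p =>
  along X (ev₃ H Y₁ Y₂ Y₃) p - ev₃ H (F.D X Y₁) Y₂ Y₃ p - ev₃ H Y₁ (F.D X Y₂) Y₃ p
    - ev₃ H Y₁ Y₂ (F.D X Y₃) p

/-- The two-form `B` on `𝔊 ⊕ TM` that generates the evolution of the three-form: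
`B = D_·H(·,*,*) - D_{·₁}G(·₂,π_𝔊 *) ∧ H(·₁,·₂,*) - ½ G(F(·₁,·₂),π_𝔊 *) ∧ H(·₁,·₂,*)
  + ½ tr_G G([·₁,·₂],π_𝔊 *) ∧ H(·₁,·₂,*)`. -/
def B (Y Z : VField EP P) : P → ℝ := fun p =>
  (∑ α, F.DH H (F.hor α) (F.hor α) Y Z p)
  - (∑ α, ∑ i, (F.DG (F.hor α) (F.ver i) (F.vert Y) p * ev₃ H (F.hor α) (F.ver i) Z p
      - F.DG (F.hor α) (F.ver i) (F.vert Z) p * ev₃ H (F.hor α) (F.ver i) Y p))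
  - 1 / 2 * (∑ α, ∑ β,
      (ev₂ b (F.curv (F.hor α) (F.hor β)) (F.vert Y) p * ev₃ H (F.hor α) (F.hor β) Z p
      - ev₂ b (F.curv (F.hor α) (F.hor β)) (F.vert Z) p * ev₃ H (F.hor α) (F.hor β) Y p))
  + 1 / 2 * (∑ i, ∑ j,
      (ev₂ b (brk (F.ver i) (F.ver j)) (F.vert Y) p * ev₃ H (F.ver i) (F.ver j) Z p
      - ev₂ b (brk (F.ver i) (F.ver j)) (F.vert Z) p * ev₃ H (F.ver i) (F.ver j) Y p))

/-- Right-hand side of the equation for `∂G/∂t (η₁, η₂)`. -/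
def rhsG (η₁ η₂ : VField EP P) : P → ℝ := fun p =>
  F.lapG η₁ η₂ p
  - (∑ α, ∑ i, F.DG (F.hor α) η₁ (F.ver i) p * F.DG (F.hor α) (F.ver i) η₂ p)
  - 1 / 2 * (∑ α, ∑ β, ev₂ b (F.curv (F.hor α) (F.hor β)) η₁ p
      * ev₂ b (F.curv (F.hor α) (F.hor β)) η₂ p)
  + (∑ i, ev₂ b (brk (F.ver i) η₁) (brk (F.ver i) η₂) p)
  - 1 / 2 * (∑ i, ∑ j, ev₂ b (brk (F.ver i) (F.ver j)) η₁ p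
      * ev₂ b (brk (F.ver i) (F.ver j)) η₂ p)
  + 1 / 2 * F.Hsq H η₁ η₂ p

/-- Right-hand side of the equation for `G(∂A/∂t v, η)`. -/
def rhsA (v η : VField EP P) : P → ℝ := fun p =>
  - (∑ α, ev₂ b (F.Dcurv (F.hor α) v (F.hor α)) η p)
  - (∑ α, F.DG (F.hor α) (F.curv v (F.hor α)) η p)
  + (∑ i, F.DG v (brk (F.ver i) η) (F.ver i) p)
  + 1 / 2 * F.Hsq H v η p

/-- Right-hand side of the equation for `∂g/∂t (v₁, v₂)`. -/
def rhsg (v₁ v₂ : VField EP P) : P → ℝ := fun p =>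
  - 2 * F.Ric v₁ v₂ p
  + 1 / 2 * (∑ i, ∑ j, F.DG v₁ (F.ver i) (F.ver j) p * F.DG v₂ (F.ver i) (F.ver j) p)
  + (∑ α, ev₂ b (F.curv v₁ (F.hor α)) (F.curv v₂ (F.hor α)) p)
  + 1 / 2 * F.Hsq H v₁ v₂ p

/-- `|DG|²` -/
def normSqDG : P → ℝ := fun p => ∑ α, ∑ i, ∑ j, F.DG (F.hor α) (F.ver i) (F.ver j) p ^ 2

/-- `tr_g H²` -/
def trHsq : P → ℝ := fun p => ∑ α, F.Hsq H (F.hor α) (F.hor α) p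

/-- `|[,]|²`, for the bracket on the fibres of `𝔊` -/
def normSqBrk : P → ℝ := fun p =>
  ∑ i, ∑ j, ev₂ b (brk (F.ver i) (F.ver j)) (brk (F.ver i) (F.ver j)) p

/-- `|H^𝔊|²`, the norm of the restriction of `H` to `𝔊` -/
def normSqHver : P → ℝ := fun p => ∑ i, ∑ j, ∑ k, ev₃ H (F.ver i) (F.ver j) (F.ver k) p ^ 2

/-- The Laplacian of `g`, applied to a function on `M`: the trace of the Hessian. -/
def lap (f : M → ℝ) : P → ℝ := fun p => ∑ α,
  (along (F.hor α) (along (F.hor α) (f ∘ π)) p - along (F.nabla (F.hor α) (F.hor α)) (f ∘ π) p)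

end AdaptedFrame

/-! ### The flow equations -/

/-- The decomposed generalized Ricci flow equations in the canonical gauge, in components with
respect to adapted orthonormal frames, at all times `t ∈ J`. The derivatives on the left are those
of `G`, `A`, `g` and of the three-form `Hbar` on `P`; `A` is represented by the vertical
projection in `TP`, and in `∂G/∂t (η₁, η₂)`, `(∂A/∂t) v`, `∂g/∂t (v₁, v₂)` the `η_i ∈ 𝔊` and
`v_i ∈ TM` are kept fixed. -/
def SatisfiesFlowEquations (π : P → M) (m n : ℕ) (J : Set ℝ) (gbar : ℝ → BilinField EP P)
    (Hbar : ℝ → ThreeForm EP P) : Prop :=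
  ∀ t ∈ J, ∀ (U : Set M) (F : AdaptedFrame K EM π (gbar t) m n U), ∀ p ∈ π ⁻¹' U,
    (∀ i j, deriv (fun s => gbar s p (F.ver i p) (F.ver j p)) t
      = F.rhsG (Hbar t) (F.ver i) (F.ver j) p) ∧
    (∀ α i, gbar t p (deriv (fun s => vertPart EM π (gbar s) p (F.hor α p)) t) (F.ver i p)
      = F.rhsA (Hbar t) (F.hor α) (F.ver i) p) ∧
    (∀ α β, deriv (fun s => gbar s p (horPart EM π (gbar s) p (F.hor α p))
          (horPart EM π (gbar s) p (F.hor β p))) t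
      = F.rhsg (Hbar t) (F.hor α) (F.hor β) p) ∧
    (∀ a c d, deriv (fun s => Hbar s p ![F.all a p, F.all c p, F.all d p]) t
      = extD₂ (F.B (Hbar t)) (F.all a) (F.all c) (F.all d) p)

/-! ### Functions on the base -/

/-- The value at `x ∈ M` of a scalar that is given by an expression `val` in adapted orthonormal
frames and does not depend on the choice of the frame nor of the point over `x`: the common
value of `val F p` for all frames `F` around `x` and all `p` over `x` such that `adm F p` holds. -/
def frameValue (π : P → M) (b : BilinField EP P) (m n : ℕ)
    (adm : ∀ U : Set M, AdaptedFrame K EM π b m n U → P → Prop)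
    (val : ∀ U : Set M, AdaptedFrame K EM π b m n U → P → ℝ) (x : M) : ℝ :=
  Classical.epsilon fun c : ℝ => ∀ (U : Set M) (F : AdaptedFrame K EM π b m n U) (p : P),
    π p ∈ U → π p = x → adm U F p → val U F p = c

/-- The function `|DG|² + tr_g H²` on `M`. -/
def energy (π : P → M) (m n : ℕ) (b : BilinField EP P) (H : ThreeForm EP P) (x : M) : ℝ :=
  frameValue K EM π b m n (fun _ _ _ => True) (fun _ F p => F.normSqDG p + F.trHsq H p) x

/-- The Laplacian `Δ f` of a function `f` on `M`, for the metric `g` on `M` induced by `b`. -/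
def laplacian (π : P → M) (m n : ℕ) (b : BilinField EP P) (f : M → ℝ) (x : M) : ℝ :=
  frameValue K EM π b m n (fun _ _ _ => True) (fun _ F p => F.lap f p) x

variable {K EM} in
/-- The third vertical frame vector lies in the centre `Z(𝔊)` at the point `p`. -/
def IsCentralAt {π : P → M} {b : BilinField EP P} {U : Set M}
    (F : AdaptedFrame K EM π b 1 3 U) (p : P) : Prop :=
  ∀ i, brk (F.ver 2) (F.ver i) p = 0

variable {K EM} in
/-- The expression `S_B` in an adapted frame `v, η₁, η₂, η₃` such that `η₃` is central at the
point considered. (If the bracket is not zero, `η₃` spans `Z(𝔊)` there and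
`|DG|²_{Z(𝔊)} = D_vG(η₃,η₃)²`; otherwise the two terms that contain `η₃` vanish.) -/
def SBframe {π : P → M} {b : BilinField EP P} {U : Set M} (F : AdaptedFrame K EM π b 1 3 U)
    (H : ThreeForm EP P) (p : P) : ℝ :=
  let v : VField EP P := F.hor 0
  let η : Fin 3 → VField EP P := F.ver
  2 * (∑ i, ∑ j, (F.lapG (η i) (η j) p
        - (∑ k, F.DG v (η i) (η k) p * F.DG v (η j) (η k) p)
        + ∑ k, ev₃ H v (η i) (η k) p * ev₃ H v (η j) (η k) p) ^ 2)
  + 2 * (∑ i, ∑ j, (F.DH H v v (η i) (η j) p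
        + (∑ k, ev₃ H v (η k) (η i) p * F.DG v (η k) (η j) p)
        - ∑ k, ev₃ H v (η k) (η j) p * F.DG v (η k) (η i) p) ^ 2)
  + F.normSqBrk p * ((∑ k, F.DG v (η k) (η k) p) - 2 * F.DG v (η 2) (η 2) p) ^ 2
  + 2 * F.normSqBrk p * ((∑ k, F.DG v (η k) (η 2) p ^ 2) - F.DG v (η 2) (η 2) p ^ 2)
  + 2 * (∑ j, (∑ k, F.DG v (brk (η k) (η j)) (η k) p) ^ 2)
  + 2 * (∑ j, ((∑ k, F.DG v (brk (η k) (η j)) (η k) p) + F.Hsq H v (η j) p) ^ 2)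
  + 2 * (∑ l, (∑ i, ∑ j, ev₃ H v (η i) (η j) p * ev₂ b (brk (η i) (η j)) (η l) p) ^ 2)
  + 1 / 3 * F.normSqHver H p * (∑ k, F.DG v (η k) (η k) p) ^ 2

/-- The function `S_B` on `M`. -/
def SB (π : P → M) (b : BilinField EP P) (H : ThreeForm EP P) (x : M) : ℝ :=
  frameValue K EM π b 1 3 (fun _ F p => IsCentralAt F p) (fun _ F p => SBframe F H p) x

end Defs

end GRFlow

end

/-! Because the base is one-dimensional, an invariant function is locally a function of one real
variable, and the whole statement becomes an identity between the components of a single frame. Let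
`V, η₁, η₂, η₃` be a local adapted orthonormal frame and put `A i j = G([V, η_i], η_j)` (`conn`), `C
i j k = G([η_i, η_j], η_k)` (`struc`), `w i j = H(V, η_i, η_j)` (`flux`) and `H i j k = H(η_i, η_j,
η_k)` (`fluxVer`). Then `D_V G` has the components `s i j = -(A i j + A j i)` (`shape`), and the
quantity `u = |DG|² + tr_g H²` is the sum of all `s i j ²` and `w i j ²` (`density`). In dimension
one `∇_V V`, the curvature of the connection and the Ricci tensor vanish, so every tensor in the
flow equations and in `S_B` is a polynomial in these functions and their derivatives along `V`.

Time derivative. A frame that is orthonormal at time `t` does not remain so. It is therefore kept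
fixed, and `u` at other times is expressed in it through the Gram matrix of the `η_i`, the
coefficients of the vertical part of `V`, the squared length of the horizontal part of `V`, and the
correspondingly corrected `s` and `w` (`densityFor`). `density_eq_densityFor` shows that this is the
right value; it also shows that `u` does not depend on the frame. The flow equations are the
derivatives of these ingredients at time `t`. Since the base metric evolves by `u/2`, the factor `1
/ horSq` contributes exactly `-½u²`. The rest has to equal `Δu - S_B`, where `Δu` is the second
derivative of `u` along `V`.

Algebra. The Jacobi identity expresses `V C` through `A` and `C` (`along_struc`), and `dH = 0`
expresses `V H` through `A`, `C`, `w` and `H` (`along_fluxVer`). If `η₃` is central, nilpotency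
makes `[η₁, η₂]` a multiple of `η₃`, so that `C` has one essential component. The remaining
quantities are treated as independent variables, and `PointData.evolution` is a polynomial identity
that is verified by expansion.

Geometry. The nilpotent Lie algebra of the structure group controls brackets of invariant vertical
fields because the orbit map `a ↦ p · a⁻¹` respects brackets (`orbitTangent_lie`). Frames with a
central last vector at a given point come from a central element of the Lie algebra and Gram-Schmidt
(`exists_adaptedFrame`). That `S_B` is well defined needs no computation: it is what remains in an
evolution equation all of whose other terms are independent of the frame. -/

namespace GRFlow

/-! ### Calculus of smooth functions and vector fields on the total space. -/

section FieldCalculus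

set_option linter.unusedSectionVars false

open scoped Topology

variable {EP : Type*} [NormedAddCommGroup EP] [NormedSpace ℝ EP]
  {P : Type*} [TopologicalSpace P] [ChartedSpace EP P]

/-- Smooth real functions on `W`. -/
def SmoothOn (EP : Type*) [NormedAddCommGroup EP] [NormedSpace ℝ EP]
    {P : Type*} [TopologicalSpace P] [ChartedSpace EP P] (f : P → ℝ) (W : Set P) : Prop :=
  ContMDiffOn 𝓘(ℝ, EP) 𝓘(ℝ, ℝ) ∞ f W

/-- `f` is differentiable at `p`, with derivative `d` along `X`. -/
def HasAlong (X : VField EP P) (f : P → ℝ) (d : ℝ) (p : P) : Prop :=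
  MDifferentiableAt 𝓘(ℝ, EP) 𝓘(ℝ, ℝ) f p ∧ along X f p = d

lemma along_eq_mvfderiv (X : VField EP P) (f : P → ℝ) (p : P) :
    along X f p = mvfderiv 𝓘(ℝ, EP) f p (X p) := rfl

lemma along_congr {X Y : VField EP P} {f g : P → ℝ} {p : P} (hX : X p = Y p) (h : f =ᶠ[𝓝 p] g) :
    along X f p = along Y g p := by
  unfold along; rw [h.mfderiv_eq, hX]; rfl

namespace HasAlong

variable {X : VField EP P} {f g : P → ℝ} {d e : ℝ} {p : P}

lemma congr (h : HasAlong X f d p) (hg : g =ᶠ[𝓝 p] f) : HasAlong X g d p :=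
  ⟨h.1.congr_of_eventuallyEq hg, by rw [along_congr rfl hg, h.2]⟩

lemma congrOn {W : Set P} (h : HasAlong X f d p) (hW : IsOpen W) (hp : p ∈ W)
    (hg : ∀ q ∈ W, g q = f q) : HasAlong X g d p :=
  h.congr (Filter.eventuallyEq_of_mem (hW.mem_nhds hp) hg)

lemma const (X : VField EP P) (c : ℝ) (p : P) : HasAlong X (fun _ => c) 0 p :=
  ⟨mdifferentiableAt_const, by rw [along_eq_mvfderiv, mvfderiv_const]; rfl⟩

lemma add (hf : HasAlong X f d p) (hg : HasAlong X g e p) :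
    HasAlong X (fun q => f q + g q) (d + e) p :=
  ⟨hf.1.add hg.1, by
    rw [← hf.2, ← hg.2, along_eq_mvfderiv, along_eq_mvfderiv, along_eq_mvfderiv,
      show (fun q => f q + g q) = f + g from rfl, mvfderiv_add hf.1 hg.1]; rfl⟩

lemma neg (hf : HasAlong X f d p) : HasAlong X (fun q => - f q) (-d) p :=
  ⟨hf.1.neg, by
    rw [← hf.2, along_eq_mvfderiv, along_eq_mvfderiv,
      show (fun q => - f q) = - f from rfl, mvfderiv_neg]; rfl⟩

lemma sub (hf : HasAlong X f d p) (hg : HasAlong X g e p) :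
    HasAlong X (fun q => f q - g q) (d - e) p := by
  simpa only [sub_eq_add_neg] using hf.add hg.neg

lemma mul (hf : HasAlong X f d p) (hg : HasAlong X g e p) :
    HasAlong X (fun q => f q * g q) (d * g p + f p * e) p :=
  ⟨hf.1.mul hg.1, by
    rw [← hf.2, ← hg.2, along_eq_mvfderiv, along_eq_mvfderiv, along_eq_mvfderiv,
      show (fun q => f q * g q) = f * g from rfl, mvfderiv_mul hf.1 hg.1]
    simp; ring⟩

lemma const_mul (c : ℝ) (hf : HasAlong X f d p) : HasAlong X (fun q => c * f q) (c * d) p := by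
  simpa using (HasAlong.const X c p).mul hf

lemma sum {ι : Type*} {t : Finset ι} {f : ι → P → ℝ} {d : ι → ℝ}
    (hf : ∀ i ∈ t, HasAlong X (f i) (d i) p) :
    HasAlong X (fun q => ∑ i ∈ t, f i q) (∑ i ∈ t, d i) p := by
  classical
  induction t using Finset.induction_on with
  | empty => simpa using HasAlong.const X 0 p
  | insert i s hi IH =>
    simp only [Finset.sum_insert hi]
    exact (hf i (by simp)).add (IH fun j hj => hf j (by simp [hj]))

lemma sum_univ {ι : Type*} [Fintype ι] {f : ι → P → ℝ} {d : ι → ℝ}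
    (hf : ∀ i, HasAlong X (f i) (d i) p) :
    HasAlong X (fun q => ∑ i, f i q) (∑ i, d i) p := HasAlong.sum fun i _ => hf i

end HasAlong

lemma SmoothOn.mdifferentiableAt {f : P → ℝ} {W : Set P} (hf : SmoothOn EP f W) (hW : IsOpen W)
    {p : P} (hp : p ∈ W) : MDifferentiableAt 𝓘(ℝ, EP) 𝓘(ℝ, ℝ) f p :=
  (hf.contMDiffAt (hW.mem_nhds hp)).mdifferentiableAt (by simp)

lemma SmoothOn.hasAlong {f : P → ℝ} {W : Set P} (hf : SmoothOn EP f W) (hW : IsOpen W)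
    {p : P} (hp : p ∈ W) (X : VField EP P) : HasAlong X f (along X f p) p :=
  ⟨hf.mdifferentiableAt hW hp, rfl⟩

lemma along_eq_zero_of_const {X : VField EP P} {f : P → ℝ} {W : Set P} (hW : IsOpen W) {p : P}
    (hp : p ∈ W) {c : ℝ} (h : ∀ q ∈ W, f q = c) : along X f p = 0 :=
  ((HasAlong.const X c p).congrOn hW hp h).2

namespace SmoothOn

variable {f g : P → ℝ} {W : Set P}

lemma congr (hf : SmoothOn EP f W) (h : ∀ q ∈ W, g q = f q) : SmoothOn EP g W :=
  ContMDiffOn.congr hf h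

lemma mono (hf : SmoothOn EP f W) {W' : Set P} (h : W' ⊆ W) : SmoothOn EP f W' :=
  ContMDiffOn.mono hf h

lemma const (c : ℝ) (W : Set P) : SmoothOn EP (fun _ : P => c) W := contMDiffOn_const

lemma add (hf : SmoothOn EP f W) (hg : SmoothOn EP g W) : SmoothOn EP (fun q => f q + g q) W :=
  ContMDiffOn.add hf hg

lemma neg (hf : SmoothOn EP f W) : SmoothOn EP (fun q => - f q) W := ContMDiffOn.neg hf

lemma mul (hf : SmoothOn EP f W) (hg : SmoothOn EP g W) : SmoothOn EP (fun q => f q * g q) W :=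
  ContMDiffOn.mul hf hg

lemma sum_univ {ι : Type*} [Fintype ι] {f : ι → P → ℝ} (hf : ∀ i, SmoothOn EP (f i) W) :
    SmoothOn EP (fun q => ∑ i, f i q) W := by
  classical
  have : ∀ t : Finset ι, SmoothOn EP (fun q => ∑ i ∈ t, f i q) W := by
    intro t
    induction t using Finset.induction_on with
    | empty => simpa using SmoothOn.const (EP := EP) 0 W
    | insert i s hi IH => simp only [Finset.sum_insert hi]; exact (hf i).add IH
  exact this _

end SmoothOn

variable [IsManifold 𝓘(ℝ, EP) ∞ P]

namespace SmoothFieldOn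

variable {X Y : VField EP P} {f : P → ℝ} {W : Set P}

lemma mono (hX : SmoothFieldOn X W) {W' : Set P} (h : W' ⊆ W) : SmoothFieldOn X W' :=
  ContMDiffOn.mono hX h

lemma congr (hX : SmoothFieldOn X W) (h : ∀ q ∈ W, Y q = X q) : SmoothFieldOn Y W :=
  ContMDiffOn.congr hX fun q hq => by rw [h q hq]

lemma contMDiffAt (hX : SmoothFieldOn X W) (hW : IsOpen W) {p : P} (hp : p ∈ W) :
    ContMDiffAt 𝓘(ℝ, EP) 𝓘(ℝ, EP).tangent ∞
      (fun p => (⟨p, X p⟩ : TangentBundle 𝓘(ℝ, EP) P)) p :=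
  ContMDiffOn.contMDiffAt hX (hW.mem_nhds hp)

lemma mdifferentiableAt (hX : SmoothFieldOn X W) (hW : IsOpen W) {p : P} (hp : p ∈ W) :
    MDifferentiableAt 𝓘(ℝ, EP) 𝓘(ℝ, EP).tangent
      (fun p => (⟨p, X p⟩ : TangentBundle 𝓘(ℝ, EP) P)) p :=
  (hX.contMDiffAt hW hp).mdifferentiableAt (by simp)

lemma add (hX : SmoothFieldOn X W) (hY : SmoothFieldOn Y W) : SmoothFieldOn (X + Y) W :=
  ContMDiffOn.add_section hX hY

lemma sub (hX : SmoothFieldOn X W) (hY : SmoothFieldOn Y W) : SmoothFieldOn (X - Y) W :=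
  ContMDiffOn.sub_section hX hY

lemma smul (hf : SmoothOn EP f W) (hX : SmoothFieldOn X W) : SmoothFieldOn (f • X) W :=
  ContMDiffOn.smul_section hf hX

lemma sum {ι : Type*} [Fintype ι] {X : ι → VField EP P} (hX : ∀ i, SmoothFieldOn (X i) W) :
    SmoothFieldOn (∑ i, X i) W := by
  have := ContMDiffOn.sum_section (s := Finset.univ) (t := fun i p => X i p)
    (fun i _ => (hX i : ContMDiffOn 𝓘(ℝ, EP) 𝓘(ℝ, EP).tangent ∞ _ W))
  exact SmoothFieldOn.congr (X := fun p => ∑ i, X i p) this fun q _ => by simp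

end SmoothFieldOn

lemma brk_congr {X X' Y Y' : VField EP P} {W : Set P} (hW : IsOpen W) {p : P} (hp : p ∈ W)
    (hX : ∀ q ∈ W, X q = X' q) (hY : ∀ q ∈ W, Y q = Y' q) : brk X Y p = brk X' Y' p :=
  Filter.EventuallyEq.mlieBracket_vectorField_eq
    (Filter.eventuallyEq_of_mem (hW.mem_nhds hp) hX) (Filter.eventuallyEq_of_mem (hW.mem_nhds hp) hY)

lemma brk_swap (X Y : VField EP P) (p : P) : brk X Y p = - brk Y X p := mlieBracket_swap_apply

lemma brk_self (X : VField EP P) (p : P) : brk X X p = 0 := by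
  simp [brk]

variable [CompleteSpace EP]

lemma SmoothFieldOn.brk {X Y : VField EP P} {W : Set P} (hW : IsOpen W) (hX : SmoothFieldOn X W)
    (hY : SmoothFieldOn Y W) : SmoothFieldOn (brk X Y) W := fun p hp =>
  have : IsManifold 𝓘(ℝ, EP) (((⊤ : ℕ∞) : WithTop ℕ∞) + 1) P := ‹IsManifold 𝓘(ℝ, EP) ∞ P›
  have : IsManifold 𝓘(ℝ, EP) (minSmoothness ℝ 2) P := IsManifold.of_le (n := ∞) (by
    rw [minSmoothness_of_isRCLikeNormedField]; exact WithTop.coe_le_coe.2 le_top)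
  (ContMDiffAt.mlieBracket_vectorField (m := ⊤) (n := ⊤) (hX.contMDiffAt hW hp)
    (hY.contMDiffAt hW hp) (by rw [minSmoothness_of_isRCLikeNormedField]; rfl)).contMDiffWithinAt

section

variable {W : Set P} (hW : IsOpen W) {p : P} (hp : p ∈ W)
include hW hp

lemma brk_smul_right {X Y : VField EP P} {f : P → ℝ} (hf : SmoothOn EP f W)
    (hY : SmoothFieldOn Y W) :
    brk X (f • Y) p = along X f p • Y p + f p • brk X Y p :=
  mlieBracket_smul_right (hf.mdifferentiableAt hW hp) (hY.mdifferentiableAt hW hp)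

lemma brk_add_right {X Y Z : VField EP P} (hY : SmoothFieldOn Y W) (hZ : SmoothFieldOn Z W) :
    brk X (Y + Z) p = brk X Y p + brk X Z p :=
  mlieBracket_add_right (hY.mdifferentiableAt hW hp) (hZ.mdifferentiableAt hW hp)

lemma brk_sum_right {ι : Type*} [Fintype ι] {X : VField EP P} {Y : ι → VField EP P}
    (hY : ∀ i, SmoothFieldOn (Y i) W) : brk X (∑ i, Y i) p = ∑ i, brk X (Y i) p := by
  classical
  have key : ∀ t : Finset ι, SmoothFieldOn (∑ i ∈ t, Y i) W ∧
      brk X (∑ i ∈ t, Y i) p = ∑ i ∈ t, brk X (Y i) p := by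
    intro t
    induction t using Finset.induction_on with
    | empty =>
      refine ⟨?_, by simp [brk]⟩
      have := SmoothFieldOn.sum (W := W) (X := fun i : Fin 0 => (0 : VField EP P)) (fun i => i.elim0)
      simpa using this
    | insert i s hi IH =>
      simp only [Finset.sum_insert hi]
      exact ⟨(hY i).add IH.1, by rw [brk_add_right hW hp (hY i) IH.1, IH.2]⟩
  exact (key _).2

lemma brk_lincomb_right {ι : Type*} [Fintype ι] {X : VField EP P} {Y : ι → VField EP P}
    {f : ι → P → ℝ} (hf : ∀ i, SmoothOn EP (f i) W) (hY : ∀ i, SmoothFieldOn (Y i) W) :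
    brk X (∑ i, f i • Y i) p = ∑ i, (along X (f i) p • Y i p + f i p • brk X (Y i) p) := by
  rw [brk_sum_right hW hp fun i => SmoothFieldOn.smul (hf i) (hY i)]
  exact Finset.sum_congr rfl fun i _ => brk_smul_right hW hp (hf i) (hY i)

lemma brk_lincomb_left {ι : Type*} [Fintype ι] {X : VField EP P} {Y : ι → VField EP P}
    {f : ι → P → ℝ} (hf : ∀ i, SmoothOn EP (f i) W) (hY : ∀ i, SmoothFieldOn (Y i) W) :
    brk (∑ i, f i • Y i) X p = ∑ i, (- along X (f i) p • Y i p + f i p • brk (Y i) X p) := by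
  rw [brk_swap, brk_lincomb_right hW hp hf hY, ← Finset.sum_neg_distrib]
  refine Finset.sum_congr rfl fun i _ => ?_
  rw [brk_swap X (Y i), smul_neg, neg_add, neg_neg, neg_smul]

lemma brk_jacobi {X Y Z : VField EP P} (hX : SmoothFieldOn X W) (hY : SmoothFieldOn Y W)
    (hZ : SmoothFieldOn Z W) :
    brk X (brk Y Z) p = brk (brk X Y) Z p + brk Y (brk X Z) p := by
  have h2 : minSmoothness ℝ 2 ≤ (∞ : WithTop ℕ∞) := by
    rw [minSmoothness_of_isRCLikeNormedField]; exact WithTop.coe_le_coe.2 le_top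
  have : IsManifold 𝓘(ℝ, EP) (minSmoothness ℝ 3) P := IsManifold.of_le (n := ∞) (by
    rw [minSmoothness_of_isRCLikeNormedField]; exact WithTop.coe_le_coe.2 le_top)
  exact leibniz_identity_mlieBracket_apply ((hX.contMDiffAt hW hp).of_le h2)
    ((hY.contMDiffAt hW hp).of_le h2) ((hZ.contMDiffAt hW hp).of_le h2)

end

/-- The derivative of a smooth function along a smooth field is smooth. -/
lemma SmoothOn.along {X : VField EP P} {f : P → ℝ} {W : Set P} (hf : SmoothOn EP f W)
    (hW : IsOpen W) (hX : SmoothFieldOn X W) : SmoothOn EP (along X f) W := by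
  -- The derivative along `X` is the fibre component of the tangent map of `f` composed with the
  -- section `X`.
  have h1 := ContMDiffOn.contMDiffOn_tangentMapWithin (m := ∞) hf (by simp) hW.uniqueMDiffOn
  have h2 := h1.comp (show ContMDiffOn 𝓘(ℝ, EP) 𝓘(ℝ, EP).tangent ∞ _ W from hX) (fun q hq => hq)
  have h3 := (contMDiff_snd_tangentBundle_modelSpace ℝ 𝓘(ℝ, ℝ) (n := ∞)).comp_contMDiffOn h2
  refine ContMDiffOn.congr h3 fun q hq => ?_
  simp only [Function.comp, tangentMapWithin, GRFlow.along]
  rw [mfderivWithin_of_isOpen hW hq]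

end FieldCalculus

/-! ### Invariance under the right action. -/

section Invariance

set_option linter.unusedSectionVars false

open scoped Topology

variable {EK : Type*} [NormedAddCommGroup EK] [NormedSpace ℝ EK]
  {K : Type*} [TopologicalSpace K] [Group K] [ChartedSpace EK K]
  {EM : Type*} [NormedAddCommGroup EM] [NormedSpace ℝ EM]
  {M : Type*} [TopologicalSpace M] [ChartedSpace EM M]
  {EP : Type*} [NormedAddCommGroup EP] [NormedSpace ℝ EP]
  {P : Type*} [TopologicalSpace P] [ChartedSpace EP P] [MulAction Kᵐᵒᵖ P]
  {π : P → M}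

variable (K) in
/-- Functions that are invariant under the right translations, at the points of `W`. -/
def InvFun (f : P → ℝ) (W : Set P) : Prop :=
  ∀ a : K, ∀ p ∈ W, f (MulOpposite.op a • p) = f p

lemma InvFun.mono {f : P → ℝ} {W W' : Set P} (hf : InvFun K f W) (h : W' ⊆ W) : InvFun K f W' :=
  fun a p hp => hf a p (h hp)

namespace IsPrincipalBundle

variable (hπ : IsPrincipalBundle EK K EM EP π)
include hπ

lemma contMDiff_act (a : K) :
    ContMDiff 𝓘(ℝ, EP) 𝓘(ℝ, EP) ∞ (fun q : P => MulOpposite.op a • q) :=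
  hπ.smooth_action.comp (contMDiff_id.prodMk contMDiff_const)

lemma mdifferentiableAt_act (a : K) (p : P) :
    MDifferentiableAt 𝓘(ℝ, EP) 𝓘(ℝ, EP) (fun q : P => MulOpposite.op a • q) p :=
  (hπ.contMDiff_act a).mdifferentiableAt (by simp)

/-- In a local trivialization the action changes only the group coordinate. -/
lemma proj_act (a : K) (p : P) : π (MulOpposite.op a • p) = π p := by
  obtain ⟨U, φ, ψ, -, hx, -, -, h1, h2, h3⟩ := hπ.locally_trivial (π p)
  have hp := h2 p hx
  rw [← hp, ← h3 _ hx, (h1 _ hx _).1, (h1 _ hx _).1]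

lemma act_mem {U : Set M} (a : K) {p : P} (hp : p ∈ π ⁻¹' U) :
    MulOpposite.op a • p ∈ π ⁻¹' U := by
  simpa only [Set.mem_preimage, hπ.proj_act] using hp

lemma isOpen_preimage {U : Set M} (hU : IsOpen U) : IsOpen (π ⁻¹' U) :=
  hU.preimage hπ.smooth_proj.continuous

lemma mdifferentiableAt_proj (p : P) : MDifferentiableAt 𝓘(ℝ, EP) 𝓘(ℝ, EM) π p :=
  hπ.smooth_proj.mdifferentiableAt (by simp)

lemma mfderiv_act_inv (a : K) (p : P) :
    (mfderiv 𝓘(ℝ, EP) 𝓘(ℝ, EP) (fun q : P => MulOpposite.op a⁻¹ • q) (MulOpposite.op a • p)).comp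
      (mfderiv 𝓘(ℝ, EP) 𝓘(ℝ, EP) (fun q : P => MulOpposite.op a • q) p) =
    ContinuousLinearMap.id ℝ _ := by
  rw [← mfderiv_comp p (hπ.mdifferentiableAt_act _ _) (hπ.mdifferentiableAt_act _ _)]
  have : (fun q : P => MulOpposite.op a⁻¹ • q) ∘ (fun q : P => MulOpposite.op a • q) = id := by
    ext q; simp [smul_smul]
  rw [this, mfderiv_id]

lemma mfderiv_act_inv_apply (a : K) (p : P) (v : TangentSpace 𝓘(ℝ, EP) p) :
    mfderiv 𝓘(ℝ, EP) 𝓘(ℝ, EP) (fun q : P => MulOpposite.op a⁻¹ • q) (MulOpposite.op a • p)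
      (mfderiv 𝓘(ℝ, EP) 𝓘(ℝ, EP) (fun q : P => MulOpposite.op a • q) p v) = v :=
  congrArg (fun L : TangentSpace 𝓘(ℝ, EP) p →L[ℝ] _ => L v) (hπ.mfderiv_act_inv a p)

/-- `ContinuousLinearMap.inverse` is zero on non-invertible maps. Translation by `a⁻¹` supplies the
two one-sided inverses needed to evaluate it, and with it the pullback of fields under translations.
-/
lemma inverse_mfderiv_act (a : K) (p : P) (v : TangentSpace 𝓘(ℝ, EP) p) :
    (mfderiv 𝓘(ℝ, EP) 𝓘(ℝ, EP) (fun q : P => MulOpposite.op a • q) p).inverse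
      (mfderiv 𝓘(ℝ, EP) 𝓘(ℝ, EP) (fun q : P => MulOpposite.op a • q) p v) = v := by
  have h := hπ.mfderiv_act_inv a⁻¹ (MulOpposite.op a • p)
  have e : (MulOpposite.op a⁻¹ • MulOpposite.op a • p : P) = p := by simp [smul_smul]
  rw [inv_inv, e] at h
  rw [ContinuousLinearMap.inverse_eq h (hπ.mfderiv_act_inv a p)]
  exact hπ.mfderiv_act_inv_apply a p v

lemma mfderiv_act_inverse (a : K) (p : P) (v : TangentSpace 𝓘(ℝ, EP) (MulOpposite.op a • p)) :
    mfderiv 𝓘(ℝ, EP) 𝓘(ℝ, EP) (fun q : P => MulOpposite.op a • q) p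
      ((mfderiv 𝓘(ℝ, EP) 𝓘(ℝ, EP) (fun q : P => MulOpposite.op a • q) p).inverse v) = v := by
  have h := hπ.mfderiv_act_inv a⁻¹ (MulOpposite.op a • p)
  have e : (MulOpposite.op a⁻¹ • MulOpposite.op a • p : P) = p := by simp [smul_smul]
  rw [inv_inv, e] at h
  rw [ContinuousLinearMap.inverse_eq h (hπ.mfderiv_act_inv a p)]
  exact congrArg (fun L : TangentSpace 𝓘(ℝ, EP) (MulOpposite.op a • p) →L[ℝ] _ => L v) h

/-- The derivative of an invariant function along an invariant field is invariant. -/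
lemma invFun_along {U : Set M} (hU : IsOpen U) {X : VField EP P} {f : P → ℝ}
    (hX : InvariantFieldOn K X (π ⁻¹' U)) (hf : SmoothOn EP f (π ⁻¹' U))
    (hi : InvFun K f (π ⁻¹' U)) : InvFun K (along X f) (π ⁻¹' U) := by
  intro a p hp
  have h1 : along X (f ∘ fun q : P => MulOpposite.op a • q) p = along X f p :=
    along_congr rfl (Filter.eventuallyEq_of_mem ((hπ.isOpen_preimage hU).mem_nhds hp)
      fun q hq => hi a q hq)
  rw [← h1]
  unfold along
  rw [mfderiv_comp p (hf.mdifferentiableAt (hπ.isOpen_preimage hU) (hπ.act_mem a hp))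
    (hπ.mdifferentiableAt_act a p), ← hX a p hp]
  rfl

variable [IsManifold 𝓘(ℝ, EP) ∞ P]

/-- The bracket of invariant fields is invariant. -/
lemma invariant_brk [CompleteSpace EP] {U : Set M} (hU : IsOpen U) {X Y : VField EP P}
    (hX : SmoothFieldOn X (π ⁻¹' U)) (hY : SmoothFieldOn Y (π ⁻¹' U))
    (hXi : InvariantFieldOn K X (π ⁻¹' U)) (hYi : InvariantFieldOn K Y (π ⁻¹' U)) :
    InvariantFieldOn K (brk X Y) (π ⁻¹' U) := by
  intro a p hp
  have hW := hπ.isOpen_preimage hU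
  have : IsManifold 𝓘(ℝ, EP) (minSmoothness ℝ 3) P := IsManifold.of_le (n := ∞) (by
    rw [minSmoothness_of_isRCLikeNormedField]; exact WithTop.coe_le_coe.2 le_top)
  -- Pullback commutes with the bracket, and an invariant field is its own pullback under
  -- translations.
  have h := mpullback_mlieBracket (I := 𝓘(ℝ, EP)) (I' := 𝓘(ℝ, EP)) (n := ∞) (x₀ := p)
    (f := fun q : P => MulOpposite.op a • q)
    (hX.mdifferentiableAt hW (hπ.act_mem a hp)) (hY.mdifferentiableAt hW (hπ.act_mem a hp))
    ((hπ.contMDiff_act a).contMDiffAt) (by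
      rw [minSmoothness_of_isRCLikeNormedField]; exact WithTop.coe_le_coe.2 le_top)
  have pull : ∀ {Z : VField EP P}, InvariantFieldOn K Z (π ⁻¹' U) → ∀ q ∈ π ⁻¹' U,
      mpullback 𝓘(ℝ, EP) 𝓘(ℝ, EP) (fun q : P => MulOpposite.op a • q) Z q = Z q := by
    intro Z hZ q hq
    rw [mpullback_apply, ← hZ a q hq, hπ.inverse_mfderiv_act]
  have h2 := brk_congr hW hp (pull hXi) (pull hYi)
  rw [← h2]
  unfold brk
  rw [← h, mpullback_apply, hπ.mfderiv_act_inverse]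

end IsPrincipalBundle

lemma InvariantFieldOn.sub {X Y : VField EP P} {W : Set P} (hX : InvariantFieldOn K X W)
    (hY : InvariantFieldOn K Y W) : InvariantFieldOn K (X - Y) W := fun a p hp => by
  simp only [Pi.sub_apply, map_sub, hX a p hp, hY a p hp]

lemma InvariantFieldOn.smul {X : VField EP P} {f : P → ℝ} {W : Set P} (hf : InvFun K f W)
    (hX : InvariantFieldOn K X W) : InvariantFieldOn K (f • X) W := fun a p hp => by
  simp only [Pi.smul_apply', map_smul, hX a p hp, hf a p hp]

lemma InvariantFieldOn.sum {ι : Type*} [Fintype ι] {X : ι → VField EP P} {W : Set P}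
    (hX : ∀ i, InvariantFieldOn K (X i) W) : InvariantFieldOn K (∑ i, X i) W := fun a p hp => by
  simp only [Finset.sum_apply, map_sum, hX _ a p hp]

lemma InvariantFieldOn.mono {X : VField EP P} {W W' : Set P} (hX : InvariantFieldOn K X W)
    (h : W' ⊆ W) : InvariantFieldOn K X W' := fun a p hp => hX a p (h hp)

end Invariance

/-! ### Local sections over a one-dimensional base: invariant functions as functions of one
variable. -/

section Slices

set_option linter.unusedSectionVars false

open scoped Topology

variable {EK : Type*} [NormedAddCommGroup EK] [NormedSpace ℝ EK]
  {K : Type*} [TopologicalSpace K] [Group K] [ChartedSpace EK K]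
  {M : Type*} [TopologicalSpace M] [ChartedSpace (EuclideanSpace ℝ (Fin 1)) M]
  {EP : Type*} [NormedAddCommGroup EP] [NormedSpace ℝ EP]
  {P : Type*} [TopologicalSpace P] [ChartedSpace EP P] [MulAction Kᵐᵒᵖ P]
  {π : P → M}

variable (K EP) in
/-- A coordinate `z` on the open set `U` of the one-dimensional base, and a smooth section `σ` of
the bundle over `U`, written in this coordinate. -/
structure Slice (π : P → M) (U : Set M) (z : M → ℝ) (σ : ℝ → P) (I : Set ℝ) : Prop where
  isOpen : IsOpen U
  isOpen_coord : IsOpen I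
  smooth_coord : ContMDiffOn 𝓘(ℝ, EuclideanSpace ℝ (Fin 1)) 𝓘(ℝ, ℝ) ∞ z U
  smooth_section : ContMDiffOn 𝓘(ℝ, ℝ) 𝓘(ℝ, EP) ∞ σ I
  coord_mem : ∀ y ∈ U, z y ∈ I
  section_mem : ∀ x ∈ I, σ x ∈ π ⁻¹' U
  coord_section : ∀ x ∈ I, z (π (σ x)) = x
  exists_act : ∀ p ∈ π ⁻¹' U, ∃ a : K, p = MulOpposite.op a • σ (z (π p))

lemma Slice.restrict {U : Set M} {z : M → ℝ} {σ : ℝ → P} {I : Set ℝ} (h : Slice K EP π U z σ I)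
    (hπ : IsPrincipalBundle EK K (EuclideanSpace ℝ (Fin 1)) EP π)
    {U' : Set M} (hU' : IsOpen U') (hs : U' ⊆ U) :
    Slice K EP π U' z σ (I ∩ σ ⁻¹' (π ⁻¹' U')) where
  isOpen := hU'
  isOpen_coord := h.smooth_section.continuousOn.isOpen_inter_preimage h.isOpen_coord
    (hπ.isOpen_preimage hU')
  smooth_coord := h.smooth_coord.mono hs
  smooth_section := h.smooth_section.mono Set.inter_subset_left
  coord_mem y hy := by
    refine ⟨h.coord_mem y (hs hy), ?_⟩
    obtain ⟨W, φ, ψ, -, hx, -, -, h1, -⟩ := hπ.locally_trivial y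
    have hy' : π (φ (y, 1)) = y := (h1 y hx 1).1
    obtain ⟨a, ha⟩ := h.exists_act (φ (y, 1)) (by simpa only [Set.mem_preimage, hy'] using hs hy)
    rw [Set.mem_preimage, Set.mem_preimage]
    have := congrArg π ha
    rw [hπ.proj_act, hy'] at this
    rwa [← this]
  section_mem x hx := hx.2
  coord_section x hx := h.coord_section x hx.1
  exists_act p hp := h.exists_act p (hs hp)

/-- The section is the identity section of a local trivialization, read in a chart of the base; `e`
and `e'` identify the model space with `ℝ`. -/
lemma exists_slice [IsManifold 𝓘(ℝ, EuclideanSpace ℝ (Fin 1)) ∞ M]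
    (hπ : IsPrincipalBundle EK K (EuclideanSpace ℝ (Fin 1)) EP π) (x₀ : M) :
    ∃ U z σ I, x₀ ∈ U ∧ Slice K EP π U z σ I := by
  obtain ⟨U, φ, ψ, hU, hx, hφ, -, h1, h2, h3⟩ := hπ.locally_trivial x₀
  set χ := chartAt (EuclideanSpace ℝ (Fin 1)) x₀ with hχ
  let e : EuclideanSpace ℝ (Fin 1) →L[ℝ] ℝ := EuclideanSpace.proj 0
  let e' : ℝ →L[ℝ] EuclideanSpace ℝ (Fin 1) :=
    (ContinuousLinearMap.id ℝ ℝ).smulRight (EuclideanSpace.single 0 1)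
  have ee' : ∀ x, e (e' x) = x := fun x => by simp [e, e']
  have e'e : ∀ v, e' (e v) = v := fun v => by
    ext i; fin_cases i; simp [e, e']
  let V : Set (EuclideanSpace ℝ (Fin 1)) := χ.target ∩ χ.symm ⁻¹' U
  have hV : IsOpen V := χ.isOpen_inter_preimage_symm hU
  have hχs : ContMDiffOn 𝓘(ℝ, EuclideanSpace ℝ (Fin 1)) 𝓘(ℝ, EuclideanSpace ℝ (Fin 1)) ∞ χ.symm
    χ.target := contMDiffOn_chart_symm
  have hχc : ContMDiffOn 𝓘(ℝ, EuclideanSpace ℝ (Fin 1)) 𝓘(ℝ, EuclideanSpace ℝ (Fin 1)) ∞ χ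
    χ.source := contMDiffOn_chart
  refine ⟨U ∩ χ.source, fun y => e (χ y), fun x => φ (χ.symm (e' x), 1), e' ⁻¹' V,
    ⟨hx, mem_chart_source _ x₀⟩, ?_⟩
  refine ⟨hU.inter χ.open_source, hV.preimage e'.continuous, ?_, ?_, ?_, ?_, ?_, ?_⟩
  · exact e.contMDiff.comp_contMDiffOn (hχc.mono Set.inter_subset_right)
  · refine hφ.comp (t := U ×ˢ Set.univ) (ContMDiffOn.prodMk
      (hχs.comp e'.contMDiff.contMDiffOn (fun x hx => hx.1)) contMDiffOn_const) ?_
    intro x hx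
    exact ⟨hx.2, trivial⟩
  · rintro y ⟨hy1, hy2⟩
    simp only [Set.mem_preimage, e'e]
    exact ⟨χ.map_source hy2, by simpa [χ.left_inv hy2] using hy1⟩
  · intro x hx
    rw [Set.mem_preimage, (h1 _ hx.2 1).1]
    exact ⟨hx.2, χ.map_target hx.1⟩
  · intro x hx
    rw [(h1 _ hx.2 1).1, χ.right_inv hx.1, ee']
  · rintro p ⟨hp1, hp2⟩
    refine ⟨ψ p, ?_⟩
    rw [e'e, χ.left_inv hp2, ← h3 _ hp1, one_mul, h2 p hp1]

namespace Slice

variable {U : Set M} {z : M → ℝ} {σ : ℝ → P} {I : Set ℝ} (h : Slice K EP π U z σ I)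
  (hπ : IsPrincipalBundle EK K (EuclideanSpace ℝ (Fin 1)) EP π)
include h

/-- Each point over `U` is a translate of the section point with the same coordinate. -/
lemma eq_section {f : P → ℝ} (hf : InvFun K f (π ⁻¹' U)) {p : P} (hp : p ∈ π ⁻¹' U) :
    f p = f (σ (z (π p))) := by
  obtain ⟨a, ha⟩ := h.exists_act p hp
  conv_lhs => rw [ha]
  exact hf a _ (h.section_mem _ (h.coord_mem _ hp))

lemma contDiffOn_comp_section {f : P → ℝ} (hf : SmoothOn EP f (π ⁻¹' U)) :
    ContDiffOn ℝ ∞ (f ∘ σ) I :=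
  contMDiffOn_iff_contDiffOn.1 (ContMDiffOn.comp hf h.smooth_section h.section_mem)

include hπ

lemma smoothOn_coord : SmoothOn EP (z ∘ π) (π ⁻¹' U) :=
  h.smooth_coord.comp hπ.smooth_proj.contMDiffOn (fun _ hp => hp)

lemma along_eq {f : P → ℝ} (hf : InvFun K f (π ⁻¹' U)) {p : P} (hp : p ∈ π ⁻¹' U)
    (hd : DifferentiableAt ℝ (f ∘ σ) (z (π p))) (Y : VField EP P) :
    along Y f p = deriv (f ∘ σ) (z (π p)) * along Y (z ∘ π) p := by
  have hW := hπ.isOpen_preimage h.isOpen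
  have h1 : along Y f p = along Y ((f ∘ σ) ∘ (z ∘ π)) p :=
    along_congr rfl (Filter.eventuallyEq_of_mem (hW.mem_nhds hp) fun q hq => h.eq_section hf hq)
  have hz := (h.smoothOn_coord hπ).mdifferentiableAt hW hp
  rw [h1]
  have h2 := mfderiv_comp (I := 𝓘(ℝ, EP)) (I' := 𝓘(ℝ, ℝ)) (I'' := 𝓘(ℝ, ℝ)) p
    (g := f ∘ σ) (f := z ∘ π) hd.mdifferentiableAt hz
  unfold along
  rw [h2]
  have : mfderiv 𝓘(ℝ, ℝ) 𝓘(ℝ, ℝ) (f ∘ σ) ((z ∘ π) p) = fderiv ℝ (f ∘ σ) ((z ∘ π) p) :=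
    mfderiv_eq_fderiv
  rw [this]
  change fderiv ℝ (f ∘ σ) (z (π p)) (along Y (z ∘ π) p) = _
  rw [fderiv_eq_smul_deriv, smul_eq_mul, mul_comm]
  rfl

lemma along_vertical_coord {p : P} (hp : p ∈ π ⁻¹' U) {Y : VField EP P}
    (hY : mfderiv 𝓘(ℝ, EP) 𝓘(ℝ, EuclideanSpace ℝ (Fin 1)) π p (Y p) = 0) :
    along Y (z ∘ π) p = 0 := by
  have hz : MDifferentiableAt 𝓘(ℝ, EuclideanSpace ℝ (Fin 1)) 𝓘(ℝ, ℝ) z (π p) :=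
    (h.smooth_coord.contMDiffAt (h.isOpen.mem_nhds hp)).mdifferentiableAt (by simp)
  unfold along
  rw [mfderiv_comp p hz (hπ.mdifferentiableAt_proj p)]
  change mfderiv 𝓘(ℝ, EuclideanSpace ℝ (Fin 1)) 𝓘(ℝ, ℝ) z (π p)
    (mfderiv 𝓘(ℝ, EP) 𝓘(ℝ, EuclideanSpace ℝ (Fin 1)) π p (Y p)) = _
  rw [hY, map_zero]
  rfl

/-- Invariant functions are constant along vertical fields. -/
lemma along_vertical {f : P → ℝ} (hf : InvFun K f (π ⁻¹' U)) (hs : SmoothOn EP f (π ⁻¹' U))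
    {p : P} (hp : p ∈ π ⁻¹' U) {Y : VField EP P}
    (hY : mfderiv 𝓘(ℝ, EP) 𝓘(ℝ, EuclideanSpace ℝ (Fin 1)) π p (Y p) = 0) :
    along Y f p = 0 := by
  rw [h.along_eq hπ hf hp, h.along_vertical_coord hπ hp hY, mul_zero]
  exact ((h.contDiffOn_comp_section hs).contDiffAt
    (h.isOpen_coord.mem_nhds (h.coord_mem _ hp))).differentiableAt (by simp)

end Slice

end Slices

/-! ### Tangent vectors and brackets as derivations. -/

section Derivations

set_option linter.unusedSectionVars false

open scoped Topology

variable {EP : Type*} [NormedAddCommGroup EP] [NormedSpace ℝ EP] [CompleteSpace EP]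
  {P : Type*} [TopologicalSpace P] [ChartedSpace EP P] [IsManifold 𝓘(ℝ, EP) ∞ P]

/-- The bracket of vector fields is the commutator of derivations. -/
lemma along_brk {W : Set P} (hW : IsOpen W) {p : P} (hp : p ∈ W) {X Y Z : VField EP P}
    (hX : SmoothFieldOn X W) (hY : SmoothFieldOn Y W) (hZ : SmoothFieldOn Z W) (hZp : Z p ≠ 0)
    {f : P → ℝ} (hf : SmoothOn EP f W) :
    along (brk X Y) f p = along X (along Y f) p - along Y (along X f) p := by
  -- The commutator formula is extracted from the Jacobi identity for `X`, `Y` and `f • Z`. After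
  -- expansion by the Leibniz rule and subtraction of `f` times the Jacobi identity for `X`, `Y`,
  -- `Z`, what remains is the desired equation multiplied by `Z p ≠ 0`.
  have leib : ∀ {U : VField EP P}, SmoothFieldOn U W → ∀ q ∈ W,
      brk U (f • Z) q = (along U f • Z + f • brk U Z) q :=
    fun hU q hq => brk_smul_right hW hq hf hZ
  have second : ∀ {U V : VField EP P}, SmoothFieldOn U W → SmoothFieldOn V W →
      brk V (brk U (f • Z)) p = along V (along U f) p • Z p + along U f p • brk V Z p
        + (along V f p • brk U Z p + f p • brk V (brk U Z) p) := by
    intro U V hU hV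
    rw [brk_congr hW hp (fun _ _ => rfl) (leib hU),
      brk_add_right hW hp (SmoothFieldOn.smul (hf.along hW hU) hZ)
        (SmoothFieldOn.smul hf (hU.brk hW hZ)),
      brk_smul_right hW hp (hf.along hW hU) hZ, brk_smul_right hW hp hf (hU.brk hW hZ)]
  have j1 := brk_jacobi hW hp hX hY (SmoothFieldOn.smul hf hZ)
  have j2 := brk_jacobi hW hp hX hY hZ
  rw [second hY hX, second hX hY, leib (hX.brk hW hY) p hp, j2] at j1
  simp only [Pi.add_apply, Pi.smul_apply'] at j1
  have : (along X (along Y f) p - along Y (along X f) p - along (brk X Y) f p) • Z p = 0 := by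
    rw [← sub_eq_zero] at j1
    rw [← j1]
    module
  have h0 := (smul_eq_zero.1 this).resolve_right hZp
  linarith

/-- Smooth functions separate tangent vectors. -/
lemma tangent_ext {W : Set P} (hW : IsOpen W) {p : P} (hp : p ∈ W)
    {v w : TangentSpace 𝓘(ℝ, EP) p}
    (h : ∀ (W' : Set P) (f : P → ℝ), IsOpen W' → p ∈ W' → W' ⊆ W → SmoothOn EP f W' →
      mfderiv 𝓘(ℝ, EP) 𝓘(ℝ, ℝ) f p v = mfderiv 𝓘(ℝ, EP) 𝓘(ℝ, ℝ) f p w) : v = w := by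
  -- The derivative of a chart is injective, so it suffices to test with the functions `l ∘ chart`,
  -- `l` a continuous functional on the model space.
  have hinv := isInvertible_mfderiv_extChartAt (I := 𝓘(ℝ, EP)) (mem_extChartAt_source p)
  refine hinv.injective ((SeparatingDual.eq_iff_forall_dual_eq (R := ℝ) (V := EP)).2 fun l => ?_)
  have hs : ContMDiffOn 𝓘(ℝ, EP) 𝓘(ℝ, EP) ∞ (extChartAt 𝓘(ℝ, EP) p) (chartAt EP p).source :=
    contMDiffOn_extChartAt
  have hd : MDifferentiableAt 𝓘(ℝ, EP) 𝓘(ℝ, EP) (extChartAt 𝓘(ℝ, EP) p) p :=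
    mdifferentiableAt_extChartAt (mem_chart_source _ p)
  have key := h (W ∩ (chartAt EP p).source) (l ∘ extChartAt 𝓘(ℝ, EP) p)
    (hW.inter (chartAt EP p).open_source) ⟨hp, mem_chart_source _ p⟩ Set.inter_subset_left
    (l.contMDiff.comp_contMDiffOn (hs.mono Set.inter_subset_right))
  have hl : MDifferentiableAt 𝓘(ℝ, EP) 𝓘(ℝ, ℝ) l (extChartAt 𝓘(ℝ, EP) p p) :=
    (l.contMDiff (n := 1)).mdifferentiableAt (by simp)
  have hc := mfderiv_comp p hl hd
  rw [hc] at key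
  have hl' : mfderiv 𝓘(ℝ, EP) 𝓘(ℝ, ℝ) l (extChartAt 𝓘(ℝ, EP) p p) = l := by
    rw [mfderiv_eq_fderiv]; exact l.fderiv
  rw [hl'] at key
  exact key

end Derivations

/-! ### Vector fields generated by smooth families of maps. -/

section Families

set_option linter.unusedSectionVars false

open scoped Topology

variable {EP : Type*} [NormedAddCommGroup EP] [NormedSpace ℝ EP]
  {P : Type*} [TopologicalSpace P] [ChartedSpace EP P] [IsManifold 𝓘(ℝ, EP) ∞ P]
  {EN : Type*} [NormedAddCommGroup EN] [NormedSpace ℝ EN]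
  {N : Type*} [TopologicalSpace N] [ChartedSpace EN N] [IsManifold 𝓘(ℝ, EN) ∞ N]

/-- The vector field of initial velocities, in the direction `w`, of a family `Θ` of maps
`N → P` with `Θ (p, n₀) = p`. -/
noncomputable def familyField (Θ : P × N → P) (n₀ : N) (w : TangentSpace 𝓘(ℝ, EN) n₀) :
    VField EP P :=
  fun p => (mfderiv 𝓘(ℝ, EN) 𝓘(ℝ, EP) (fun n => Θ (p, n)) n₀ w : EP)

lemma smoothFieldOn_family {Θ : P × N → P} {n₀ : N} (w : TangentSpace 𝓘(ℝ, EN) n₀)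
    {Ω : Set (P × N)} (hΩ : IsOpen Ω)
    (hΘ : ContMDiffOn (𝓘(ℝ, EP).prod 𝓘(ℝ, EN)) 𝓘(ℝ, EP) ∞ Θ Ω) {W : Set P}
    (hW : ∀ p ∈ W, (p, n₀) ∈ Ω) (hid : ∀ p ∈ W, Θ (p, n₀) = p) :
    SmoothFieldOn (familyField (EP := EP) Θ n₀ w) W := by
  have : IsManifold 𝓘(ℝ, EN) 1 N := IsManifold.of_le (n := ∞) (by simp)
  have : IsManifold 𝓘(ℝ, EP) 1 P := IsManifold.of_le (n := ∞) (by simp)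
  -- The field is the tangent map of `Θ` evaluated along the smooth section `p ↦ (0, w)` of the
  -- tangent bundle of the product, over the points `(p, n₀)`.
  have sfg : ContMDiff 𝓘(ℝ, EP) 𝓘(ℝ, EP).tangent ∞
      (fun g : P => (⟨g, 0⟩ : TangentBundle 𝓘(ℝ, EP) P)) := Bundle.contMDiff_zeroSection _ _
  have sfv : ContMDiff 𝓘(ℝ, EP) 𝓘(ℝ, EN).tangent ∞
      (fun _ : P => (⟨n₀, w⟩ : TangentBundle 𝓘(ℝ, EN) N)) := contMDiff_const
  have S₂ := (contMDiff_equivTangentBundleProd_symm (n := ∞) (I := 𝓘(ℝ, EP)) (M := P)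
    (I' := 𝓘(ℝ, EN)) (M' := N)).comp (sfg.prodMk sfv)
  have S₃ := (hΘ.contMDiffOn_tangentMapWithin (m := ∞) (by simp) hΩ.uniqueMDiffOn).comp
    (S₂.contMDiffOn (s := W)) (fun p hp => hW p hp)
  refine ContMDiffOn.congr S₃ fun p hp => ?_
  have hd : MDifferentiableAt (𝓘(ℝ, EP).prod 𝓘(ℝ, EN)) 𝓘(ℝ, EP) Θ (p, n₀) :=
    (hΘ.contMDiffAt (hΩ.mem_nhds (hW p hp))).mdifferentiableAt (by simp)
  have key := mfderiv_prod_eq_add_apply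
    (v := ((0, w) : TangentSpace (𝓘(ℝ, EP).prod 𝓘(ℝ, EN)) ((p, n₀) : P × N))) hd
  have aux : ∀ {x y : P} (v : EP), x = y →
      (⟨x, v⟩ : TangentBundle 𝓘(ℝ, EP) P) = ⟨y, v⟩ := by
    rintro x _ v rfl; rfl
  simp only [Function.comp_apply, tangentMapWithin, equivTangentBundleProd, Equiv.coe_fn_symm_mk]
  rw [mfderivWithin_of_isOpen hΩ (hW p hp)]
  have key2 : (mfderiv (𝓘(ℝ, EP).prod 𝓘(ℝ, EN)) 𝓘(ℝ, EP) Θ (p, n₀) (0, w) : EP) =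
      familyField Θ n₀ w p := by
    refine Eq.trans key ?_
    erw [map_zero, zero_add]
    rfl
  erw [key2]
  exact (aux _ (hid p hp)).symm

/-- The field is invariant when the maps of the family are equivariant. -/
lemma invariantFieldOn_family {EK : Type*} [NormedAddCommGroup EK] [NormedSpace ℝ EK]
    {K : Type*} [TopologicalSpace K] [Group K] [ChartedSpace EK K]
    {EM : Type*} [NormedAddCommGroup EM] [NormedSpace ℝ EM]
    {M : Type*} [TopologicalSpace M] [ChartedSpace EM M] [MulAction Kᵐᵒᵖ P]
    {π : P → M} (hπ : IsPrincipalBundle EK K EM EP π)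
    {Θ : P × N → P} {n₀ : N} (w : TangentSpace 𝓘(ℝ, EN) n₀)
    {Ω : Set (P × N)} (hΩ : IsOpen Ω)
    (hΘ : ContMDiffOn (𝓘(ℝ, EP).prod 𝓘(ℝ, EN)) 𝓘(ℝ, EP) ∞ Θ Ω) {W : Set P}
    (hW : ∀ p ∈ W, (p, n₀) ∈ Ω) (hid : ∀ p ∈ W, Θ (p, n₀) = p)
    (hinv : ∀ (a : K) (p : P) (n : N), (p, n) ∈ Ω →
      Θ (MulOpposite.op a • p, n) = MulOpposite.op a • Θ (p, n)) :
    InvariantFieldOn K (familyField (EP := EP) Θ n₀ w) W := by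
  intro a p hp
  have hd : MDifferentiableAt 𝓘(ℝ, EN) 𝓘(ℝ, EP) (fun n => Θ (p, n)) n₀ := by
    have h1 : MDifferentiableAt (𝓘(ℝ, EP).prod 𝓘(ℝ, EN)) 𝓘(ℝ, EP) Θ (p, n₀) :=
      (hΘ.contMDiffAt (hΩ.mem_nhds (hW p hp))).mdifferentiableAt (by simp)
    exact h1.comp n₀ (mdifferentiableAt_const.prodMk mdifferentiableAt_id)
  have hev : (fun n => Θ (MulOpposite.op a • p, n)) =ᶠ[𝓝 n₀]
      (fun q : P => MulOpposite.op a • q) ∘ (fun n => Θ (p, n)) := by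
    have : ∀ᶠ n in 𝓝 n₀, (p, n) ∈ Ω :=
      (Continuous.prodMk_right p).continuousAt.preimage_mem_nhds (hΩ.mem_nhds (hW p hp))
    filter_upwards [this] with n hn using hinv a p n hn
  unfold familyField
  rw [hev.mfderiv_eq, mfderiv_comp n₀ (hπ.mdifferentiableAt_act a _) hd, hid p hp]
  rfl

end Families

/-! ### Orbit maps and the Lie algebra of the structure group. -/

section Orbits

/-- Base points of derivatives may be replaced by equal ones. -/
lemma mfderiv_point_congr {E E' : Type*} [NormedAddCommGroup E] [NormedSpace ℝ E]
    [NormedAddCommGroup E'] [NormedSpace ℝ E'] {N N' : Type*} [TopologicalSpace N]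
    [ChartedSpace E N] [TopologicalSpace N'] [ChartedSpace E' N'] (f : N → N') {x y : N}
    (h : x = y) (v : E) :
    (mfderiv 𝓘(ℝ, E) 𝓘(ℝ, E') f x v : E') = mfderiv 𝓘(ℝ, E) 𝓘(ℝ, E') f y v := by
  subst h; rfl

set_option linter.unusedSectionVars false

open scoped Topology

variable {EK : Type*} [NormedAddCommGroup EK] [NormedSpace ℝ EK] [CompleteSpace EK]
  {K : Type*} [TopologicalSpace K] [Group K] [ChartedSpace EK K] [LieGroup 𝓘(ℝ, EK) ∞ K]

/-- Left-invariant vector fields on a smooth Lie group are smooth. -/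
lemma smoothFieldOn_mulInvariant (v : GroupLieAlgebra 𝓘(ℝ, EK) K) :
    SmoothFieldOn (mulInvariantVectorField v : VField EK K) Set.univ :=
  (smoothFieldOn_family (Θ := fun z : K × K => z.1 * z.2) v isOpen_univ
    (contMDiff_mul 𝓘(ℝ, EK) ∞ (G := K)).contMDiffOn (fun _ _ => trivial)
    (fun p _ => mul_one p)).congr fun _ _ => rfl

variable {EM : Type*} [NormedAddCommGroup EM] [NormedSpace ℝ EM]
  {M : Type*} [TopologicalSpace M] [ChartedSpace EM M]
  {EP : Type*} [NormedAddCommGroup EP] [NormedSpace ℝ EP]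
  {P : Type*} [TopologicalSpace P] [ChartedSpace EP P] [MulAction Kᵐᵒᵖ P]
  {π : P → M}

variable (K) in
/-- The orbit map `a ↦ p · a⁻¹`. -/
def orbitMap (p : P) : K → P := fun a => MulOpposite.op a⁻¹ • p

lemma orbitMap_one (p : P) : orbitMap K p 1 = p := by simp [orbitMap]

/-- The tangent map of the orbit map at the identity. -/
noncomputable def orbitTangent (EP : Type*) [NormedAddCommGroup EP] [NormedSpace ℝ EP]
    {P : Type*} [TopologicalSpace P] [ChartedSpace EP P] [MulAction Kᵐᵒᵖ P]
    (p : P) (v : GroupLieAlgebra 𝓘(ℝ, EK) K) : TangentSpace 𝓘(ℝ, EP) p :=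
  (mfderiv 𝓘(ℝ, EK) 𝓘(ℝ, EP) (orbitMap K p) 1 v : EP)

namespace IsPrincipalBundle

variable (hπ : IsPrincipalBundle EK K EM EP π)
include hπ

lemma contMDiff_orbitMap (p : P) : ContMDiff 𝓘(ℝ, EK) 𝓘(ℝ, EP) ∞ (orbitMap K p) :=
  hπ.smooth_action.comp (contMDiff_const.prodMk (contMDiff_inv 𝓘(ℝ, EK) ∞))

/-- The orbit map relates left-invariant fields to invariant fields. -/
lemma orbitMap_related {W : Set P} {X : VField EP P} (hX : InvariantFieldOn K X W) {p : P}
    (hp : p ∈ W) {v : GroupLieAlgebra 𝓘(ℝ, EK) K} (hv : orbitTangent EP p v = X p) (a : K) :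
    mfderiv 𝓘(ℝ, EK) 𝓘(ℝ, EP) (orbitMap K p) a (mulInvariantVectorField v a)
      = X (orbitMap K p a) := by
  -- The inverse in the orbit map turns left multiplication by `a` into the right action of `a⁻¹`.
  -- Left-invariant fields therefore match invariant fields, and brackets match without a sign.
  have h1 : (orbitMap K p) ∘ (fun b => a * b)
      = (fun q : P => MulOpposite.op a⁻¹ • q) ∘ orbitMap K p := by
    ext b; simp [orbitMap, smul_smul]
  have hd : ∀ b, MDifferentiableAt 𝓘(ℝ, EK) 𝓘(ℝ, EP) (orbitMap K p) b :=
    fun b => (hπ.contMDiff_orbitMap p).mdifferentiableAt (by simp)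
  have hm : MDifferentiableAt 𝓘(ℝ, EK) 𝓘(ℝ, EK) (fun b => a * b) (1 : K) :=
    (contMDiff_mul_left (I := 𝓘(ℝ, EK)) (n := ∞)).mdifferentiableAt (by simp)
  have e1 := mfderiv_comp (1 : K) (hd _) hm
  have e2 := mfderiv_comp (1 : K) (hπ.mdifferentiableAt_act a⁻¹ (orbitMap K p 1)) (hd 1)
  rw [h1, e2] at e1
  have e3 := congrArg (fun L : EK →L[ℝ] EP => L v) e1
  have e4 := hX a⁻¹ p hp
  rw [← hv] at e4
  have e5 : mfderiv 𝓘(ℝ, EK) 𝓘(ℝ, EP) (orbitMap K p) (a * 1) (mulInvariantVectorField v a)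
      = X (orbitMap K p a) := by
    exact Eq.trans e3.symm (Eq.trans (mfderiv_point_congr _ (orbitMap_one p) _) e4)
  rwa [mul_one] at e5

lemma along_orbitMap {W : Set P} {X : VField EP P} (hX : InvariantFieldOn K X W)
    {p : P} (hp : p ∈ W) {v : GroupLieAlgebra 𝓘(ℝ, EK) K} (hv : orbitTangent EP p v = X p)
    {f : P → ℝ} {W' : Set P} (hW' : IsOpen W') (hf : SmoothOn EP f W') {a : K}
    (ha : orbitMap K p a ∈ W') :
    along (mulInvariantVectorField v : VField EK K) (f ∘ orbitMap K p) a
      = along X f (orbitMap K p a) := by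
  unfold along
  rw [mfderiv_comp a (hf.mdifferentiableAt hW' ha)
    ((hπ.contMDiff_orbitMap p).mdifferentiableAt (by simp)), ← hπ.orbitMap_related hX hp hv a]
  rfl

/-- Vertical vectors are tangent to the orbits, and the orbit map is an immersion. -/
lemma exists_orbitTangent (p : P) :
    Function.Injective (orbitTangent (K := K) (EK := EK) EP p) ∧
    ∀ w : TangentSpace 𝓘(ℝ, EP) p, mfderiv 𝓘(ℝ, EP) 𝓘(ℝ, EM) π p w = 0 →
      ∃ v : GroupLieAlgebra 𝓘(ℝ, EK) K, orbitTangent EP p v = w := by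
  obtain ⟨U, φ, ψ, hU, hx, hφ, hψ, h1, h2, h3⟩ := hπ.locally_trivial (π p)
  have hW := hπ.isOpen_preimage hU
  have hp : p ∈ π ⁻¹' U := hx
  -- `q` is a left inverse of the orbit map: it recovers `a` from `p · a⁻¹`. This gives injectivity;
  -- the composite in the other order is `p' ↦ φ (π p, ψ p')`.
  let q : P → K := fun p' => (ψ p')⁻¹ * ψ p
  have orb : ∀ a, orbitMap K p a = φ (π p, ψ p * a⁻¹) := fun a => by
    rw [h3 _ hx, h2 p hp, orbitMap]
  have hψd : MDifferentiableAt 𝓘(ℝ, EP) 𝓘(ℝ, EK) ψ p :=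
    (hψ.contMDiffAt (hW.mem_nhds hp)).mdifferentiableAt (by simp)
  have hqd : MDifferentiableAt 𝓘(ℝ, EP) 𝓘(ℝ, EK) q p := by
    have g1 : MDifferentiableAt 𝓘(ℝ, EK) 𝓘(ℝ, EK) (fun c : K => c⁻¹ * ψ p) (ψ p) :=
      ((contMDiff_mul_right (I := 𝓘(ℝ, EK)) (n := ∞) (a := ψ p)).comp
        (contMDiff_inv 𝓘(ℝ, EK) ∞)).mdifferentiableAt (by simp)
    exact g1.comp p hψd
  have hod : MDifferentiableAt 𝓘(ℝ, EK) 𝓘(ℝ, EP) (orbitMap K p) 1 :=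
    (hπ.contMDiff_orbitMap p).mdifferentiableAt (by simp)
  constructor
  · have hc : q ∘ orbitMap K p = id := by
      ext a
      simp [q, orb, (h1 _ hx _).2]
    have hqd' : MDifferentiableAt 𝓘(ℝ, EP) 𝓘(ℝ, EK) q (orbitMap K p 1) := by
      rwa [orbitMap_one]
    have e1 := mfderiv_comp (1 : K) hqd' hod
    rw [hc, mfderiv_id] at e1
    intro v w hvw
    have e2 := fun u : EK => congrArg (fun L : EK →L[ℝ] EK => L u) e1
    refine (e2 v).trans (Eq.trans ?_ (e2 w).symm)
    exact congrArg (fun u : EP => (mfderiv 𝓘(ℝ, EP) 𝓘(ℝ, EK) q (orbitMap K p 1) u : EK)) hvw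
  · intro w hw
    refine ⟨(mfderiv 𝓘(ℝ, EP) 𝓘(ℝ, EK) q p w : EK), ?_⟩
    have hq1 : q p = 1 := by simp [q]
    have e1 := mfderiv_comp p (g := orbitMap K p) (f := q) (by rwa [hq1]) hqd
    have hc : orbitMap K p ∘ q = φ ∘ (fun p' => (π p, ψ p')) := by
      ext p'
      simp [q, orb]
    -- The identity is locally `p' ↦ φ (π p', ψ p')`. Freezing the base component does not change
    -- its derivative on a vertical vector, so `orbitMap ∘ q` fixes vertical vectors to first order.
    have hid : (id : P → P) =ᶠ[𝓝 p] φ ∘ (fun p' => (π p', ψ p')) :=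
      Filter.eventuallyEq_of_mem (hW.mem_nhds hp) fun p' hp' => (h2 p' hp').symm
    have hφd : MDifferentiableAt (𝓘(ℝ, EM).prod 𝓘(ℝ, EK)) 𝓘(ℝ, EP) φ (π p, ψ p) :=
      (hφ.contMDiffAt ((hU.prod isOpen_univ).mem_nhds ⟨hx, trivial⟩)).mdifferentiableAt (by simp)
    have e2 := mfderiv_comp p (g := φ) (f := fun p' => (π p', ψ p')) hφd
      ((hπ.mdifferentiableAt_proj p).prodMk hψd)
    have e3 := mfderiv_comp p (g := φ) (f := fun p' => (π p, ψ p')) hφd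
      ((mdifferentiableAt_const (I' := 𝓘(ℝ, EM))).prodMk hψd)
    rw [mfderiv_prodMk (hπ.mdifferentiableAt_proj p) hψd, ← hid.mfderiv_eq, mfderiv_id] at e2
    rw [mfderiv_prodMk mdifferentiableAt_const hψd, mfderiv_const, ← hc, e1] at e3
    have e2' := congrArg (fun L : EP →L[ℝ] EP => L w) e2
    have e3' := congrArg (fun L : EP →L[ℝ] EP => L w) e3
    refine Eq.trans (mfderiv_point_congr _ hq1.symm _) (Eq.trans e3' (Eq.trans ?_ e2'.symm))
    refine congrArg (fun u : EM × EK =>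
      (mfderiv (𝓘(ℝ, EM).prod 𝓘(ℝ, EK)) 𝓘(ℝ, EP) φ (π p, ψ p) u : EP)) ?_
    exact Prod.ext hw.symm rfl

variable [IsManifold 𝓘(ℝ, EP) ∞ P] [CompleteSpace EP]

/-- The orbit map is compatible with brackets. -/
lemma orbitTangent_lie {U : Set M} (hU : IsOpen U) {X Y : VField EP P}
    (hX : SmoothFieldOn X (π ⁻¹' U)) (hY : SmoothFieldOn Y (π ⁻¹' U))
    (hXi : InvariantFieldOn K X (π ⁻¹' U)) (hYi : InvariantFieldOn K Y (π ⁻¹' U))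
    {p : P} (hp : p ∈ π ⁻¹' U) (hXp : X p ≠ 0) {v w : GroupLieAlgebra 𝓘(ℝ, EK) K}
    (hv : orbitTangent EP p v = X p) (hw : orbitTangent EP p w = Y p) :
    orbitTangent EP p ⁅v, w⁆ = brk X Y p := by
  have hW := hπ.isOpen_preimage hU
  have hv0 : v ≠ 0 := by
    rintro rfl
    apply hXp
    rw [← hv]
    unfold orbitTangent
    exact map_zero _
  -- The two vectors are compared as derivations: both brackets are commutators, and the orbit map
  -- intertwines the iterated derivatives.
  refine tangent_ext hW hp fun W' f hW' hp' hs hf => ?_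
  have hO : IsOpen (orbitMap K p ⁻¹' W') := hW'.preimage (hπ.contMDiff_orbitMap p).continuous
  have h1O : (1 : K) ∈ orbitMap K p ⁻¹' W' := by simpa [orbitMap_one] using hp'
  have hfo : SmoothOn EK (f ∘ orbitMap K p) (orbitMap K p ⁻¹' W') :=
    ContMDiffOn.comp hf (hπ.contMDiff_orbitMap p).contMDiffOn (fun _ h => h)
  have sm : ∀ u : GroupLieAlgebra 𝓘(ℝ, EK) K,
      SmoothFieldOn (mulInvariantVectorField u : VField EK K) (orbitMap K p ⁻¹' W') :=
    fun u => (smoothFieldOn_mulInvariant u).mono (Set.subset_univ _)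
  have hne : (mulInvariantVectorField v : VField EK K) 1 ≠ 0 := by
    have : (mulInvariantVectorField v : VField EK K) 1 = v := by
      have h1 : (fun x : K => 1 * x) = id := funext one_mul
      unfold mulInvariantVectorField
      rw [h1, mfderiv_id]
      rfl
    rwa [this]
  have c1 := along_brk hO h1O (sm v) (sm w) (sm v) hne hfo
  have c2 := along_brk hW' hp' (hX.mono hs) (hY.mono hs) (hX.mono hs) hXp hf
  have d : ∀ {Z Z' : VField EP P} {u u' : GroupLieAlgebra 𝓘(ℝ, EK) K},
      SmoothFieldOn Z' (π ⁻¹' U) →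
      InvariantFieldOn K Z (π ⁻¹' U) → InvariantFieldOn K Z' (π ⁻¹' U) →
      orbitTangent EP p u = Z p → orbitTangent EP p u' = Z' p →
      along (mulInvariantVectorField u : VField EK K)
        (along (mulInvariantVectorField u' : VField EK K) (f ∘ orbitMap K p)) 1
      = along Z (along Z' f) p := by
    intro Z Z' u u' hZ' hZi hZi' hu hu'
    have g1 : along (mulInvariantVectorField u : VField EK K)
        (along (mulInvariantVectorField u' : VField EK K) (f ∘ orbitMap K p)) 1
        = along (mulInvariantVectorField u : VField EK K) ((along Z' f) ∘ orbitMap K p) 1 :=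
      along_congr rfl (Filter.eventuallyEq_of_mem (hO.mem_nhds h1O) fun a ha =>
        hπ.along_orbitMap hZi' hp hu' hW' hf ha)
    rw [g1, hπ.along_orbitMap hZi hp hu hW' (hf.along hW' (hZ'.mono hs)) h1O, orbitMap_one]
  rw [d hY hXi hYi hv hw, d hX hYi hXi hw hv, ← c2] at c1
  have fin : along (brk (mulInvariantVectorField v : VField EK K) (mulInvariantVectorField w))
      (f ∘ orbitMap K p) 1
      = mfderiv 𝓘(ℝ, EP) 𝓘(ℝ, ℝ) f p (orbitTangent EP p ⁅v, w⁆) := by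
    unfold along
    have hf1 : MDifferentiableAt 𝓘(ℝ, EP) 𝓘(ℝ, ℝ) f (orbitMap K p 1) :=
      hf.mdifferentiableAt hW' h1O
    rw [mfderiv_comp (1 : K) hf1 ((hπ.contMDiff_orbitMap p).mdifferentiableAt (by simp))]
    exact mfderiv_point_congr f (orbitMap_one p) _
  rw [fin] at c1
  exact c1

end IsPrincipalBundle

end Orbits

/-! ### Three-dimensional nilpotent Lie algebras. -/

section Nilpotent

set_option linter.unusedSectionVars false

/-- `ad x` is nilpotent, and a nilpotent endomorphism has no nonzero eigenvalue. -/
lemma eq_zero_of_lie_eq_smul {L : Type*} [LieRing L] [LieAlgebra ℝ L] [LieRing.IsNilpotent L]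
    {x y : L} {c : ℝ} (hy : y ≠ 0) (h : ⁅x, y⁆ = c • y) : c = 0 := by
  obtain ⟨k, hk⟩ := LieModule.isNilpotent_toEnd_of_isNilpotent ℝ L L x
  have key : ∀ n : ℕ, ((LieModule.toEnd ℝ L L x) ^ n) y = c ^ n • y := by
    intro n
    induction n with
    | zero => simp
    | succ n ih =>
      rw [pow_succ', Module.End.mul_apply, ih, map_smul, LieModule.toEnd_apply_apply, h, smul_smul,
        pow_succ]
  have h0 := key k
  rw [hk, LinearMap.zero_apply] at h0
  exact eq_zero_of_pow_eq_zero ((smul_eq_zero.1 h0.symm).resolve_right hy)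

/-- In a nilpotent Lie algebra, if `z` is central then `[x, y]` has no components along `x` and
`y`, for `x`, `y`, `z` linearly independent. -/
lemma lie_coeff_eq_zero {L : Type*} [LieRing L] [LieAlgebra ℝ L] [LieRing.IsNilpotent L]
    {ξ : Fin 3 → L} (hξ : LinearIndependent ℝ ξ) (hz : ∀ i, ⁅ξ 2, ξ i⁆ = 0) {c : Fin 3 → ℝ}
    (h : ⁅ξ 0, ξ 1⁆ = ∑ k, c k • ξ k) : c 0 = 0 ∧ c 1 = 0 := by
  have hz' : ∀ i, ⁅ξ i, ξ 2⁆ = 0 := fun i => by rw [← lie_skew, hz, neg_zero]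
  have coeff : (∑ k, c k • ξ k) = 0 → ∀ k, c k = 0 := Fintype.linearIndependent_iff.1 hξ c
  by_cases h0 : ∑ k, c k • ξ k = 0
  · exact ⟨coeff h0 0, coeff h0 1⟩
  constructor
  -- Since `ξ 2` is central, `u = [ξ 0, ξ 1]` is an eigenvector of `ad (-ξ 1)` with eigenvalue `c
  -- 0`, and likewise of `ad (ξ 0)` with eigenvalue `c 1`.
  · have : ⁅-ξ 1, ∑ k, c k • ξ k⁆ = c 0 • ∑ k, c k • ξ k := by
      rw [← h, h, Fin.sum_univ_three]
      simp only [lie_add, lie_smul, neg_lie, hz', lie_self]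
      rw [← lie_skew, neg_neg, h, Fin.sum_univ_three]
      simp
    exact eq_zero_of_lie_eq_smul h0 this
  · have : ⁅ξ 0, ∑ k, c k • ξ k⁆ = c 1 • ∑ k, c k • ξ k := by
      rw [Fin.sum_univ_three]
      simp only [lie_add, lie_smul, hz', lie_self]
      rw [h, Fin.sum_univ_three]
      simp
    exact eq_zero_of_lie_eq_smul h0 this

/-- A nilpotent Lie algebra of dimension three has a basis whose last vector is central. -/
lemma exists_central_basis {L : Type*} [LieRing L] [LieAlgebra ℝ L] [LieRing.IsNilpotent L]
    (hd : Module.finrank ℝ L = 3) :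
    ∃ ξ : Fin 3 → L, LinearIndependent ℝ ξ ∧ ∀ x : L, ⁅ξ 2, x⁆ = 0 := by
  have : Nontrivial L := Module.nontrivial_of_finrank_pos (R := ℝ) (by omega)
  have : FiniteDimensional ℝ L := Module.finite_of_finrank_pos (by omega)
  have hc := LieAlgebra.non_trivial_center_of_isNilpotent (R := ℝ) (L := L)
  obtain ⟨⟨z, hz⟩, hz0⟩ := exists_ne (0 : LieAlgebra.center ℝ L)
  have hz0' : z ≠ 0 := fun h => hz0 (Subtype.ext h)
  have hzc : ∀ x : L, ⁅z, x⁆ = 0 := fun x => by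
    have := (LieModule.mem_maxTrivSubmodule ℝ L L z).1 hz x
    rw [← lie_skew, this, neg_zero]
  have h1 : LinearIndependent ℝ ![z] := by
    rw [linearIndependent_unique_iff]; simpa using hz0'
  obtain ⟨y, hy⟩ := exists_linearIndependent_cons_of_lt_finrank h1 (by omega)
  obtain ⟨x, hx⟩ := exists_linearIndependent_cons_of_lt_finrank hy (by omega)
  exact ⟨![x, y, z], hx, hzc⟩

variable {EK : Type*} [NormedAddCommGroup EK] [NormedSpace ℝ EK] [CompleteSpace EK]
  {K : Type*} [TopologicalSpace K] [Group K] [ChartedSpace EK K] [LieGroup 𝓘(ℝ, EK) ∞ K]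
  {EM : Type*} [NormedAddCommGroup EM] [NormedSpace ℝ EM]
  {M : Type*} [TopologicalSpace M] [ChartedSpace EM M]
  {EP : Type*} [NormedAddCommGroup EP] [NormedSpace ℝ EP] [CompleteSpace EP]
  {P : Type*} [TopologicalSpace P] [ChartedSpace EP P] [MulAction Kᵐᵒᵖ P]
  [IsManifold 𝓘(ℝ, EP) ∞ P] {π : P → M}

/-- The tangent map of the orbit map, as a linear map. -/
noncomputable def orbitTangentₗ (p : P) :
    GroupLieAlgebra 𝓘(ℝ, EK) K →ₗ[ℝ] TangentSpace 𝓘(ℝ, EP) p where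
  toFun := orbitTangent EP p
  map_add' v w := map_add (mfderiv 𝓘(ℝ, EK) 𝓘(ℝ, EP) (orbitMap K p) 1) v w
  map_smul' c v := map_smul (mfderiv 𝓘(ℝ, EK) 𝓘(ℝ, EP) (orbitMap K p) 1) c v

/-- Brackets of invariant vertical fields with nilpotent structure group. -/
lemma brk_coeff_eq_zero (hK : IsNilpotentLieGroup (E := EK) K) (hπ : IsPrincipalBundle EK K EM EP π)
    {U : Set M} (hU : IsOpen U) {e : Fin 3 → VField EP P}
    (he : ∀ i, SmoothFieldOn (e i) (π ⁻¹' U)) (hi : ∀ i, InvariantFieldOn K (e i) (π ⁻¹' U))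
    {p : P} (hp : p ∈ π ⁻¹' U) (hv : ∀ i, mfderiv 𝓘(ℝ, EP) 𝓘(ℝ, EM) π p (e i p) = 0)
    (hli : LinearIndependent ℝ fun i => e i p) (hc : ∀ i, brk (e 2) (e i) p = 0) {c : Fin 3 → ℝ}
    (h : brk (e 0) (e 1) p = ∑ k, c k • e k p) : c 0 = 0 ∧ c 1 = 0 := by
  have : LieGroup 𝓘(ℝ, EK) (minSmoothness ℝ 3) K :=
    LieGroup.of_le (n := ∞) (by
      rw [minSmoothness_of_isRCLikeNormedField]; exact WithTop.coe_le_coe.2 le_top)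
  have : LieRing.IsNilpotent (GroupLieAlgebra 𝓘(ℝ, EK) K) := hK
  obtain ⟨hinj, hsurj⟩ := hπ.exists_orbitTangent p
  -- The claim is transported to the Lie algebra along the injective, bracket-preserving tangent map
  -- of the orbit map at `p`.
  choose ξ hξ using fun i => hsurj (e i p) (hv i)
  have hne : ∀ i, e i p ≠ 0 := fun i => hli.ne_zero i
  have lie : ∀ i j, orbitTangentₗ (EK := EK) (K := K) (EP := EP) p ⁅ξ i, ξ j⁆ = brk (e i) (e j) p :=
    fun i j => hπ.orbitTangent_lie hU (he i) (he j) (hi i) (hi j) hp (hne i) (hξ i) (hξ j)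
  have hξ' : ∀ i, orbitTangentₗ (EK := EK) (K := K) (EP := EP) p (ξ i) = e i p := hξ
  have hinj' : Function.Injective (orbitTangentₗ (EK := EK) (K := K) (EP := EP) p) := hinj
  have hlin : LinearIndependent ℝ ξ := by
    refine LinearIndependent.of_comp (orbitTangentₗ (EK := EK) (K := K) (EP := EP) p) ?_
    exact (funext hξ' : orbitTangentₗ (EK := EK) (K := K) (EP := EP) p ∘ ξ = fun i => e i p) ▸ hli
  refine lie_coeff_eq_zero hlin (fun i => hinj' ?_) (hinj' ?_)
  · rw [lie, hc, map_zero]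
  · rw [lie, h, map_sum]
    simp only [map_smul, hξ']

end Nilpotent

/-! ### Local invariant fields with a central vertical one. -/

section LocalFields

set_option linter.unusedSectionVars false

open scoped Topology

variable {K : Type*} [TopologicalSpace K] [Group K] [ChartedSpace (EuclideanSpace ℝ (Fin 3)) K]
  [LieGroup 𝓘(ℝ, EuclideanSpace ℝ (Fin 3)) ∞ K]
  {M : Type*} [TopologicalSpace M] [ChartedSpace (EuclideanSpace ℝ (Fin 1)) M]
  [IsManifold 𝓘(ℝ, EuclideanSpace ℝ (Fin 1)) ∞ M]
  {EP : Type*} [NormedAddCommGroup EP] [NormedSpace ℝ EP] [CompleteSpace EP]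
  {P : Type*} [TopologicalSpace P] [ChartedSpace EP P] [MulAction Kᵐᵒᵖ P]
  [IsManifold 𝓘(ℝ, EP) ∞ P] {π : P → M}

/-- Near every point there are smooth invariant fields `X` and `e 0, e 1, e 2` such that the `e i`
are vertical and linearly independent, `X` is not vertical and `e 2` is central at the point. -/
lemma exists_local_fields (hK : IsNilpotentLieGroup (E := EuclideanSpace ℝ (Fin 3)) K)
    (hπ : IsPrincipalBundle (EuclideanSpace ℝ (Fin 3)) K (EuclideanSpace ℝ (Fin 1)) EP π) (p₀ : P) :
    ∃ (U : Set M) (X : VField EP P) (e : Fin 3 → VField EP P), IsOpen U ∧ p₀ ∈ π ⁻¹' U ∧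
      SmoothFieldOn X (π ⁻¹' U) ∧ InvariantFieldOn K X (π ⁻¹' U) ∧
      (∀ i, SmoothFieldOn (e i) (π ⁻¹' U)) ∧ (∀ i, InvariantFieldOn K (e i) (π ⁻¹' U)) ∧
      (∀ p ∈ π ⁻¹' U, mfderiv 𝓘(ℝ, EP) 𝓘(ℝ, EuclideanSpace ℝ (Fin 1)) π p (X p) ≠ 0) ∧
      (∀ i, ∀ p ∈ π ⁻¹' U, mfderiv 𝓘(ℝ, EP) 𝓘(ℝ, EuclideanSpace ℝ (Fin 1)) π p (e i p) = 0) ∧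
      (∀ p ∈ π ⁻¹' U, LinearIndependent ℝ fun i => e i p) ∧
      ∃ ζ : GroupLieAlgebra 𝓘(ℝ, EuclideanSpace ℝ (Fin 3)) K, orbitTangent EP p₀ ζ = e 2 p₀ ∧
        ∀ x : GroupLieAlgebra 𝓘(ℝ, EuclideanSpace ℝ (Fin 3)) K, ⁅ζ, x⁆ = 0 := by
  obtain ⟨U₀, φ, ψ, hU₀, hx, hφ, hψ, h1, h2, h3⟩ := hπ.locally_trivial (π p₀)
  set χ := chartAt (EuclideanSpace ℝ (Fin 1)) (π p₀) with hχ
  have hχs : ContMDiffOn 𝓘(ℝ, EuclideanSpace ℝ (Fin 1)) 𝓘(ℝ, EuclideanSpace ℝ (Fin 1)) ∞ χ.symm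
    χ.target := contMDiffOn_chart_symm
  have hχc : ContMDiffOn 𝓘(ℝ, EuclideanSpace ℝ (Fin 1)) 𝓘(ℝ, EuclideanSpace ℝ (Fin 1)) ∞ χ
    χ.source := contMDiffOn_chart
  have hU : IsOpen (U₀ ∩ χ.source) := hU₀.inter χ.open_source
  have hW := hπ.isOpen_preimage hU
  have hp₀ : p₀ ∈ π ⁻¹' (U₀ ∩ χ.source) := ⟨hx, mem_chart_source _ _⟩
  let W := π ⁻¹' (U₀ ∩ χ.source)
  have hψW : ContMDiffOn 𝓘(ℝ, EP) 𝓘(ℝ, EuclideanSpace ℝ (Fin 3)) ∞ ψ W :=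
    hψ.mono fun p hp => hp.1
  have hψact : ∀ p ∈ W, ∀ a : K, ψ (MulOpposite.op a • p) = ψ p * a := fun p hp a => by
    conv_lhs => rw [← h2 p hp.1, ← h3 _ hp.1, (h1 _ hp.1 _).2]
  -- vertical fields
  let b := ψ p₀
  -- Left multiplication in the group coordinate commutes with the right action and moves along the
  -- fibre. Conjugating by `b = ψ p₀` makes `Θ (p₀, ·)` the orbit map of `p₀`, so that a central Lie
  -- algebra element gives the field that is central at `p₀`.
  let Θ : P × K → P := fun z => φ (π z.1, b * z.2⁻¹ * b⁻¹ * ψ z.1)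
  have hΩ : IsOpen (W ×ˢ (Set.univ : Set K)) := hW.prod isOpen_univ
  have hΘ : ContMDiffOn (𝓘(ℝ, EP).prod 𝓘(ℝ, EuclideanSpace ℝ (Fin 3))) 𝓘(ℝ, EP) ∞ Θ
      (W ×ˢ Set.univ) := by
    have m1 : ContMDiff 𝓘(ℝ, EuclideanSpace ℝ (Fin 3)) 𝓘(ℝ, EuclideanSpace ℝ (Fin 3)) ∞
        (fun c : K => b * c⁻¹ * b⁻¹) :=
      (contMDiff_mul_right (I := 𝓘(ℝ, EuclideanSpace ℝ (Fin 3))) (n := ∞)).comp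
        ((contMDiff_mul_left (I := 𝓘(ℝ, EuclideanSpace ℝ (Fin 3))) (n := ∞)).comp
          (contMDiff_inv _ ∞))
    have m2 : ContMDiffOn (𝓘(ℝ, EP).prod 𝓘(ℝ, EuclideanSpace ℝ (Fin 3)))
        𝓘(ℝ, EuclideanSpace ℝ (Fin 3)) ∞ (fun z : P × K => b * z.2⁻¹ * b⁻¹ * ψ z.1)
        (W ×ˢ Set.univ) :=
      ContMDiffOn.mul (m1.comp contMDiff_snd).contMDiffOn
        (hψW.comp contMDiffOn_fst fun z hz => hz.1)
    exact hφ.comp ((hπ.smooth_proj.comp contMDiff_fst).contMDiffOn.prodMk m2)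
      fun z hz => ⟨hz.1.1, trivial⟩
  have hΘid : ∀ p ∈ W, Θ (p, 1) = p := fun p hp => by simp [Θ, h2 p hp.1]
  have hΘinv : ∀ (a : K) (p : P) (n : K), (p, n) ∈ W ×ˢ (Set.univ : Set K) →
      Θ (MulOpposite.op a • p, n) = MulOpposite.op a • Θ (p, n) := fun a p n hpn => by
    simp only [Θ]
    rw [hπ.proj_act, hψact p hpn.1, ← h3 _ hpn.1.1, mul_assoc _ (ψ p) a]
  have hΘd : ∀ p ∈ W, MDifferentiableAt 𝓘(ℝ, EuclideanSpace ℝ (Fin 3)) 𝓘(ℝ, EP)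
      (fun c => Θ (p, c)) 1 := fun p hp =>
    ((hΘ.contMDiffAt (hΩ.mem_nhds ⟨hp, trivial⟩)).mdifferentiableAt (by simp)).comp (1 : K)
      (mdifferentiableAt_const.prodMk mdifferentiableAt_id)
  -- the transversal field
  let V : Set (P × EuclideanSpace ℝ (Fin 1)) :=
    {z | z.1 ∈ W ∧ χ (π z.1) + z.2 ∈ χ.target ∩ χ.symm ⁻¹' U₀}
  have hχπ : ContMDiffOn 𝓘(ℝ, EP) 𝓘(ℝ, EuclideanSpace ℝ (Fin 1)) ∞ (fun p => χ (π p)) W :=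
    hχc.comp hπ.smooth_proj.contMDiffOn fun p hp => hp.2
  have hadd : ContMDiffOn (𝓘(ℝ, EP).prod 𝓘(ℝ, EuclideanSpace ℝ (Fin 1)))
      𝓘(ℝ, EuclideanSpace ℝ (Fin 1)) ∞
      (fun z : P × EuclideanSpace ℝ (Fin 1) => χ (π z.1) + z.2) (W ×ˢ Set.univ) :=
    ContMDiffOn.add (hχπ.comp contMDiffOn_fst fun z hz => hz.1) contMDiffOn_snd
  have hV : IsOpen V := by
    have := hadd.continuousOn.isOpen_inter_preimage (hW.prod isOpen_univ)
      (χ.isOpen_inter_preimage_symm hU₀)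
    convert this using 1
    ext z; simp [V, W]
  -- Translation of the base chart with the group coordinate held fixed: its velocity projects to a
  -- coordinate vector field and is never vertical.
  let Θ' : P × EuclideanSpace ℝ (Fin 1) → P := fun z => φ (χ.symm (χ (π z.1) + z.2), ψ z.1)
  have hΘ' : ContMDiffOn (𝓘(ℝ, EP).prod 𝓘(ℝ, EuclideanSpace ℝ (Fin 1))) 𝓘(ℝ, EP) ∞ Θ' V := by
    refine hφ.comp (ContMDiffOn.prodMk (hχs.comp (hadd.mono fun z hz => ⟨hz.1, trivial⟩)
      fun z hz => hz.2.1) (hψW.comp contMDiffOn_fst fun z hz => hz.1)) fun z hz => ⟨hz.2.2, trivial⟩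
  have hVmem : ∀ p ∈ W, (p, 0) ∈ V := fun p hp => by
    refine ⟨hp, ?_⟩
    simp only [add_zero]
    exact ⟨χ.map_source hp.2, by simpa [χ.left_inv hp.2] using hp.1⟩
  have hΘ'id : ∀ p ∈ W, Θ' (p, 0) = p := fun p hp => by
    simp [Θ', χ.left_inv hp.2, h2 p hp.1]
  have hΘ'inv : ∀ (a : K) (p : P) (n : EuclideanSpace ℝ (Fin 1)), (p, n) ∈ V →
      Θ' (MulOpposite.op a • p, n) = MulOpposite.op a • Θ' (p, n) := fun a p n hpn => by
    simp only [Θ']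
    rw [hπ.proj_act, hψact p hpn.1, ← h3 _ hpn.2.2]
  have hΘ'd : ∀ p ∈ W, MDifferentiableAt 𝓘(ℝ, EuclideanSpace ℝ (Fin 1)) 𝓘(ℝ, EP)
      (fun c => Θ' (p, c)) 0 := fun p hp =>
    ((hΘ'.contMDiffAt (hV.mem_nhds (hVmem p hp))).mdifferentiableAt (by simp)).comp
      (0 : EuclideanSpace ℝ (Fin 1)) (mdifferentiableAt_const.prodMk mdifferentiableAt_id)
  -- the basis of the Lie algebra
  have : LieGroup 𝓘(ℝ, EuclideanSpace ℝ (Fin 3)) (minSmoothness ℝ 3) K :=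
    LieGroup.of_le (n := ∞) (by
      rw [minSmoothness_of_isRCLikeNormedField]; exact WithTop.coe_le_coe.2 le_top)
  have : LieRing.IsNilpotent (GroupLieAlgebra 𝓘(ℝ, EuclideanSpace ℝ (Fin 3)) K) := hK
  obtain ⟨ξ, hξ, hξc⟩ := exists_central_basis
    (L := GroupLieAlgebra 𝓘(ℝ, EuclideanSpace ℝ (Fin 3)) K)
    (finrank_euclideanSpace_fin (𝕜 := ℝ) (n := 3))
  let e : Fin 3 → VField EP P := fun i => familyField Θ 1 (ξ i)
  let X : VField EP P := familyField Θ' (0 : EuclideanSpace ℝ (Fin 1))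
    (EuclideanSpace.single 0 1 : EuclideanSpace ℝ (Fin 1))
  have hes : ∀ i, SmoothFieldOn (e i) W := fun i =>
    smoothFieldOn_family (ξ i) hΩ hΘ (fun p hp => ⟨hp, trivial⟩) hΘid
  have hei : ∀ i, InvariantFieldOn K (e i) W := fun i =>
    invariantFieldOn_family hπ (ξ i) hΩ hΘ (fun p hp => ⟨hp, trivial⟩) hΘid hΘinv
  have hlin : ∀ p ∈ W, LinearIndependent ℝ fun i => e i p := by
    intro p hp
    let L : EuclideanSpace ℝ (Fin 3) →L[ℝ] EP :=
      mfderiv 𝓘(ℝ, EuclideanSpace ℝ (Fin 3)) 𝓘(ℝ, EP) (fun c => Θ (p, c)) 1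
    -- A left inverse of `c ↦ Θ (p, c)`, so that the derivative `L` is injective and preserves
    -- linear independence.
    let q : P → K := fun p' => (b⁻¹ * (ψ p' * ((ψ p)⁻¹ * b)))⁻¹
    have hq : MDifferentiableAt 𝓘(ℝ, EP) 𝓘(ℝ, EuclideanSpace ℝ (Fin 3)) q p := by
      have g1 : ContMDiff 𝓘(ℝ, EuclideanSpace ℝ (Fin 3)) 𝓘(ℝ, EuclideanSpace ℝ (Fin 3)) ∞
          (fun c : K => (b⁻¹ * (c * ((ψ p)⁻¹ * b)))⁻¹) :=
        (contMDiff_inv _ ∞).comp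
          ((contMDiff_mul_left (I := 𝓘(ℝ, EuclideanSpace ℝ (Fin 3))) (n := ∞)).comp
            (contMDiff_mul_right (I := 𝓘(ℝ, EuclideanSpace ℝ (Fin 3))) (n := ∞)))
      exact (g1.mdifferentiableAt (by simp)).comp p
        ((hψW.contMDiffAt (hW.mem_nhds hp)).mdifferentiableAt (by simp))
    have hqΘ : q ∘ (fun c => Θ (p, c)) = id := by
      ext c
      simp only [q, Θ, Function.comp, (h1 _ hp.1 _).2, id]
      group
    have hq' : MDifferentiableAt 𝓘(ℝ, EP) 𝓘(ℝ, EuclideanSpace ℝ (Fin 3)) q (Θ (p, 1)) := by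
      rwa [hΘid p hp]
    have e1 := mfderiv_comp (1 : K) hq' (hΘd p hp)
    rw [hqΘ, mfderiv_id] at e1
    have hinj : Function.Injective L := by
      intro v w hvw
      have e2 := fun u : EuclideanSpace ℝ (Fin 3) => congrArg
        (fun T : EuclideanSpace ℝ (Fin 3) →L[ℝ] EuclideanSpace ℝ (Fin 3) => T u) e1
      refine (e2 v).trans (Eq.trans ?_ (e2 w).symm)
      exact congrArg (fun u : EP => (mfderiv 𝓘(ℝ, EP) 𝓘(ℝ, EuclideanSpace ℝ (Fin 3)) q
        (Θ (p, 1)) u : EuclideanSpace ℝ (Fin 3))) hvw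
    exact LinearIndependent.map' (R := ℝ) (M := EuclideanSpace ℝ (Fin 3)) (M' := EP) hξ
      (L : EuclideanSpace ℝ (Fin 3) →ₗ[ℝ] EP) (LinearMap.ker_eq_bot.2 hinj)
  refine ⟨U₀ ∩ χ.source, X, e, hU, hp₀, smoothFieldOn_family _ hV hΘ' hVmem hΘ'id,
    invariantFieldOn_family hπ _ hV hΘ' hVmem hΘ'id hΘ'inv, hes, hei, ?_, ?_, hlin, ?_⟩
  · intro p hp h0
    have hχd : MDifferentiableAt 𝓘(ℝ, EuclideanSpace ℝ (Fin 1)) 𝓘(ℝ, EuclideanSpace ℝ (Fin 1)) χ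
        (π p) := (hχc.contMDiffAt (χ.open_source.mem_nhds hp.2)).mdifferentiableAt (by simp)
    have hf : MDifferentiableAt 𝓘(ℝ, EP) 𝓘(ℝ, EuclideanSpace ℝ (Fin 1)) (χ ∘ π) (Θ' (p, 0)) := by
      rw [hΘ'id p hp]
      exact hχd.comp p (hπ.mdifferentiableAt_proj p)
    have e1 := mfderiv_comp (0 : EuclideanSpace ℝ (Fin 1)) hf (hΘ'd p hp)
    have ev : (χ ∘ π) ∘ (fun v => Θ' (p, v)) =ᶠ[𝓝 (0 : EuclideanSpace ℝ (Fin 1))]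
        fun v => χ (π p) + v := by
      have : ∀ᶠ v in 𝓝 (0 : EuclideanSpace ℝ (Fin 1)), (p, v) ∈ V :=
        (Continuous.prodMk_right p).continuousAt.preimage_mem_nhds (hV.mem_nhds (hVmem p hp))
      filter_upwards [this] with v hv
      simp only [Function.comp, Θ']
      rw [(h1 _ hv.2.2 _).1, χ.right_inv hv.2.1]
    have e2 : mfderiv 𝓘(ℝ, EuclideanSpace ℝ (Fin 1)) 𝓘(ℝ, EuclideanSpace ℝ (Fin 1))
        (fun v => χ (π p) + v) (0 : EuclideanSpace ℝ (Fin 1)) = ContinuousLinearMap.id ℝ _ := by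
      rw [mfderiv_eq_fderiv, fderiv_const_add]
      exact fderiv_id
    have e3 := congrArg (fun T : EuclideanSpace ℝ (Fin 1) →L[ℝ] EuclideanSpace ℝ (Fin 1) =>
      T (EuclideanSpace.single 0 1)) ((ev.mfderiv_eq.symm.trans e1).symm.trans e2)
    have e4 : (mfderiv 𝓘(ℝ, EP) 𝓘(ℝ, EuclideanSpace ℝ (Fin 1)) (χ ∘ π) p (X p) :
        EuclideanSpace ℝ (Fin 1)) = EuclideanSpace.single 0 1 :=
      (mfderiv_point_congr (χ ∘ π) (hΘ'id p hp).symm _).trans e3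
    have e5 := mfderiv_comp p hχd (hπ.mdifferentiableAt_proj p)
    rw [e5] at e4
    have e6 : (EuclideanSpace.single 0 1 : EuclideanSpace ℝ (Fin 1)) = 0 :=
      e4.symm.trans ((congrArg (fun u : EuclideanSpace ℝ (Fin 1) =>
        (mfderiv 𝓘(ℝ, EuclideanSpace ℝ (Fin 1)) 𝓘(ℝ, EuclideanSpace ℝ (Fin 1)) χ (π p) u :
          EuclideanSpace ℝ (Fin 1))) h0).trans (map_zero _))
    simpa using congrArg (fun v : EuclideanSpace ℝ (Fin 1) => v 0) e6
  · intro i p hp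
    have hc : π ∘ (fun c : K => Θ (p, c)) = fun _ => π p := by
      ext c
      exact (h1 _ hp.1 _).1
    have e1 := mfderiv_comp (1 : K) (hπ.mdifferentiableAt_proj (Θ (p, 1))) (hΘd p hp)
    rw [hc, mfderiv_const] at e1
    refine (mfderiv_point_congr π (hΘid p hp).symm _).trans ?_
    exact congrArg (fun T : EuclideanSpace ℝ (Fin 3) →L[ℝ] EuclideanSpace ℝ (Fin 1) => T (ξ i))
      e1.symm
  · have horb : (fun c : K => Θ (p₀, c)) = orbitMap K p₀ := by
      ext c
      simp only [Θ, orbitMap]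
      conv_rhs => rw [← h2 p₀ hx, ← h3 _ hx]
      simp [b]
    exact ⟨ξ 2, congrArg (fun f : K → P => (mfderiv 𝓘(ℝ, EuclideanSpace ℝ (Fin 3)) 𝓘(ℝ, EP) f 1
        (ξ 2) : EP)) horb.symm, hξc⟩

end LocalFields

/-! ### Gram-Schmidt for smooth invariant fields. -/

section GramSchmidt

set_option linter.unusedSectionVars false

open scoped Topology

variable {K : Type*} [TopologicalSpace K] [Group K]
  {EP : Type*} [NormedAddCommGroup EP] [NormedSpace ℝ EP]
  {P : Type*} [TopologicalSpace P] [ChartedSpace EP P] [MulAction Kᵐᵒᵖ P]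
  [IsManifold 𝓘(ℝ, EP) ∞ P]

variable (K) in
/-- Smooth invariant Riemannian metrics on `P`. -/
structure IsInvMetric (b : BilinField EP P) : Prop where
  symm : ∀ p (v w : TangentSpace 𝓘(ℝ, EP) p), b p v w = b p w v
  pos : ∀ p (v : TangentSpace 𝓘(ℝ, EP) p), v ≠ 0 → 0 < b p v v
  invariant : ∀ (a : K) (p : P) (v w : TangentSpace 𝓘(ℝ, EP) p),
    b (MulOpposite.op a • p)
        (mfderiv 𝓘(ℝ, EP) 𝓘(ℝ, EP) (fun q : P => MulOpposite.op a • q) p v)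
        (mfderiv 𝓘(ℝ, EP) 𝓘(ℝ, EP) (fun q : P => MulOpposite.op a • q) p w) = b p v w
  smooth : ∀ (W : Set P) (X Y : VField EP P), IsOpen W →
    SmoothFieldOn X W → SmoothFieldOn Y W → SmoothOn EP (ev₂ b X Y) W

variable (K) in
/-- Smooth invariant three-forms on `P`. -/
structure IsInvForm (H : ThreeForm EP P) : Prop where
  invariant : ∀ (a : K) (p : P) (u v w : TangentSpace 𝓘(ℝ, EP) p),
    H (MulOpposite.op a • p)
        ![mfderiv 𝓘(ℝ, EP) 𝓘(ℝ, EP) (fun q : P => MulOpposite.op a • q) p u,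
          mfderiv 𝓘(ℝ, EP) 𝓘(ℝ, EP) (fun q : P => MulOpposite.op a • q) p v,
          mfderiv 𝓘(ℝ, EP) 𝓘(ℝ, EP) (fun q : P => MulOpposite.op a • q) p w] = H p ![u, v, w]
  smooth : ∀ (W : Set P) (X Y Z : VField EP P), IsOpen W →
    SmoothFieldOn X W → SmoothFieldOn Y W → SmoothFieldOn Z W → SmoothOn EP (ev₃ H X Y Z) W

lemma IsInvMetric.invFun {b : BilinField EP P} (hb : IsInvMetric K b) {X Y : VField EP P}
    {W : Set P} (hX : InvariantFieldOn K X W) (hY : InvariantFieldOn K Y W) :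
    InvFun K (ev₂ b X Y) W := fun a p hp => by
  simp only [ev₂, ← hX a p hp, ← hY a p hp, hb.invariant]

lemma IsInvForm.invFun {H : ThreeForm EP P} (hH : IsInvForm K H) {X Y Z : VField EP P}
    {W : Set P} (hX : InvariantFieldOn K X W) (hY : InvariantFieldOn K Y W)
    (hZ : InvariantFieldOn K Z W) : InvFun K (ev₃ H X Y Z) W := fun a p hp => by
  simp only [ev₃, ← hX a p hp, ← hY a p hp, ← hZ a p hp, hH.invariant]

lemma IsInvariantMetricFamily.isInvMetric {J : Set ℝ} {gbar : ℝ → BilinField EP P}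
    (hg : IsInvariantMetricFamily K J gbar) {t : ℝ} (ht : t ∈ J) : IsInvMetric K (gbar t) where
  symm := hg.symm t ht
  pos := hg.pos t ht
  invariant := hg.invariant t ht
  smooth W X Y hW hX hY := (hg.smooth W X Y hW hX hY).comp
    (contMDiff_const.prodMk contMDiff_id).contMDiffOn fun _ hp => ⟨ht, hp⟩

lemma IsInvariantClosedThreeFormFamily.isInvForm {J : Set ℝ} {Hbar : ℝ → ThreeForm EP P}
    (hH : IsInvariantClosedThreeFormFamily K J Hbar) {t : ℝ} (ht : t ∈ J) :
    IsInvForm K (Hbar t) where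
  invariant := hH.invariant t ht
  smooth W X Y Z hW hX hY hZ := (hH.smooth W X Y Z hW hX hY hZ).comp
    (contMDiff_const.prodMk contMDiff_id).contMDiffOn fun _ hp => ⟨ht, hp⟩

lemma SmoothOn.inv {f : P → ℝ} {W : Set P} (hf : SmoothOn EP f W) (h : ∀ p ∈ W, f p ≠ 0) :
    SmoothOn EP (fun p => (f p)⁻¹) W := ContMDiffOn.inv₀ hf h

lemma SmoothOn.sqrt {f : P → ℝ} {W : Set P} (hf : SmoothOn EP f W) (h : ∀ p ∈ W, 0 < f p) :
    SmoothOn EP (fun p => √(f p)) W := fun p hp =>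
  ContMDiffAt.comp_contMDiffWithinAt p
    (Real.contDiffAt_sqrt (n := ∞) (h p hp).ne').contMDiffAt (hf p hp)

/-- One step of the Gram-Schmidt process for smooth invariant fields. -/
lemma gramSchmidt_step {EK : Type*} [NormedAddCommGroup EK] [NormedSpace ℝ EK]
    [ChartedSpace EK K] {EM : Type*} [NormedAddCommGroup EM] [NormedSpace ℝ EM]
    {M : Type*} [TopologicalSpace M] [ChartedSpace EM M] {π : P → M}
    (hπ : IsPrincipalBundle EK K EM EP π)
    {b : BilinField EP P} (hb : IsInvMetric K b) {U : Set M} (hU : IsOpen U)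
    {ι : Type*} [Fintype ι] [DecidableEq ι] {η : ι → VField EP P}
    (hs : ∀ i, SmoothFieldOn (η i) (π ⁻¹' U)) (hi : ∀ i, InvariantFieldOn K (η i) (π ⁻¹' U))
    (ho : ∀ i j, ∀ p ∈ π ⁻¹' U, b p (η i p) (η j p) = if i = j then 1 else 0)
    {Y : VField EP P} (hYs : SmoothFieldOn Y (π ⁻¹' U)) (hYi : InvariantFieldOn K Y (π ⁻¹' U))
    (hY : ∀ p ∈ π ⁻¹' U, Y p ∉ Submodule.span ℝ (Set.range fun i => η i p)) :
    ∃ (ζ : VField EP P) (c : P → ℝ) (d : ι → P → ℝ), SmoothFieldOn ζ (π ⁻¹' U) ∧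
      InvariantFieldOn K ζ (π ⁻¹' U) ∧ (∀ p ∈ π ⁻¹' U, b p (ζ p) (ζ p) = 1) ∧
      (∀ i, ∀ p ∈ π ⁻¹' U, b p (ζ p) (η i p) = 0) ∧
      ∀ p ∈ π ⁻¹' U, c p ≠ 0 ∧ ζ p = c p • Y p + ∑ i, d i p • η i p := by
  have hW := hπ.isOpen_preimage hU
  let Z : VField EP P := Y - ∑ i, ev₂ b Y (η i) • η i
  have hZs : SmoothFieldOn Z (π ⁻¹' U) :=
    hYs.sub (SmoothFieldOn.sum fun i => SmoothFieldOn.smul (hb.smooth _ _ _ hW hYs (hs i)) (hs i))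
  have hZi : InvariantFieldOn K Z (π ⁻¹' U) :=
    hYi.sub (InvariantFieldOn.sum fun i => InvariantFieldOn.smul (hb.invFun hYi (hi i)) (hi i))
  have hZ : ∀ p, Z p = Y p - ∑ i, b p (Y p) (η i p) • η i p := fun p => by
    simp [Z, ev₂]
  have hZ0 : ∀ p ∈ π ⁻¹' U, Z p ≠ 0 := fun p hp h => by
    rw [hZ, sub_eq_zero] at h
    apply hY p hp
    rw [h]
    exact Submodule.sum_mem _ fun i _ => Submodule.smul_mem _ _ (Submodule.subset_span ⟨i, rfl⟩)
  have hN : ∀ p ∈ π ⁻¹' U, 0 < ev₂ b Z Z p := fun p hp => hb.pos p _ (hZ0 p hp)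
  have hNs := hb.smooth _ _ _ hW hZs hZs
  let c : P → ℝ := fun p => (√(ev₂ b Z Z p))⁻¹
  have hcpos : ∀ p ∈ π ⁻¹' U, 0 < c p := fun p hp => inv_pos.2 (Real.sqrt_pos.2 (hN p hp))
  have hcs : SmoothOn EP c (π ⁻¹' U) :=
    SmoothOn.inv (hNs.sqrt hN) fun p hp => (Real.sqrt_pos.2 (hN p hp)).ne'
  have hci : InvFun K c (π ⁻¹' U) := fun a p hp => by
    simp only [c, hb.invFun hZi hZi a p hp]
  refine ⟨c • Z, c, fun i p => - (c p * b p (Y p) (η i p)), SmoothFieldOn.smul hcs hZs,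
    InvariantFieldOn.smul hci hZi, fun p hp => ?_, fun i p hp => ?_, fun p hp =>
    ⟨(hcpos p hp).ne', ?_⟩⟩
  · have : c p * (c p * ev₂ b Z Z p) = 1 := by
      have h1 : √(ev₂ b Z Z p) * √(ev₂ b Z Z p) = ev₂ b Z Z p := Real.mul_self_sqrt (hN p hp).le
      have h2 := (Real.sqrt_pos.2 (hN p hp)).ne'
      simp only [c]
      rw [← mul_assoc, ← mul_inv, h1, inv_mul_cancel₀ (hN p hp).ne']
    simpa [ev₂] using this
  · have : b p (Z p) (η i p) = 0 := by
      rw [hZ]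
      simp [ho _ _ p hp]
    simp [this]
  · rw [Pi.smul_apply', hZ, smul_sub, Finset.smul_sum, sub_eq_add_neg, ← Finset.sum_neg_distrib]
    simp only [neg_smul, mul_smul]

end GramSchmidt

/-! ### Existence of adapted orthonormal frames. -/

section Frames

set_option linter.unusedSectionVars false

open scoped Topology

variable {K : Type*} [TopologicalSpace K] [Group K] [ChartedSpace (EuclideanSpace ℝ (Fin 3)) K]
  [LieGroup 𝓘(ℝ, EuclideanSpace ℝ (Fin 3)) ∞ K]
  {M : Type*} [TopologicalSpace M] [ChartedSpace (EuclideanSpace ℝ (Fin 1)) M]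
  [IsManifold 𝓘(ℝ, EuclideanSpace ℝ (Fin 1)) ∞ M]
  {P : Type*} [TopologicalSpace P] [ChartedSpace (EuclideanSpace ℝ (Fin 4)) P] [MulAction Kᵐᵒᵖ P]
  [IsManifold 𝓘(ℝ, EuclideanSpace ℝ (Fin 4)) ∞ P] {π : P → M}

/-- Vectors that are orthonormal for `b` are linearly independent. -/
lemma linearIndependent_of_orthonormal {V : Type*} [AddCommGroup V] [Module ℝ V]
    {ι : Type*} [Fintype ι] [DecidableEq ι] (b : V →ₗ[ℝ] V →ₗ[ℝ] ℝ) {v : ι → V}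
    (h : ∀ i j, b (v i) (v j) = if i = j then 1 else 0) : LinearIndependent ℝ v := by
  rw [Fintype.linearIndependent_iff]
  intro g hg i
  have := congrArg (b (v i)) hg
  simpa [h] using this

/-- Adapted orthonormal frames exist near every point, with a central last vector there. -/
lemma exists_adaptedFrame (hK : IsNilpotentLieGroup (E := EuclideanSpace ℝ (Fin 3)) K)
    (hπ : IsPrincipalBundle (EuclideanSpace ℝ (Fin 3)) K (EuclideanSpace ℝ (Fin 1))
      (EuclideanSpace ℝ (Fin 4)) π)
    {b : BilinField (EuclideanSpace ℝ (Fin 4)) P} (hb : IsInvMetric K b) (p₀ : P) :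
    ∃ (U : Set M) (F : AdaptedFrame K (EuclideanSpace ℝ (Fin 1)) π b 1 3 U), p₀ ∈ π ⁻¹' U ∧
      IsCentralAt F p₀ := by
  obtain ⟨U, X, e, hU, hp₀, hXs, hXi, hes, hei, hXv, hev, hlin, ζ, hζ, hζc⟩ :=
    exists_local_fields hK hπ p₀
  have li : ∀ p ∈ π ⁻¹' U, ∀ s : Set (Fin 3), ∀ i ∉ s,
      e i p ∉ Submodule.span ℝ ((fun i => e i p) '' s) := fun p hp s i hi =>
    (hlin p hp).notMem_span_image hi
  -- The process starts with the central field, so that the last frame vector is only a rescaling of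
  -- it and remains central at `p₀`.
  obtain ⟨f2, c2, d2, hs2, hi2, hu2, -, hf2⟩ := gramSchmidt_step hπ hb hU
    (η := fun i : Fin 0 => i.elim0) (fun i => i.elim0) (fun i => i.elim0) (fun i => i.elim0)
    (hes 2) (hei 2) (fun p hp => by
      have := li p hp ∅ 2 (by simp)
      simpa using this)
  simp only [Finset.univ_eq_empty, Finset.sum_empty, add_zero] at hf2
  have sp2 : ∀ p ∈ π ⁻¹' U, f2 p ∈ Submodule.span ℝ ((fun i => e i p) '' {2}) := fun p hp => by
    rw [(hf2 p hp).2]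
    exact Submodule.smul_mem _ _ (Submodule.subset_span ⟨2, by simp⟩)
  obtain ⟨f1, c1, d1, hs1, hi1, hu1, hz1, hf1⟩ := gramSchmidt_step hπ hb hU
    (η := fun _ : Fin 1 => f2) (fun i => hs2) (fun i => hi2)
    (fun i j p hp => by rw [if_pos (Subsingleton.elim i j)]; exact hu2 p hp)
    (hes 1) (hei 1) (fun p hp hmem => by
      refine li p hp {2} 1 (by simp) (Submodule.span_le.2 ?_ hmem)
      rintro _ ⟨i, rfl⟩
      exact sp2 p hp)
  have sp1 : ∀ p ∈ π ⁻¹' U, f1 p ∈ Submodule.span ℝ ((fun i => e i p) '' {1, 2}) := fun p hp => by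
    rw [(hf1 p hp).2]
    refine Submodule.add_mem _ (Submodule.smul_mem _ _ (Submodule.subset_span ⟨1, by simp⟩))
      (Submodule.sum_mem _ fun i _ => Submodule.smul_mem _ _ ?_)
    exact Submodule.span_mono (Set.image_mono (by simp)) (sp2 p hp)
  have h12 : ∀ p ∈ π ⁻¹' U, b p (f1 p) (f2 p) = 0 := fun p hp => hz1 0 p hp
  obtain ⟨f0, c0, d0, hs0, hi0, hu0, hz0, hf0⟩ := gramSchmidt_step hπ hb hU
    (η := ![f1, f2]) (by simp [Fin.forall_fin_two, hs1, hs2])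
    (by simp [Fin.forall_fin_two, hi1, hi2])
    (fun i j p hp => match i, j with
      | 0, 0 => hu1 p hp
      | 0, 1 => h12 p hp
      | 1, 0 => (hb.symm p _ _).trans (h12 p hp)
      | 1, 1 => hu2 p hp)
    (hes 0) (hei 0) (fun p hp hmem => by
      refine li p hp {1, 2} 0 (by simp) (Submodule.span_le.2 ?_ hmem)
      rintro _ ⟨i, rfl⟩
      fin_cases i
      · exact sp1 p hp
      · exact Submodule.span_mono (Set.image_mono (by simp)) (sp2 p hp))
  have h01 : ∀ p ∈ π ⁻¹' U, b p (f0 p) (f1 p) = 0 := fun p hp => hz0 0 p hp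
  have h02 : ∀ p ∈ π ⁻¹' U, b p (f0 p) (f2 p) = 0 := fun p hp => hz0 1 p hp
  let f : Fin 3 → VField (EuclideanSpace ℝ (Fin 4)) P := ![f0, f1, f2]
  have hfs : ∀ i, SmoothFieldOn (f i) (π ⁻¹' U) := by
    intro i; fin_cases i; exacts [hs0, hs1, hs2]
  have hfi : ∀ i, InvariantFieldOn K (f i) (π ⁻¹' U) := by
    intro i; fin_cases i; exacts [hi0, hi1, hi2]
  have hfo : ∀ i j, ∀ p ∈ π ⁻¹' U, b p (f i p) (f j p) = if i = j then 1 else 0 := by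
    intro i j p hp
    match i, j with
    | 0, 0 => exact hu0 p hp
    | 0, 1 => exact h01 p hp
    | 0, 2 => exact h02 p hp
    | 1, 0 => exact (hb.symm p _ _).trans (h01 p hp)
    | 1, 1 => exact hu1 p hp
    | 1, 2 => exact h12 p hp
    | 2, 0 => exact (hb.symm p _ _).trans (h02 p hp)
    | 2, 1 => exact (hb.symm p _ _).trans (h12 p hp)
    | 2, 2 => exact hu2 p hp
  have hfv : ∀ i, ∀ p ∈ π ⁻¹' U, mfderiv 𝓘(ℝ, EuclideanSpace ℝ (Fin 4))
      𝓘(ℝ, EuclideanSpace ℝ (Fin 1)) π p (f i p) = 0 := by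
    intro i p hp
    have hv2 : mfderiv 𝓘(ℝ, EuclideanSpace ℝ (Fin 4)) 𝓘(ℝ, EuclideanSpace ℝ (Fin 1)) π p (f2 p)
        = 0 := by rw [(hf2 p hp).2, map_smul, hev 2 p hp, smul_zero]
    have hv1 : mfderiv 𝓘(ℝ, EuclideanSpace ℝ (Fin 4)) 𝓘(ℝ, EuclideanSpace ℝ (Fin 1)) π p (f1 p)
        = 0 := by
      rw [(hf1 p hp).2]; simp [hev 1 p hp, hv2]
    have hv0 : mfderiv 𝓘(ℝ, EuclideanSpace ℝ (Fin 4)) 𝓘(ℝ, EuclideanSpace ℝ (Fin 1)) π p (f0 p)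
        = 0 := by
      rw [(hf0 p hp).2]; simp [hev 0 p hp, hv1, hv2]
    fin_cases i
    exacts [hv0, hv1, hv2]
  -- Orthogonalizing the transversal field against the vertical ones gives the unit horizontal
  -- field. It lies outside their span because its projection to the base is nonzero.
  obtain ⟨V, c, d, hVs, hVi, hVu, hVf, hV⟩ := gramSchmidt_step hπ hb hU hfs hfi hfo hXs hXi
    (fun p hp hmem => by
      have hle : Submodule.span ℝ (Set.range fun i => f i p) ≤ LinearMap.ker
          (mfderiv 𝓘(ℝ, EuclideanSpace ℝ (Fin 4)) 𝓘(ℝ, EuclideanSpace ℝ (Fin 1)) π p).toLinearMap := by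
        rw [Submodule.span_le]
        rintro _ ⟨i, rfl⟩
        exact hfv i p hp
      exact hXv p hp (hle hmem))
  have hVv : ∀ p ∈ π ⁻¹' U, mfderiv 𝓘(ℝ, EuclideanSpace ℝ (Fin 4))
      𝓘(ℝ, EuclideanSpace ℝ (Fin 1)) π p (V p) ≠ 0 := by
    intro p hp h
    rw [(hV p hp).2] at h
    simp only [map_add, map_smul, map_sum, hfv _ p hp, smul_zero, Finset.sum_const_zero,
      add_zero] at h
    exact hXv p hp ((smul_eq_zero.1 h).resolve_left (hV p hp).1)
  have hspan : ∀ p ∈ π ⁻¹' U, Submodule.span ℝ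
      (Set.range (fun _ : Fin 1 => V p) ∪ Set.range fun i => f i p) = ⊤ := by
    intro p hp
    have hl : LinearIndependent ℝ (Sum.elim (fun _ : Fin 1 => V p) fun i => f i p) := by
      refine linearIndependent_of_orthonormal
        (V := TangentSpace 𝓘(ℝ, EuclideanSpace ℝ (Fin 4)) p)
        ((ContinuousLinearMap.coeLM ℝ).comp (b p).toLinearMap) ?_
      rintro (i | i) (j | j)
      · simpa [Subsingleton.elim i j] using hVu p hp
      · simpa using hVf j p hp
      · simpa [hb.symm p (f i p)] using hVf i p hp
      · simpa using hfo i j p hp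
    have := hl.span_eq_top_of_card_eq_finrank (by
      simp only [Fintype.card_sum, Fintype.card_fin]
      exact (finrank_euclideanSpace_fin (𝕜 := ℝ) (n := 4)).symm)
    rwa [Set.Sum.elim_range] at this
  refine ⟨U, ⟨fun _ => V, f, hU, fun _ => hVs, hfs, fun _ => hVi, hfi, ?_, hfv, ?_, hfo, hspan⟩,
    hp₀, ?_⟩
  · intro _ p hp w hw
    have hmem : w ∈ Submodule.span ℝ
        (Set.range (fun _ : Fin 1 => V p) ∪ Set.range fun i => f i p) := by
      rw [hspan p hp]; trivial
    rw [Submodule.span_union, Submodule.mem_sup] at hmem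
    obtain ⟨x, hx, y, hy, rfl⟩ := hmem
    rw [Set.range_const, Submodule.mem_span_singleton] at hx
    obtain ⟨r, rfl⟩ := hx
    obtain ⟨k, rfl⟩ := (Submodule.mem_span_range_iff_exists_fun ℝ).1 hy
    simp only [map_add, map_smul, map_sum, hfv _ p hp, smul_zero, Finset.sum_const_zero,
      add_zero] at hw
    have hr := (smul_eq_zero.1 hw).resolve_right (hVv p hp)
    simp [hr, hVf _ p hp]
  · intro i j p hp
    rw [if_pos (Subsingleton.elim i j)]
    exact hVu p hp
  · intro i
    have : LieGroup 𝓘(ℝ, EuclideanSpace ℝ (Fin 3)) (minSmoothness ℝ 3) K :=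
      LieGroup.of_le (n := ∞) (by
        rw [minSmoothness_of_isRCLikeNormedField]; exact WithTop.coe_le_coe.2 le_top)
    -- The vectors `f 2 p₀` and `f i p₀` are the images of `c2 p₀ • ζ` and `x` in the Lie algebra,
    -- whose bracket vanishes because `ζ` is central.
    obtain ⟨x, hx⟩ := (hπ.exists_orbitTangent p₀).2 (f i p₀) (hfv i p₀ hp₀)
    have hc : orbitTangent (EuclideanSpace ℝ (Fin 4)) p₀ (c2 p₀ • ζ) = f 2 p₀ := by
      refine ((orbitTangentₗ (EP := EuclideanSpace ℝ (Fin 4)) p₀).map_smul (c2 p₀) ζ).trans ?_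
      refine (congrArg (fun v => c2 p₀ • v) hζ).trans (hf2 p₀ hp₀).2.symm
    have hne : f 2 p₀ ≠ 0 := by
      intro h
      have := hfo 2 2 p₀ hp₀
      simp [h] at this
    have := hπ.orbitTangent_lie hU (hfs 2) (hfs i) (hfi 2) (hfi i) hp₀ hne hc hx
    refine this.symm.trans ?_
    rw [smul_lie, hζc, smul_zero]
    exact map_zero (orbitTangentₗ (EP := EuclideanSpace ℝ (Fin 4)) p₀)

end Frames

/-! ### Vertical fields and their brackets. -/

section Vertical

set_option linter.unusedSectionVars false

open scoped Topology

variable {EK : Type*} [NormedAddCommGroup EK] [NormedSpace ℝ EK]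
  {K : Type*} [TopologicalSpace K] [Group K] [ChartedSpace EK K]
  {M : Type*} [TopologicalSpace M] [ChartedSpace (EuclideanSpace ℝ (Fin 1)) M]
  {EP : Type*} [NormedAddCommGroup EP] [NormedSpace ℝ EP]
  {P : Type*} [TopologicalSpace P] [ChartedSpace EP P] [MulAction Kᵐᵒᵖ P]
  {π : P → M}

/-- A vector that annihilates the base coordinate is vertical. -/
lemma Slice.vertical_of_along {U : Set M} {z : M → ℝ} {σ : ℝ → P} {I : Set ℝ}
    (h : Slice K EP π U z σ I) (hπ : IsPrincipalBundle EK K (EuclideanSpace ℝ (Fin 1)) EP π)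
    {p : P} (hp : p ∈ π ⁻¹' U) {Y : VField EP P} (hY : along Y (z ∘ π) p = 0) :
    mfderiv 𝓘(ℝ, EP) 𝓘(ℝ, EuclideanSpace ℝ (Fin 1)) π p (Y p) = 0 := by
  have hW := hπ.isOpen_preimage h.isOpen
  have hz := (h.smoothOn_coord hπ).mdifferentiableAt hW hp
  have hI := h.coord_mem _ hp
  have hσ : MDifferentiableAt 𝓘(ℝ, ℝ) 𝓘(ℝ, EP) σ ((z ∘ π) p) :=
    (h.smooth_section.contMDiffAt (h.isOpen_coord.mem_nhds hI)).mdifferentiableAt (by simp)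
  -- Locally `π` factors through the coordinate `z ∘ π`, hence so does its derivative.
  have e : (π ∘ σ) ∘ (z ∘ π) =ᶠ[𝓝 p] π := Filter.eventuallyEq_of_mem (hW.mem_nhds hp)
    fun q hq => by
      obtain ⟨a, ha⟩ := h.exists_act q hq
      have := congrArg π ha
      rw [hπ.proj_act] at this
      exact this.symm
  rw [← e.mfderiv_eq, mfderiv_comp p ((hπ.mdifferentiableAt_proj _).comp _ hσ) hz]
  have hY' : mfderiv 𝓘(ℝ, EP) 𝓘(ℝ, ℝ) (z ∘ π) p (Y p) = 0 := hY
  change mfderiv 𝓘(ℝ, ℝ) 𝓘(ℝ, EuclideanSpace ℝ (Fin 1)) (π ∘ σ) ((z ∘ π) p)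
    (mfderiv 𝓘(ℝ, EP) 𝓘(ℝ, ℝ) (z ∘ π) p (Y p)) = 0
  rw [hY', map_zero]

namespace IsPrincipalBundle

variable (hπ : IsPrincipalBundle EK K (EuclideanSpace ℝ (Fin 1)) EP π)
  [IsManifold 𝓘(ℝ, EuclideanSpace ℝ (Fin 1)) ∞ M]
include hπ

/-- Around every point of an open set of the base there is a slice over a smaller open set. -/
lemma exists_slice_subset {U : Set M} (hU : IsOpen U) {x : M} (hx : x ∈ U) :
    ∃ U' z σ I, x ∈ U' ∧ U' ⊆ U ∧ Slice K EP π U' z σ I := by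
  obtain ⟨U', z, σ, I, hx', h⟩ := exists_slice hπ x
  exact ⟨U' ∩ U, z, σ, _, ⟨hx', hx⟩, Set.inter_subset_right,
    h.restrict hπ (h.isOpen.inter hU) Set.inter_subset_left⟩

lemma along_vertical {U : Set M} (hU : IsOpen U) {f : P → ℝ} (hf : InvFun K f (π ⁻¹' U))
    (hs : SmoothOn EP f (π ⁻¹' U)) {p : P} (hp : p ∈ π ⁻¹' U) {Y : VField EP P}
    (hY : mfderiv 𝓘(ℝ, EP) 𝓘(ℝ, EuclideanSpace ℝ (Fin 1)) π p (Y p) = 0) :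
    along Y f p = 0 := by
  obtain ⟨U', z, σ, I, hx, hsub, h⟩ := hπ.exists_slice_subset hU hp
  exact h.along_vertical hπ (hf.mono (Set.preimage_mono hsub)) (hs.mono (Set.preimage_mono hsub))
    hx hY

/-- The fibres of `π` are orbits. -/
lemma exists_act_of_proj_eq {p q : P} (h : π p = π q) : ∃ a : K, q = MulOpposite.op a • p := by
  obtain ⟨U, z, σ, I, hx, hs⟩ := exists_slice hπ (π p)
  obtain ⟨a, ha⟩ := hs.exists_act p hx
  obtain ⟨c, hc⟩ := hs.exists_act q (by rwa [Set.mem_preimage, ← h])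
  rw [← h] at hc
  generalize σ (z (π p)) = y at ha hc
  exact ⟨a⁻¹ * c, by rw [hc, ha, smul_smul]; simp⟩

/-- The bracket of an invariant field with an invariant vertical field is vertical. -/
lemma vertical_brk [IsManifold 𝓘(ℝ, EP) ∞ P] [CompleteSpace EP] {U : Set M} (hU : IsOpen U)
    {X Y : VField EP P}
    (hX : SmoothFieldOn X (π ⁻¹' U)) (hXi : InvariantFieldOn K X (π ⁻¹' U))
    (hY : SmoothFieldOn Y (π ⁻¹' U))
    (hYv : ∀ q ∈ π ⁻¹' U, mfderiv 𝓘(ℝ, EP) 𝓘(ℝ, EuclideanSpace ℝ (Fin 1)) π q (Y q) = 0)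
    {p : P} (hp : p ∈ π ⁻¹' U) (hYp : Y p ≠ 0) :
    mfderiv 𝓘(ℝ, EP) 𝓘(ℝ, EuclideanSpace ℝ (Fin 1)) π p (brk X Y p) = 0 := by
  obtain ⟨U', z, σ, I, hx, hsub, h⟩ := hπ.exists_slice_subset hU hp
  have hsub' : π ⁻¹' U' ⊆ π ⁻¹' U := Set.preimage_mono hsub
  have hW := hπ.isOpen_preimage h.isOpen
  have hz := h.smoothOn_coord hπ
  have hzi : InvFun K (z ∘ π) (π ⁻¹' U') := fun a q _ => by simp [hπ.proj_act]
  -- Apply the commutator `[X, Y]` to the base coordinate: `Y z` vanishes identically, and `X z` is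
  -- invariant, hence constant along `Y`.
  refine h.vertical_of_along hπ hx ?_
  rw [along_brk hW hx (hX.mono hsub') (hY.mono hsub') (hY.mono hsub') hYp hz,
    along_eq_zero_of_const hW hx fun q hq => h.along_vertical_coord hπ hq (hYv q (hsub' hq)),
    h.along_vertical hπ (hπ.invFun_along h.isOpen (hXi.mono hsub') hz hzi)
      (hz.along hW (hX.mono hsub')) hx (hYv p hp), sub_zero]

end IsPrincipalBundle

end Vertical

/-! ### Multilinear algebra of three-forms. -/

section Forms

variable {EP : Type*} [NormedAddCommGroup EP] [NormedSpace ℝ EP]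
  {P : Type*} [TopologicalSpace P] [ChartedSpace EP P] (H : ThreeForm EP P)

lemma form_swap {p : P} (u v w : TangentSpace 𝓘(ℝ, EP) p) : H p ![v, u, w] = - H p ![u, v, w] := by
  have := (H p).toAlternatingMap.map_swap ![u, v, w] (i := 0) (j := 1) (by decide)
  rw [← ContinuousAlternatingMap.coe_toAlternatingMap, ← this]
  congr 1
  funext i
  match i with
  | 0 => rfl
  | 1 => rfl
  | 2 => rfl

lemma form_swap' {p : P} (u v w : TangentSpace 𝓘(ℝ, EP) p) : H p ![u, w, v] = - H p ![u, v, w] := by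
  have := (H p).toAlternatingMap.map_swap ![u, v, w] (i := 1) (j := 2) (by decide)
  rw [← ContinuousAlternatingMap.coe_toAlternatingMap, ← this]
  congr 1
  funext i
  match i with
  | 0 => rfl
  | 1 => rfl
  | 2 => rfl

lemma form_rot {p : P} (u v w : TangentSpace 𝓘(ℝ, EP) p) : H p ![v, w, u] = H p ![u, v, w] := by
  rw [form_swap', form_swap, neg_neg]

lemma form_self {p : P} (u w : TangentSpace 𝓘(ℝ, EP) p) : H p ![u, u, w] = 0 := by
  have := form_swap H u u w
  linarith

lemma form_self' {p : P} (u w : TangentSpace 𝓘(ℝ, EP) p) : H p ![w, u, u] = 0 := by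
  have := form_swap' H w u u
  linarith

lemma form_self'' {p : P} (u w : TangentSpace 𝓘(ℝ, EP) p) : H p ![u, w, u] = 0 := by
  rw [form_swap', form_self, neg_zero]

lemma form_lincomb {p : P} {ι : Type*} [Fintype ι] (c : ι → ℝ) (x : ι → TangentSpace 𝓘(ℝ, EP) p)
    (v w : TangentSpace 𝓘(ℝ, EP) p) :
    H p ![∑ i, c i • x i, v, w] = ∑ i, c i * H p ![x i, v, w] := by
  have e : ∀ u : TangentSpace 𝓘(ℝ, EP) p,
      H p ![u, v, w] = (H p).toAlternatingMap.toMultilinearMap.toLinearMap ![0, v, w] 0 u := fun u => by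
    rw [MultilinearMap.toLinearMap_apply]
    refine congrArg (H p) ?_
    funext i
    match i with
    | 0 => rfl
    | 1 => rfl
    | 2 => rfl
  simp only [e, map_sum, map_smul, smul_eq_mul]

lemma form_lincomb' {p : P} {ι : Type*} [Fintype ι] (c : ι → ℝ) (x : ι → TangentSpace 𝓘(ℝ, EP) p)
    (v w : TangentSpace 𝓘(ℝ, EP) p) :
    H p ![v, ∑ i, c i • x i, w] = ∑ i, c i * H p ![v, x i, w] := by
  rw [form_swap, form_lincomb, ← Finset.sum_neg_distrib]
  exact Finset.sum_congr rfl fun i _ => by rw [form_swap H v]; ring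

lemma form_lincomb'' {p : P} {ι : Type*} [Fintype ι] (c : ι → ℝ) (x : ι → TangentSpace 𝓘(ℝ, EP) p)
    (v w : TangentSpace 𝓘(ℝ, EP) p) :
    H p ![v, w, ∑ i, c i • x i] = ∑ i, c i * H p ![v, w, x i] := by
  rw [form_rot, form_lincomb]
  exact Finset.sum_congr rfl fun i _ => by rw [form_rot H (x i)]

end Forms

/-! ### The connection and `DG` in an adapted frame. -/

section FrameCalculus

set_option linter.unusedSectionVars false

open scoped Topology

variable {EK : Type*} [NormedAddCommGroup EK] [NormedSpace ℝ EK]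
  {K : Type*} [TopologicalSpace K] [Group K] [ChartedSpace EK K]
  {M : Type*} [TopologicalSpace M] [ChartedSpace (EuclideanSpace ℝ (Fin 1)) M]
  [IsManifold 𝓘(ℝ, EuclideanSpace ℝ (Fin 1)) ∞ M]
  {EP : Type*} [NormedAddCommGroup EP] [NormedSpace ℝ EP] [CompleteSpace EP]
  {P : Type*} [TopologicalSpace P] [ChartedSpace EP P] [MulAction Kᵐᵒᵖ P]
  [IsManifold 𝓘(ℝ, EP) ∞ P] {π : P → M}

lemma brk_zero_right (X : VField EP P) (p : P) : brk X 0 p = 0 := by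
  simp [brk, mlieBracket_zero_right]

lemma brk_zero_left (X : VField EP P) (p : P) : brk 0 X p = 0 := by
  rw [brk_swap, brk_zero_right, neg_zero]

lemma along_zero_left (f : P → ℝ) (p : P) : along (0 : VField EP P) f p = 0 :=
  map_zero (mfderiv 𝓘(ℝ, EP) 𝓘(ℝ, ℝ) f p)

lemma along_zero_right (X : VField EP P) (p : P) : along X (0 : P → ℝ) p = 0 :=
  along_eq_zero_of_const isOpen_univ trivial fun _ _ => rfl

namespace AdaptedFrame

variable {b : BilinField EP P} {U : Set M}
  (F : AdaptedFrame K (EuclideanSpace ℝ (Fin 1)) π b 1 3 U) (H : ThreeForm EP P)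

/-- The coefficients of `[V, η i]`, for the horizontal frame vector `V`. -/
noncomputable def conn (i j : Fin 3) : P → ℝ := ev₂ b (brk (F.hor 0) (F.ver i)) (F.ver j)

/-- The coefficients of `[η i, η j]`. -/
noncomputable def struc (i j k : Fin 3) : P → ℝ := ev₂ b (brk (F.ver i) (F.ver j)) (F.ver k)

/-- The components of `D_V G`. -/
noncomputable def shape (i j : Fin 3) : P → ℝ := fun p => - (F.conn i j p + F.conn j i p)

/-- The components of `i_V H`. -/
noncomputable def flux (i j : Fin 3) : P → ℝ := ev₃ H (F.hor 0) (F.ver i) (F.ver j)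

/-- The components of the restriction of `H` to vertical vectors. -/
noncomputable def fluxVer (i j k : Fin 3) : P → ℝ := ev₃ H (F.ver i) (F.ver j) (F.ver k)

variable (hπ : IsPrincipalBundle EK K (EuclideanSpace ℝ (Fin 1)) EP π) (hb : IsInvMetric K b)
  (hH : IsInvForm K H)

include hb in
/-- Tangent vectors are combinations of the frame vectors. -/
lemma expand {p : P} (hp : p ∈ π ⁻¹' U) (w : TangentSpace 𝓘(ℝ, EP) p) :
    w = b p w (F.hor 0 p) • F.hor 0 p + ∑ i, b p w (F.ver i p) • F.ver i p := by
  have hv0 : ∀ i, b p (F.hor 0 p) (F.ver i p) = 0 := fun i =>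
    F.hor_horizontal 0 p hp _ (F.ver_vertical i p hp)
  have h00 : b p (F.hor 0 p) (F.hor 0 p) = 1 := by simpa using F.hor_orthonormal 0 0 p hp
  set w' := w - (b p w (F.hor 0 p) • F.hor 0 p + ∑ i, b p w (F.ver i p) • F.ver i p) with hw'
  have e0 : b p w' (F.hor 0 p) = 0 := by
    simp [hw', h00, hb.symm p _ (F.hor 0 p), hv0]
  have ei : ∀ j, b p w' (F.ver j p) = 0 := fun j => by
    simp [hw', hv0, F.ver_orthonormal _ j p hp]
  -- The remainder `w'` is orthogonal to the spanning frame, hence to itself.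
  have hall : ∀ x, b p w' x = 0 := by
    intro x
    have hx : x ∈ Submodule.span ℝ
        (Set.range (fun α => F.hor α p) ∪ Set.range (fun i => F.ver i p)) := by
      rw [F.complete p hp]; trivial
    induction hx using Submodule.span_induction with
    | mem x hx =>
      rcases hx with ⟨α, rfl⟩ | ⟨i, rfl⟩
      · rw [Subsingleton.elim α 0]; exact e0
      · exact ei i
    | zero => exact map_zero _
    | add x y _ _ hx hy => rw [map_add, hx, hy, add_zero]
    | smul c x _ hx => rw [map_smul, hx, smul_zero]
  by_contra hne
  exact (hb.pos p w' (sub_ne_zero.2 hne)).ne' (hall w')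

include hb in
lemma expand_vertical {p : P} (hp : p ∈ π ⁻¹' U) {w : TangentSpace 𝓘(ℝ, EP) p}
    (hw : mfderiv 𝓘(ℝ, EP) 𝓘(ℝ, EuclideanSpace ℝ (Fin 1)) π p w = 0) :
    w = ∑ i, b p w (F.ver i p) • F.ver i p := by
  have := F.expand hb hp w
  rwa [hb.symm p w, F.hor_horizontal 0 p hp w hw, zero_smul, zero_add] at this

lemma ver_ne_zero {p : P} (hp : p ∈ π ⁻¹' U) (i : Fin 3) : F.ver i p ≠ 0 := fun h => by
  have := F.ver_orthonormal i i p hp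
  simp [h] at this

include hπ hb in
-- Brackets of invariant fields with vertical ones are vertical. With a single horizontal vector,
-- `conn` and `struc` thus encode all brackets of the frame.
lemma brk_hor_ver {p : P} (hp : p ∈ π ⁻¹' U) (i : Fin 3) :
    brk (F.hor 0) (F.ver i) p = ∑ j, F.conn i j p • F.ver j p :=
  F.expand_vertical hb hp (hπ.vertical_brk F.isOpen (F.hor_smooth 0) (F.hor_invariant 0)
    (F.ver_smooth i) (F.ver_vertical i) hp (F.ver_ne_zero hp i))

include hπ hb in
lemma brk_ver_ver {p : P} (hp : p ∈ π ⁻¹' U) (i j : Fin 3) :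
    brk (F.ver i) (F.ver j) p = ∑ k, F.struc i j k p • F.ver k p :=
  F.expand_vertical hb hp (hπ.vertical_brk F.isOpen (F.ver_smooth i) (F.ver_invariant i)
    (F.ver_smooth j) (F.ver_vertical j) hp (F.ver_ne_zero hp j))

section Regularity

include hπ hb

lemma smooth_conn (i j : Fin 3) : SmoothOn EP (F.conn i j) (π ⁻¹' U) :=
  have hW := hπ.isOpen_preimage F.isOpen
  hb.smooth _ _ _ hW ((F.hor_smooth 0).brk hW (F.ver_smooth i)) (F.ver_smooth j)

lemma smooth_struc (i j k : Fin 3) : SmoothOn EP (F.struc i j k) (π ⁻¹' U) :=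
  have hW := hπ.isOpen_preimage F.isOpen
  hb.smooth _ _ _ hW ((F.ver_smooth i).brk hW (F.ver_smooth j)) (F.ver_smooth k)

lemma smooth_shape (i j : Fin 3) : SmoothOn EP (F.shape i j) (π ⁻¹' U) :=
  ((F.smooth_conn hπ hb i j).add (F.smooth_conn hπ hb j i)).neg

lemma inv_conn (i j : Fin 3) : InvFun K (F.conn i j) (π ⁻¹' U) :=
  hb.invFun (hπ.invariant_brk F.isOpen (F.hor_smooth 0) (F.ver_smooth i) (F.hor_invariant 0)
    (F.ver_invariant i)) (F.ver_invariant j)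

lemma inv_struc (i j k : Fin 3) : InvFun K (F.struc i j k) (π ⁻¹' U) :=
  hb.invFun (hπ.invariant_brk F.isOpen (F.ver_smooth i) (F.ver_smooth j) (F.ver_invariant i)
    (F.ver_invariant j)) (F.ver_invariant k)

lemma inv_shape (i j : Fin 3) : InvFun K (F.shape i j) (π ⁻¹' U) := fun a p hp => by
  simp only [shape, F.inv_conn hπ hb _ _ a p hp]

omit hb
include hH

lemma smooth_flux (i j : Fin 3) : SmoothOn EP (F.flux H i j) (π ⁻¹' U) :=
  hH.smooth _ _ _ _ (hπ.isOpen_preimage F.isOpen) (F.hor_smooth 0) (F.ver_smooth i) (F.ver_smooth j)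

lemma smooth_fluxVer (i j k : Fin 3) : SmoothOn EP (F.fluxVer H i j k) (π ⁻¹' U) :=
  hH.smooth _ _ _ _ (hπ.isOpen_preimage F.isOpen) (F.ver_smooth i) (F.ver_smooth j) (F.ver_smooth k)

omit hπ

lemma inv_flux (i j : Fin 3) : InvFun K (F.flux H i j) (π ⁻¹' U) :=
  hH.invFun (F.hor_invariant 0) (F.ver_invariant i) (F.ver_invariant j)

end Regularity

lemma shape_symm (i j : Fin 3) : F.shape i j = F.shape j i := by
  funext p; simp only [shape]; ring

lemma struc_swap (i j k : Fin 3) (p : P) : F.struc j i k p = - F.struc i j k p := by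
  simp only [struc, ev₂, brk_swap (F.ver j) (F.ver i) p, map_neg, neg_apply]

lemma flux_swap (i j : Fin 3) (p : P) : F.flux H j i p = - F.flux H i j p := form_swap' H _ _ _

lemma ev₂_ver_lincomb {p : P} (hp : p ∈ π ⁻¹' U) (c d : Fin 3 → ℝ) :
    b p (∑ i, c i • F.ver i p) (∑ i, d i • F.ver i p) = ∑ i, c i * d i := by
  simp [F.ver_orthonormal _ _ p hp, mul_comm]

lemma ev₂_ver_lincomb_left {p : P} (hp : p ∈ π ⁻¹' U) (c : Fin 3 → ℝ) (j : Fin 3) :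
    b p (∑ i, c i • F.ver i p) (F.ver j p) = c j := by
  simp [F.ver_orthonormal _ _ p hp]

lemma vert_lincomb {p : P} (hp : p ∈ π ⁻¹' U) {Y : VField EP P} {c : Fin 3 → ℝ}
    (hY : Y p = ∑ i, c i • F.ver i p) : F.vert Y p = Y p := by
  simp only [vert, ev₂, hY, F.ev₂_ver_lincomb_left hp]

lemma vert_hor {p : P} (hp : p ∈ π ⁻¹' U) : F.vert (F.hor 0) p = 0 := by
  simp only [vert, ev₂, F.hor_horizontal 0 p hp _ (F.ver_vertical _ p hp), zero_smul,
    Finset.sum_const_zero]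

include hb in
lemma horiz_lincomb {p : P} (hp : p ∈ π ⁻¹' U) {Y : VField EP P} {c : Fin 3 → ℝ}
    (hY : Y p = ∑ i, c i • F.ver i p) : F.horiz Y p = 0 := by
  refine Finset.sum_eq_zero fun α _ => ?_
  simp only [ev₂, hY]
  rw [hb.symm]
  simp only [map_sum, map_smul, F.hor_horizontal _ p hp _ (F.ver_vertical _ p hp), smul_zero,
    Finset.sum_const_zero, zero_smul]

lemma horiz_hor {p : P} (hp : p ∈ π ⁻¹' U) : F.horiz (F.hor 0) p = F.hor 0 p := by
  simp only [horiz, ev₂, F.hor_orthonormal _ _ p hp]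
  simp

section Nabla

include hπ

/-- The Koszul expression is local in both arguments, so identities on `π⁻¹(U)` may be used inside
`∇`. -/
lemma nabla_congr {X X' Y Y' : VField EP P} {p : P} (hp : p ∈ π ⁻¹' U)
    (hX : ∀ q ∈ π ⁻¹' U, X q = X' q) (hY : ∀ q ∈ π ⁻¹' U, Y q = Y' q) :
    F.nabla X Y p = F.nabla X' Y' p := by
  have hW := hπ.isOpen_preimage F.isOpen
  have ev : ∀ {f g : P → ℝ}, (∀ q ∈ π ⁻¹' U, f q = g q) → f =ᶠ[𝓝 p] g := fun h =>
    Filter.eventuallyEq_of_mem (hW.mem_nhds hp) h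
  simp only [nabla]
  refine Finset.sum_congr rfl fun α _ => ?_
  rw [along_congr (hX p hp) (ev (f := ev₂ b Y (F.hor α)) (g := ev₂ b Y' (F.hor α))
      fun q hq => by simp [ev₂, hY q hq]),
    along_congr (hY p hp) (ev (f := ev₂ b X (F.hor α)) (g := ev₂ b X' (F.hor α))
      fun q hq => by simp [ev₂, hX q hq]),
    along_congr (rfl : F.hor α p = _) (ev (f := ev₂ b X Y) (g := ev₂ b X' Y')
      fun q hq => by simp [ev₂, hX q hq, hY q hq])]
  simp only [ev₂, brk_congr hW hp hX hY, brk_congr hW hp hX (fun _ _ => rfl),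
    brk_congr hW hp hY (fun _ _ => rfl), hX p hp, hY p hp]

omit hπ

lemma nabla_zero_right (X : VField EP P) (p : P) : F.nabla X 0 p = 0 := by
  have h1 : ∀ Z : VField EP P, ev₂ b 0 Z = 0 := fun Z => by funext q; simp [ev₂]
  have h2 : ∀ Z : VField EP P, ev₂ b Z 0 = 0 := fun Z => by funext q; simp [ev₂]
  simp only [nabla, h1, h2, along_zero_right, along_zero_left, Pi.zero_apply]
  simp [ev₂, brk_zero_right, brk_zero_left]

lemma nabla_zero_left (X : VField EP P) (p : P) : F.nabla 0 X p = 0 := by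
  have h1 : ∀ Z : VField EP P, ev₂ b 0 Z = 0 := fun Z => by funext q; simp [ev₂]
  have h2 : ∀ Z : VField EP P, ev₂ b Z 0 = 0 := fun Z => by funext q; simp [ev₂]
  simp only [nabla, h1, h2, along_zero_right, along_zero_left, Pi.zero_apply]
  simp [ev₂, brk_zero_left]

include hπ

/-- `V` has constant length and commutes with itself, so each term of the Koszul formula vanishes
when the base has dimension one. -/
lemma nabla_hor {p : P} (hp : p ∈ π ⁻¹' U) : F.nabla (F.hor 0) (F.hor 0) p = 0 := by
  have hW := hπ.isOpen_preimage F.isOpen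
  simp only [nabla, Fin.sum_univ_one]
  have h : along (F.hor 0) (ev₂ b (F.hor 0) (F.hor 0)) p = 0 :=
    along_eq_zero_of_const hW hp fun q hq => F.hor_orthonormal 0 0 q hq
  simp [h, ev₂, brk_self]

lemma D_hor {p : P} (hp : p ∈ π ⁻¹' U) : F.D (F.hor 0) (F.hor 0) p = 0 := by
  have hW := hπ.isOpen_preimage F.isOpen
  simp only [D, Pi.add_apply]
  rw [brk_congr (Y' := 0) hW hp (fun _ _ => rfl) (fun q hq => F.vert_hor hq),
    F.nabla_congr hπ hp (fun _ _ => rfl) (fun q hq => F.horiz_hor hq), F.nabla_hor hπ hp,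
    brk_zero_right, add_zero]

include hb

/-- This is the Leibniz rule for `[V, ·]`. Variable coefficients are required because `D` is later
applied to brackets of frame fields. -/
lemma D_lincomb {f : Fin 3 → P → ℝ} (hf : ∀ i, SmoothOn EP (f i) (π ⁻¹' U)) {Y : VField EP P}
    (hY : ∀ q ∈ π ⁻¹' U, Y q = ∑ i, f i q • F.ver i q) {p : P} (hp : p ∈ π ⁻¹' U) :
    F.D (F.hor 0) Y p =
      ∑ j, (along (F.hor 0) (f j) p + ∑ i, f i p * F.conn i j p) • F.ver j p := by
  have hW := hπ.isOpen_preimage F.isOpen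
  simp only [D, Pi.add_apply]
  rw [brk_congr (Y' := ∑ i, f i • F.ver i) hW hp (fun _ _ => rfl) (fun q hq => by
      rw [F.vert_lincomb hq (hY q hq), hY q hq]; simp),
    F.nabla_congr (Y' := 0) hπ hp (fun _ _ => rfl)
      (fun q hq => F.horiz_lincomb hb hq (hY q hq)),
    nabla_zero_right, add_zero, brk_lincomb_right hW hp hf F.ver_smooth]
  simp only [F.brk_hor_ver hπ hb hp, add_smul, Finset.sum_smul, Finset.smul_sum, mul_smul,
    Finset.sum_add_distrib]
  congr 1
  exact Finset.sum_comm

lemma D_ver (i : Fin 3) {p : P} (hp : p ∈ π ⁻¹' U) :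
    F.D (F.hor 0) (F.ver i) p = ∑ j, F.conn i j p • F.ver j p := by
  rw [F.D_lincomb hπ hb (f := fun j _ => if i = j then 1 else 0)
    (fun j => SmoothOn.const _ _) (fun q hq => by simp) hp]
  refine Finset.sum_congr rfl fun j _ => ?_
  rw [along_eq_zero_of_const isOpen_univ trivial (fun _ _ => rfl)]
  simp

/-- `D_V G` is tensorial. -/
lemma DG_lincomb {f g : Fin 3 → P → ℝ} (hf : ∀ i, SmoothOn EP (f i) (π ⁻¹' U))
    (hg : ∀ i, SmoothOn EP (g i) (π ⁻¹' U)) {Y Z : VField EP P}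
    (hY : ∀ q ∈ π ⁻¹' U, Y q = ∑ i, f i q • F.ver i q)
    (hZ : ∀ q ∈ π ⁻¹' U, Z q = ∑ i, g i q • F.ver i q) {p : P} (hp : p ∈ π ⁻¹' U) :
    F.DG (F.hor 0) Y Z p = ∑ i, ∑ j, f i p * g j p * F.shape i j p := by
  have hW := hπ.isOpen_preimage F.isOpen
  have h1 : along (F.hor 0) (ev₂ b Y Z) p =
      ∑ i, (along (F.hor 0) (f i) p * g i p + f i p * along (F.hor 0) (g i) p) := by
    refine ((HasAlong.sum_univ fun i => ((hf i).hasAlong hW hp (F.hor 0)).mul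
      ((hg i).hasAlong hW hp (F.hor 0))).congrOn hW hp fun q hq => ?_).2
    simp only [ev₂, hY q hq, hZ q hq, F.ev₂_ver_lincomb hq]
  simp only [DG, h1, ev₂, F.D_lincomb hπ hb hf hY hp, F.D_lincomb hπ hb hg hZ hp, hY p hp, hZ p hp,
    F.ev₂_ver_lincomb hp]
  simp only [shape, Fin.sum_univ_three]
  ring

lemma DG_ver (i j : Fin 3) {p : P} (hp : p ∈ π ⁻¹' U) :
    F.DG (F.hor 0) (F.ver i) (F.ver j) p = F.shape i j p := by
  rw [F.DG_lincomb hπ hb (f := fun k _ => if i = k then 1 else 0)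
    (g := fun k _ => if j = k then 1 else 0) (fun j => SmoothOn.const _ _)
    (fun j => SmoothOn.const _ _) (fun q hq => by simp) (fun q hq => by simp) hp]
  simp

end Nabla

end AdaptedFrame

end FrameCalculus

/-! ### The flow equations in frame components. -/

section FrameTensors

set_option linter.unusedSectionVars false

open scoped Topology

variable {EK : Type*} [NormedAddCommGroup EK] [NormedSpace ℝ EK]
  {K : Type*} [TopologicalSpace K] [Group K] [ChartedSpace EK K]
  {M : Type*} [TopologicalSpace M] [ChartedSpace (EuclideanSpace ℝ (Fin 1)) M]
  [IsManifold 𝓘(ℝ, EuclideanSpace ℝ (Fin 1)) ∞ M]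
  {EP : Type*} [NormedAddCommGroup EP] [NormedSpace ℝ EP] [CompleteSpace EP]
  {P : Type*} [TopologicalSpace P] [ChartedSpace EP P] [MulAction Kᵐᵒᵖ P]
  [IsManifold 𝓘(ℝ, EP) ∞ P] {π : P → M}

namespace AdaptedFrame

variable {b : BilinField EP P} {U : Set M}
  (F : AdaptedFrame K (EuclideanSpace ℝ (Fin 1)) π b 1 3 U) (H : ThreeForm EP P)
  (hπ : IsPrincipalBundle EK K (EuclideanSpace ℝ (Fin 1)) EP π) (hb : IsInvMetric K b)
  (hH : IsInvForm K H)

lemma curv_hor (p : P) : F.curv (F.hor 0) (F.hor 0) p = 0 := by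
  simp [curv, vert, ev₂, brk_self]

/-- The factor `2` arises because the horizontal vector can occupy either of the two traced slots.
-/
lemma Hsq_ver (i j : Fin 3) (p : P) : F.Hsq H (F.ver i) (F.ver j) p =
    2 * ∑ k, F.flux H i k p * F.flux H j k p
      + ∑ k, ∑ l, F.fluxVer H i k l p * F.fluxVer H j k l p := by
  have h1 : ∀ i k, ev₃ H (F.ver i) (F.hor 0) (F.ver k) p = - F.flux H i k p :=
    fun i k => form_swap H _ _ _
  have h2 : ∀ i k, ev₃ H (F.ver i) (F.ver k) (F.hor 0) p = F.flux H i k p :=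
    fun i k => form_rot H _ _ _
  have h3 : ∀ i, ev₃ H (F.ver i) (F.hor 0) (F.hor 0) p = 0 := fun i => form_self' H _ _
  simp only [Hsq, all, Fintype.sum_sum_type, Sum.elim_inl, Sum.elim_inr, Fin.sum_univ_one, h1, h2,
    h3, Finset.sum_add_distrib, fluxVer]
  simp only [neg_mul_neg, mul_zero, zero_add]
  ring

lemma Hsq_hor_ver (j : Fin 3) (p : P) : F.Hsq H (F.hor 0) (F.ver j) p =
    ∑ k, ∑ l, F.flux H k l p * F.fluxVer H j k l p := by
  have h1 : ∀ k, ev₃ H (F.hor 0) (F.hor 0) (F.ver k) p = 0 := fun k => form_self H _ _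
  have h2 : ∀ k, ev₃ H (F.hor 0) (F.ver k) (F.hor 0) p = 0 := fun k => form_self'' H _ _
  have h3 : ev₃ H (F.hor 0) (F.hor 0) (F.hor 0) p = 0 := form_self H _ _
  simp only [Hsq, all, Fintype.sum_sum_type, Sum.elim_inl, Sum.elim_inr, Fin.sum_univ_one, h1, h2,
    h3, fluxVer, flux, zero_mul, zero_add, Finset.sum_const_zero]

lemma Hsq_hor (p : P) : F.Hsq H (F.hor 0) (F.hor 0) p = ∑ k, ∑ l, F.flux H k l p ^ 2 := by
  have h1 : ∀ k, ev₃ H (F.hor 0) (F.hor 0) (F.ver k) p = 0 := fun k => form_self H _ _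
  have h2 : ∀ k, ev₃ H (F.hor 0) (F.ver k) (F.hor 0) p = 0 := fun k => form_self'' H _ _
  have h3 : ev₃ H (F.hor 0) (F.hor 0) (F.hor 0) p = 0 := form_self H _ _
  simp only [Hsq, all, Fintype.sum_sum_type, Sum.elim_inl, Sum.elim_inr, Fin.sum_univ_one, h1, h2,
    h3, flux, zero_mul, zero_add, Finset.sum_const_zero, sq]

/-- The components of `(D_· DG)_·`. -/
noncomputable def lapShape (i j : Fin 3) : P → ℝ := fun p =>
  along (F.hor 0) (F.shape i j) p - ∑ k, F.conn i k p * F.shape k j p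
    - ∑ k, F.conn j k p * F.shape i k p

/-- The components of `D_· H(·, *, *)`. -/
noncomputable def divFlux (k l : Fin 3) : P → ℝ := fun p =>
  along (F.hor 0) (F.flux H k l) p - ∑ m, F.conn k m p * F.flux H m l p
    - ∑ m, F.conn l m p * F.flux H k m p

/-- The vertical components of `B`. -/
noncomputable def potVer (k l : Fin 3) : P → ℝ := fun p =>
  F.divFlux H k l p
    - ∑ i, (F.shape i k p * F.flux H i l p - F.shape i l p * F.flux H i k p)
    + 1 / 2 * ∑ i, ∑ j, (F.struc i j k p * F.fluxVer H i j l p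
      - F.struc i j l p * F.fluxVer H i j k p)

/-- The mixed components of `B`. -/
noncomputable def potMixed (k : Fin 3) : P → ℝ := fun p =>
  1 / 2 * ∑ i, ∑ j, F.struc i j k p * F.flux H i j p

lemma sum_ite_smul_ver (i : Fin 3) (q : P) :
    F.ver i q = ∑ k, (if i = k then (1 : ℝ) else 0) • F.ver k q := by simp

include hπ hb

lemma normSqDG_eq {p : P} (hp : p ∈ π ⁻¹' U) :
    F.normSqDG p = ∑ i, ∑ j, F.shape i j p ^ 2 := by
  simp only [normSqDG, Fin.sum_univ_one, F.DG_ver hπ hb _ _ hp]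

omit hπ hb in
lemma trHsq_eq (p : P) : F.trHsq H p = ∑ i, ∑ j, F.flux H i j p ^ 2 := by
  simp only [trHsq, Fin.sum_univ_one, F.Hsq_hor H]

lemma DG_zero_left {p : P} (hp : p ∈ π ⁻¹' U) {X : VField EP P} {i j : Fin 3}
    (hX : ∀ q ∈ π ⁻¹' U, X q = 0) : F.DG X (F.ver i) (F.ver j) p = 0 := by
  have hW := hπ.isOpen_preimage F.isOpen
  have hD : ∀ i, F.D X (F.ver i) p = 0 := fun i => by
    simp only [D, Pi.add_apply]
    rw [brk_congr (X' := 0) hW hp hX (fun _ _ => rfl), brk_zero_left,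
      F.nabla_congr (X' := 0) hπ hp hX (fun _ _ => rfl), nabla_zero_left, add_zero]
  have ha : along X (ev₂ b (F.ver i) (F.ver j)) p = 0 :=
    (along_congr (Y := 0) (hX p hp) Filter.EventuallyEq.rfl).trans (along_zero_left _ _)
  simp only [DG, hD, ha, ev₂, map_zero, zero_apply, sub_zero]

/-- `∇_V V = 0` removes the term from the differentiated direction, so only the connection on the
two vertical slots corrects `V s`. -/
lemma lapG_ver (i j : Fin 3) {p : P} (hp : p ∈ π ⁻¹' U) :
    F.lapG (F.ver i) (F.ver j) p = F.lapShape i j p := by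
  have hW := hπ.isOpen_preimage F.isOpen
  have hc : ∀ i j : Fin 3, SmoothOn EP (fun _ : P => if i = j then (1 : ℝ) else 0) (π ⁻¹' U) :=
    fun _ _ => SmoothOn.const _ _
  simp only [lapG, DDG, Fin.sum_univ_one]
  rw [F.DG_zero_left hπ hb hp fun q hq => F.nabla_hor hπ hq,
    along_congr rfl (Filter.eventuallyEq_of_mem (hW.mem_nhds hp) fun q hq => F.DG_ver hπ hb i j hq),
    F.DG_lincomb hπ hb (F.smooth_conn hπ hb i) (hc j) (fun q hq => F.D_ver hπ hb i hq)
      (fun q _ => F.sum_ite_smul_ver j q) hp,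
    F.DG_lincomb hπ hb (hc i) (F.smooth_conn hπ hb j) (fun q _ => F.sum_ite_smul_ver i q)
      (fun q hq => F.D_ver hπ hb j hq) hp]
  simp [lapShape]

lemma rhsG_ver (i j : Fin 3) {p : P} (hp : p ∈ π ⁻¹' U) :
    F.rhsG H (F.ver i) (F.ver j) p = F.lapShape i j p
      - ∑ k, F.shape i k p * F.shape k j p
      + ∑ k, ∑ l, F.struc k i l p * F.struc k j l p
      - 1 / 2 * ∑ k, ∑ l, F.struc k l i p * F.struc k l j p
      + 1 / 2 * F.Hsq H (F.ver i) (F.ver j) p := by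
  have h1 : ∀ k l, ev₂ b (brk (F.ver k) (F.ver i)) (brk (F.ver l) (F.ver j)) p =
      ∑ m, F.struc k i m p * F.struc l j m p := fun k l => by
    simp only [ev₂, F.brk_ver_ver hπ hb hp, F.ev₂_ver_lincomb hp]
  have h2 : ∀ Z, ev₂ b (F.curv (F.hor 0) (F.hor 0)) Z p = 0 := fun Z => by
    simp [ev₂, curv_hor]
  simp only [rhsG, F.lapG_ver hπ hb i j hp, Fin.sum_univ_one, F.DG_ver hπ hb _ _ hp, h1, h2]
  simp only [struc]
  ring

/-- Both curvature terms vanish, since `F` is alternating and there is only one horizontal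
direction. -/
lemma rhsA_ver (j : Fin 3) {p : P} (hp : p ∈ π ⁻¹' U) :
    F.rhsA H (F.hor 0) (F.ver j) p = ∑ i, ∑ k, F.struc i j k p * F.shape k i p
      + 1 / 2 * F.Hsq H (F.hor 0) (F.ver j) p := by
  have hW := hπ.isOpen_preimage F.isOpen
  have hc : ∀ i j : Fin 3, SmoothOn EP (fun _ : P => if i = j then (1 : ℝ) else 0) (π ⁻¹' U) :=
    fun _ _ => SmoothOn.const _ _
  have c0 : F.curv (F.hor 0) (F.hor 0) = 0 := funext fun q => F.curv_hor q
  have v0 : F.vert 0 = 0 := funext fun q => by simp [vert, ev₂]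
  have h0 : F.horiz 0 = 0 := funext fun q => by simp [horiz, ev₂]
  have c1 : F.curv (F.nabla (F.hor 0) (F.hor 0)) (F.hor 0) p = 0 := by
    have : brk (F.nabla (F.hor 0) (F.hor 0)) (F.hor 0) p = 0 := by
      rw [brk_congr (X' := 0) hW hp (fun q hq => F.nabla_hor hπ hq) (fun _ _ => rfl), brk_zero_left]
    simp [curv, vert, ev₂, this]
  have c2 : F.curv (F.hor 0) (F.nabla (F.hor 0) (F.hor 0)) p = 0 := by
    have : brk (F.hor 0) (F.nabla (F.hor 0) (F.hor 0)) p = 0 := by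
      rw [brk_congr (Y' := 0) hW hp (fun _ _ => rfl) (fun q hq => F.nabla_hor hπ hq),
        brk_zero_right]
    simp [curv, vert, ev₂, this]
  have d0 : F.Dcurv (F.hor 0) (F.hor 0) (F.hor 0) p = 0 := by
    simp only [Dcurv, Pi.sub_apply, c0, c1, c2, D, Pi.add_apply, v0, h0, brk_zero_right,
      nabla_zero_right, add_zero, sub_zero]
  have g0 : F.DG (F.hor 0) 0 (F.ver j) p = 0 := by
    rw [F.DG_lincomb hπ hb (f := fun _ _ => 0) (fun _ => SmoothOn.const _ _) (hc j)
      (fun q _ => by simp) (fun q _ => F.sum_ite_smul_ver j q) hp]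
    simp
  have g1 : ∀ i, F.DG (F.hor 0) (brk (F.ver i) (F.ver j)) (F.ver i) p =
      ∑ k, F.struc i j k p * F.shape k i p := fun i => by
    rw [F.DG_lincomb hπ hb (F.smooth_struc hπ hb i j) (hc i)
      (fun q hq => F.brk_ver_ver hπ hb hq i j) (fun q _ => F.sum_ite_smul_ver i q) hp]
    simp
  simp only [rhsA, Fin.sum_univ_one, c0, g0, g1, ev₂, d0, map_zero,
    zero_apply]
  ring

/-- Ricci and curvature terms vanish over a one-dimensional base. The metric of the base thus grows
by half the energy density, which is the source of the quadratic term in the evolution equation. -/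
lemma rhsg_hor {p : P} (hp : p ∈ π ⁻¹' U) : F.rhsg H (F.hor 0) (F.hor 0) p =
    1 / 2 * (F.normSqDG p + F.trHsq H p) := by
  have n1 : F.nabla (F.hor 0) (F.nabla (F.hor 0) (F.hor 0)) p = 0 := by
    rw [F.nabla_congr (Y' := 0) hπ hp (fun _ _ => rfl) (fun q hq => F.nabla_hor hπ hq),
      nabla_zero_right]
  have n2 : F.nabla (F.horiz (brk (F.hor 0) (F.hor 0))) (F.hor 0) p = 0 := by
    rw [F.nabla_congr (X' := 0) hπ hp (fun q _ => by simp [horiz, ev₂, brk_self])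
      (fun _ _ => rfl), nabla_zero_left]
  have r0 : F.Ric (F.hor 0) (F.hor 0) p = 0 := by
    simp [Ric, ev₂, n1, n2]
  simp only [rhsg, r0, Fin.sum_univ_one, ev₂, curv_hor, map_zero, normSqDG, trHsq, sq]
  ring

include hH

/-- `D_V V = 0` disposes of the horizontal slot, and the derivatives of the coefficients cancel. -/
lemma DH_lincomb {f g : Fin 3 → P → ℝ} (hf : ∀ i, SmoothOn EP (f i) (π ⁻¹' U))
    (hg : ∀ i, SmoothOn EP (g i) (π ⁻¹' U)) {Y Z : VField EP P}
    (hY : ∀ q ∈ π ⁻¹' U, Y q = ∑ i, f i q • F.ver i q)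
    (hZ : ∀ q ∈ π ⁻¹' U, Z q = ∑ i, g i q • F.ver i q) {p : P} (hp : p ∈ π ⁻¹' U) :
    F.DH H (F.hor 0) (F.hor 0) Y Z p = ∑ k, ∑ l, f k p * g l p * F.divFlux H k l p := by
  have hW := hπ.isOpen_preimage F.isOpen
  have h1 : along (F.hor 0) (ev₃ H (F.hor 0) Y Z) p = ∑ k, ∑ l,
      ((along (F.hor 0) (f k) p * g l p + f k p * along (F.hor 0) (g l) p) * F.flux H k l p
        + f k p * g l p * along (F.hor 0) (F.flux H k l) p) := by
    refine ((HasAlong.sum_univ fun k => HasAlong.sum_univ fun l =>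
      (((hf k).hasAlong hW hp (F.hor 0)).mul ((hg l).hasAlong hW hp (F.hor 0))).mul
        ((F.smooth_flux H hπ hH k l).hasAlong hW hp (F.hor 0))).congrOn hW hp fun q hq => ?_).2
    simp only [ev₃, hY q hq, hZ q hq, form_lincomb', form_lincomb'', Finset.mul_sum, flux]
    rw [Finset.sum_comm]
    exact Finset.sum_congr rfl fun k _ => Finset.sum_congr rfl fun l _ => by ring
  simp only [DH, h1, ev₃, F.D_hor hπ hp, F.D_lincomb hπ hb hf hY hp, F.D_lincomb hπ hb hg hZ hp,
    hY p hp, hZ p hp, form_lincomb', form_lincomb'']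
  have h0 : ∀ v w : TangentSpace 𝓘(ℝ, EP) p, H p ![0, v, w] = 0 := fun v w =>
    (H p).map_coord_zero 0 rfl
  have hfl : ∀ k l, H p ![F.hor 0 p, F.ver k p, F.ver l p] = F.flux H k l p := fun _ _ => rfl
  simp only [h0, hfl, divFlux, Fin.sum_univ_three]
  ring

/-- Tensoriality with non-constant coefficients is needed because `dB` evaluates `B` on brackets of
frame fields. -/
lemma B_lincomb {f g : Fin 3 → P → ℝ} (hf : ∀ i, SmoothOn EP (f i) (π ⁻¹' U))
    (hg : ∀ i, SmoothOn EP (g i) (π ⁻¹' U)) {Y Z : VField EP P}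
    (hY : ∀ q ∈ π ⁻¹' U, Y q = ∑ i, f i q • F.ver i q)
    (hZ : ∀ q ∈ π ⁻¹' U, Z q = ∑ i, g i q • F.ver i q) {p : P} (hp : p ∈ π ⁻¹' U) :
    F.B H Y Z p = ∑ k, ∑ l, f k p * g l p * F.potVer H k l p := by
  have hc : ∀ i j : Fin 3, SmoothOn EP (fun _ : P => if i = j then (1 : ℝ) else 0) (π ⁻¹' U) :=
    fun _ _ => SmoothOn.const _ _
  have hv : ∀ {f : Fin 3 → P → ℝ} {Y : VField EP P}, (∀ i, SmoothOn EP (f i) (π ⁻¹' U)) →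
      (∀ q ∈ π ⁻¹' U, Y q = ∑ i, f i q • F.ver i q) → ∀ i,
      F.DG (F.hor 0) (F.ver i) (F.vert Y) p = ∑ k, f k p * F.shape i k p := fun hf hY i => by
    rw [F.DG_lincomb hπ hb (hc i) hf (fun q _ => F.sum_ite_smul_ver i q)
      (fun q hq => (F.vert_lincomb hq (hY q hq)).trans (hY q hq)) hp]
    simp
  have hs : ∀ {f : Fin 3 → P → ℝ} {Y : VField EP P},
      (∀ q ∈ π ⁻¹' U, Y q = ∑ i, f i q • F.ver i q) → ∀ i j,
      ev₂ b (brk (F.ver i) (F.ver j)) (F.vert Y) p = ∑ k, f k p * F.struc i j k p :=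
    fun hY i j => by
    simp only [ev₂, F.vert_lincomb hp (hY p hp), hY p hp, F.brk_ver_ver hπ hb hp,
      F.ev₂_ver_lincomb hp, mul_comm]
  have hfl : ∀ {f : Fin 3 → P → ℝ} {Y : VField EP P},
      (∀ q ∈ π ⁻¹' U, Y q = ∑ i, f i q • F.ver i q) → ∀ i,
      ev₃ H (F.hor 0) (F.ver i) Y p = ∑ k, f k p * F.flux H i k p := fun hY i => by
    simp only [ev₃, hY p hp, form_lincomb'', flux]
  have hfv : ∀ {f : Fin 3 → P → ℝ} {Y : VField EP P},
      (∀ q ∈ π ⁻¹' U, Y q = ∑ i, f i q • F.ver i q) → ∀ i j,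
      ev₃ H (F.ver i) (F.ver j) Y p = ∑ k, f k p * F.fluxVer H i j k p := fun hY i j => by
    simp only [ev₃, hY p hp, form_lincomb'', fluxVer]
  have h2 : ∀ Z, ev₂ b (F.curv (F.hor 0) (F.hor 0)) Z p = 0 := fun Z => by
    simp [ev₂, curv_hor]
  simp only [B, Fin.sum_univ_one, F.DH_lincomb H hπ hb hH hf hg hY hZ hp, hv hf hY, hv hg hZ,
    hs hY, hs hZ, hfl hY, hfl hZ, hfv hY, hfv hZ, h2, zero_mul, sub_zero, mul_zero]
  have e : ∀ (S T : Fin 3 → ℝ) , (∑ k, f k p * S k) * (∑ l, g l p * T l) =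
      ∑ k, ∑ l, f k p * g l p * (S k * T l) := fun S T => by
    rw [Finset.sum_mul_sum]
    exact Finset.sum_congr rfl fun k _ => Finset.sum_congr rfl fun l _ => by ring
  have e' : ∀ (S T : Fin 3 → ℝ) , (∑ l, g l p * S l) * (∑ k, f k p * T k) =
      ∑ k, ∑ l, f k p * g l p * (S l * T k) := fun S T => by
    rw [Finset.sum_mul_sum, Finset.sum_comm]
    exact Finset.sum_congr rfl fun k _ => Finset.sum_congr rfl fun l _ => by ring
  have c : ∀ T : Fin 3 → Fin 3 → Fin 3 → ℝ, ∑ i, ∑ k, ∑ l, T i k l = ∑ k, ∑ l, ∑ i, T i k l :=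
    fun T => by
    rw [Finset.sum_comm]
    exact Finset.sum_congr rfl fun k _ => Finset.sum_comm
  simp only [e, e', ← Finset.sum_sub_distrib, ← mul_sub, c, ← Finset.mul_sum]
  simp only [potVer, mul_add, mul_sub, Finset.sum_add_distrib, Finset.sum_sub_distrib,
    Finset.mul_sum]
  ring_nf

lemma B_ver (k l : Fin 3) {p : P} (hp : p ∈ π ⁻¹' U) :
    F.B H (F.ver k) (F.ver l) p = F.potVer H k l p := by
  rw [F.B_lincomb H hπ hb hH (f := fun i _ => if k = i then 1 else 0)
    (g := fun i _ => if l = i then 1 else 0) (fun _ => SmoothOn.const _ _)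
    (fun _ => SmoothOn.const _ _) (fun q _ => F.sum_ite_smul_ver k q)
    (fun q _ => F.sum_ite_smul_ver l q) hp]
  simp

omit hH hb in
lemma DH_mixed (Y : VField EP P) {p : P} (hp : p ∈ π ⁻¹' U) :
    F.DH H (F.hor 0) (F.hor 0) Y (F.hor 0) p = 0 := by
  have h0 : ∀ v w : TangentSpace 𝓘(ℝ, EP) p, H p ![0, v, w] = 0 := fun v w =>
    (H p).map_coord_zero 0 rfl
  have h1 : ev₃ H (F.hor 0) Y (F.hor 0) = 0 := funext fun q => form_self'' H _ _
  simp only [DH, h1, along_zero_right, ev₃, F.D_hor hπ hp, h0, form_self'']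
  rw [form_rot H (0 : TangentSpace 𝓘(ℝ, EP) p), h0]
  ring

omit hH in
-- With one argument horizontal only the bracket term survives: `H(V, ·, V) = 0`, the curvature is
-- zero, and the projection of `V` to `𝔊` is zero.
lemma B_mixed {f : Fin 3 → P → ℝ} {Y : VField EP P} (hY : ∀ q ∈ π ⁻¹' U, Y q = ∑ i, f i q • F.ver i q) {p : P}
    (hp : p ∈ π ⁻¹' U) :
    F.B H Y (F.hor 0) p = ∑ k, f k p * F.potMixed H k p := by
  have hc : ∀ i j : Fin 3, SmoothOn EP (fun _ : P => if i = j then (1 : ℝ) else 0) (π ⁻¹' U) :=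
    fun _ _ => SmoothOn.const _ _
  have hv : ∀ i, F.DG (F.hor 0) (F.ver i) (F.vert (F.hor 0)) p = 0 := fun i => by
    rw [F.DG_lincomb hπ hb (g := fun _ _ => 0) (hc i) (fun _ => SmoothOn.const _ _)
      (fun q _ => F.sum_ite_smul_ver i q) (fun q hq => by simpa using F.vert_hor hq) hp]
    simp
  have h1 : ∀ i, ev₃ H (F.hor 0) (F.ver i) (F.hor 0) p = 0 := fun i => form_self'' H _ _
  have h2 : ∀ Z, ev₂ b (F.curv (F.hor 0) (F.hor 0)) Z p = 0 := fun Z => by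
    simp [ev₂, curv_hor]
  have h3 : ∀ i j, ev₂ b (brk (F.ver i) (F.ver j)) (F.vert (F.hor 0)) p = 0 := fun i j => by
    simp [ev₂, F.vert_hor hp]
  have h4 : ∀ i j, ev₃ H (F.ver i) (F.ver j) (F.hor 0) p = F.flux H i j p := fun i j =>
    form_rot H _ _ _
  have h5 : ∀ i j, ev₂ b (brk (F.ver i) (F.ver j)) (F.vert Y) p = ∑ k, f k p * F.struc i j k p :=
    fun i j => by
    simp only [ev₂, F.vert_lincomb hp (hY p hp), hY p hp, F.brk_ver_ver hπ hb hp,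
      F.ev₂_ver_lincomb hp, mul_comm]
  simp only [B, Fin.sum_univ_one, F.DH_mixed H hπ Y hp, hv, h1, h2, h3, h4, h5, zero_mul,
    mul_zero, sub_zero, Finset.sum_const_zero, zero_add]
  simp only [potMixed, Fin.sum_univ_three]
  ring

omit hπ hb hH in
lemma B_swap (Y Z : VField EP P) (p : P) : F.B H Y Z p = - F.B H Z Y p := by
  have h : ∀ X : VField EP P, ev₃ H X Z Y = fun q => - ev₃ H X Y Z q := fun X =>
    funext fun q => form_swap' H _ _ _
  have hD : ∀ X : VField EP P, F.DH H X X Z Y p = - F.DH H X X Y Z p := fun X => by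
    have h1 : along X (ev₃ H X Z Y) p = - along X (ev₃ H X Y Z) p := by
      rw [h, along_eq_mvfderiv, along_eq_mvfderiv,
        show (fun q => - ev₃ H X Y Z q) = - ev₃ H X Y Z from rfl, mvfderiv_neg]
      rfl
    have h2 : ∀ u v w : TangentSpace 𝓘(ℝ, EP) p, H p ![u, w, v] = - H p ![u, v, w] :=
      fun u v w => form_swap' H u v w
    simp only [DH, h1, ev₃]
    rw [h2 _ (Y p) (Z p), h2 _ (Y p) (F.D X Z p), h2 _ (F.D X Y p) (Z p)]
    ring
  simp only [B, Fin.sum_univ_one, hD]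
  simp only [Fin.sum_univ_three]
  ring

lemma smooth_potMixed (k : Fin 3) : SmoothOn EP (F.potMixed H k) (π ⁻¹' U) :=
  (SmoothOn.const _ _).mul (SmoothOn.sum_univ fun i => SmoothOn.sum_univ fun j =>
      (F.smooth_struc hπ hb i j k).mul (F.smooth_flux H hπ hH i j))

lemma inv_potMixed (k : Fin 3) : InvFun K (F.potMixed H k) (π ⁻¹' U) := fun a p hp => by
  simp only [potMixed, F.inv_struc hπ hb _ _ _ a p hp, F.inv_flux H hH _ _ a p hp]

/-- The derivatives along vertical vectors drop out because the mixed components of `B` are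
invariant. The bracket `[η_k, η_l]` is paired with `V`, which is how those mixed components enter.
-/
lemma extD_B {k l : Fin 3} {p : P} (hp : p ∈ π ⁻¹' U) :
    extD₂ (F.B H) (F.hor 0) (F.ver k) (F.ver l) p = along (F.hor 0) (F.potVer H k l) p
      - ∑ m, F.conn k m p * F.potVer H m l p + ∑ m, F.conn l m p * F.potVer H m k p
      - ∑ m, F.struc k l m p * F.potMixed H m p := by
  have hW := hπ.isOpen_preimage F.isOpen
  have hc : ∀ i j : Fin 3, SmoothOn EP (fun _ : P => if i = j then (1 : ℝ) else 0) (π ⁻¹' U) :=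
    fun _ _ => SmoothOn.const _ _
  have ev : ∀ {f g : P → ℝ}, (∀ q ∈ π ⁻¹' U, f q = g q) → f =ᶠ[𝓝 p] g := fun h =>
    Filter.eventuallyEq_of_mem (hW.mem_nhds hp) h
  have h1 : ∀ i j, along (F.ver i) (F.B H (F.hor 0) (F.ver j)) p = 0 := fun i j => by
    have hev : ∀ q ∈ π ⁻¹' U, F.B H (F.hor 0) (F.ver j) q = - F.potMixed H j q := fun q hq => by
      rw [B_swap, F.B_mixed H hπ hb (f := fun i _ => if j = i then 1 else 0) (fun q _ => F.sum_ite_smul_ver j q) hq]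
      simp
    rw [along_congr rfl (ev hev)]
    exact hπ.along_vertical F.isOpen
      (fun a q hq => by simp only [F.inv_potMixed H hπ hb hH j a q hq])
      (F.smooth_potMixed H hπ hb hH j).neg hp (F.ver_vertical i p hp)
  have h2 : ∀ i j, F.B H (brk (F.hor 0) (F.ver i)) (F.ver j) p =
      ∑ m, F.conn i m p * F.potVer H m j p := fun i j => by
    rw [F.B_lincomb H hπ hb hH (F.smooth_conn hπ hb i) (hc j)
      (fun q hq => F.brk_hor_ver hπ hb hq i) (fun q _ => F.sum_ite_smul_ver j q) hp]
    simp
  simp only [extD₂, along_congr rfl (ev fun q hq => F.B_ver H hπ hb hH k l hq), h1, h2,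
    F.B_mixed H hπ hb (fun q hq => F.brk_ver_ver hπ hb hq k l) hp]
  ring

omit hH in
/-- The Jacobi identity for the frame fields. -/
lemma along_struc (i j k : Fin 3) {p : P} (hp : p ∈ π ⁻¹' U) :
    along (F.hor 0) (F.struc i j k) p = ∑ l, F.conn i l p * F.struc l j k p
      + ∑ l, F.conn j l p * F.struc i l k p - ∑ l, F.struc i j l p * F.conn l k p := by
  have hW := hπ.isOpen_preimage F.isOpen
  have hbr : ∀ (q : P) (c : Fin 3 → P → ℝ), ∑ i, c i q • F.ver i q = (∑ i, c i • F.ver i) q :=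
    fun q c => by simp
  have hve : ∀ m (f : P → ℝ), SmoothOn EP f (π ⁻¹' U) → InvFun K f (π ⁻¹' U) →
      along (F.ver m) f p = 0 := fun m f hf hi =>
    hπ.along_vertical F.isOpen hi hf hp (F.ver_vertical m p hp)
  -- The functions `conn` are invariant, so bracketing with `η_i` and `η_j` does not differentiate
  -- them. The only derivative left is that of `struc` along `V`.
  have jac := brk_jacobi hW hp (F.hor_smooth 0) (F.ver_smooth i) (F.ver_smooth j)
  rw [brk_congr (Y := brk (F.ver i) (F.ver j)) (Y' := ∑ k, F.struc i j k • F.ver k) hW hp (fun _ _ => rfl) (fun q hq => by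
      rw [F.brk_ver_ver hπ hb hq, hbr]),
    brk_congr (X := brk (F.hor 0) (F.ver i)) (X' := ∑ k, F.conn i k • F.ver k) hW hp (fun q hq => by
      rw [F.brk_hor_ver hπ hb hq, hbr]) (fun _ _ => rfl),
    brk_congr (Y := brk (F.hor 0) (F.ver j)) (Y' := ∑ k, F.conn j k • F.ver k) hW hp (fun _ _ => rfl) (fun q hq => by
      rw [F.brk_hor_ver hπ hb hq, hbr]),
    brk_lincomb_right hW hp (F.smooth_struc hπ hb i j) F.ver_smooth,
    brk_lincomb_right hW hp (F.smooth_conn hπ hb j) F.ver_smooth,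
    brk_lincomb_left hW hp (F.smooth_conn hπ hb i) F.ver_smooth] at jac
  simp only [fun l => hve j _ (F.smooth_conn hπ hb i l) (F.inv_conn hπ hb i l),
    fun l => hve i _ (F.smooth_conn hπ hb j l) (F.inv_conn hπ hb j l), neg_zero, zero_smul,
    zero_add, Finset.sum_add_distrib] at jac
  have jk := congrArg (fun w => b p w (F.ver k p)) jac
  have hC : ∀ i j k, b p (brk (F.ver i) (F.ver j) p) (F.ver k p) = F.struc i j k p :=
    fun _ _ _ => rfl
  have hA : ∀ i k, b p (brk (F.hor 0) (F.ver i) p) (F.ver k p) = F.conn i k p := fun _ _ => rfl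
  simp only [map_add, add_apply, F.ev₂_ver_lincomb_left hp] at jk
  simp only [map_sum, map_smul, sum_apply, smul_apply, hC, hA,
    smul_eq_mul] at jk
  linarith

/-- Closedness of `H`, evaluated on the frame. -/
lemma along_fluxVer (hcl : ∀ (W : Set P) (X Y Z V : VField EP P), IsOpen W →
      SmoothFieldOn X W → SmoothFieldOn Y W → SmoothFieldOn Z W → SmoothFieldOn V W →
      ∀ p ∈ W, extD₃ (ev₃ H) X Y Z V p = 0) (i j k : Fin 3) {p : P} (hp : p ∈ π ⁻¹' U) :
    along (F.hor 0) (F.fluxVer H i j k) p = ∑ m, F.conn i m p * F.fluxVer H m j k p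
      - ∑ m, F.conn j m p * F.fluxVer H m i k p + ∑ m, F.conn k m p * F.fluxVer H m i j p
      - ∑ m, F.struc i j m p * F.flux H m k p + ∑ m, F.struc i k m p * F.flux H m j p
      - ∑ m, F.struc j k m p * F.flux H m i p := by
  have hW := hπ.isOpen_preimage F.isOpen
  -- In `dH(V, η_i, η_j, η_k) = 0` the three vertical derivatives of components of `i_V H` vanish by
  -- invariance, and the equation can be solved for `V H(η_i, η_j, η_k)`.
  have h := hcl _ _ _ _ _ hW (F.hor_smooth 0) (F.ver_smooth i) (F.ver_smooth j) (F.ver_smooth k) p hp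
  have hve : ∀ m i j, along (F.ver m) (ev₃ H (F.hor 0) (F.ver i) (F.ver j)) p = 0 := fun m i j =>
    hπ.along_vertical F.isOpen (F.inv_flux H hH i j) (F.smooth_flux H hπ hH i j) hp
      (F.ver_vertical m p hp)
  have h1 : ∀ i j k, ev₃ H (brk (F.hor 0) (F.ver i)) (F.ver j) (F.ver k) p =
      ∑ m, F.conn i m p * F.fluxVer H m j k p := fun i j k => by
    simp only [ev₃, F.brk_hor_ver hπ hb hp, form_lincomb, fluxVer]
  have h2 : ∀ i j k, ev₃ H (brk (F.ver i) (F.ver j)) (F.hor 0) (F.ver k) p =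
      - ∑ m, F.struc i j m p * F.flux H m k p := fun i j k => by
    simp only [ev₃, F.brk_ver_ver hπ hb hp, form_lincomb, flux, ← Finset.sum_neg_distrib]
    exact Finset.sum_congr rfl fun m _ => by rw [form_swap]; ring
  simp only [extD₃, hve, h1, h2] at h
  have : along (F.hor 0) (F.fluxVer H i j k) p
    = along (F.hor 0) (ev₃ H (F.ver i) (F.ver j) (F.ver k)) p := rfl
  linarith

end AdaptedFrame

end FrameTensors

/-! ### The polynomial identity behind the evolution equation. -/

section Algebra

/-- The values at a point, for an adapted frame with central last vector, of the structure
functions of the frame and of their derivatives along the horizontal frame vector: `A`, `C` are the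
structure functions, `s` the components of `D_V G`, `w` and `H` those of the three-form; primes
denote derivatives. -/
structure PointData (A A' s s' s'' w w' w'' : Fin 3 → Fin 3 → ℝ)
    (C C' H H' : Fin 3 → Fin 3 → Fin 3 → ℝ) : Prop where
  s_eq : ∀ i j, s i j = - (A i j + A j i)
  s'_eq : ∀ i j, s' i j = - (A' i j + A' j i)
  s''_symm : ∀ i j, s'' j i = s'' i j
  w_swap : ∀ i j, w j i = - w i j
  w'_swap : ∀ i j, w' j i = - w' i j
  w''_swap : ∀ i j, w'' j i = - w'' i j
  H_swap : ∀ i j k, H j i k = - H i j k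
  H_swap' : ∀ i j k, H i k j = - H i j k
  C_swap : ∀ i j k, C j i k = - C i j k
  C_central : ∀ i k, C 2 i k = 0
  C_zero : C 0 1 0 = 0 ∧ C 0 1 1 = 0
  C'_eq : ∀ i j k, C' i j k =
    ∑ l, A i l * C l j k + ∑ l, A j l * C i l k - ∑ l, C i j l * A l k
  H'_eq : ∀ i j k, H' i j k = ∑ m, A i m * H m j k - ∑ m, A j m * H m i k + ∑ m, A k m * H m i j
    - ∑ m, C i j m * w m k + ∑ m, C i k m * w m j - ∑ m, C j k m * w m i

/-- These normal forms build the symmetries of an array into explicit matrices whose entries are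
free variables, as expansion by `ring` requires. -/
lemma eq_vec_of_symm {s : Fin 3 → Fin 3 → ℝ} (h : ∀ i j, s j i = s i j) :
    s = ![![s 0 0, s 0 1, s 0 2], ![s 0 1, s 1 1, s 1 2], ![s 0 2, s 1 2, s 2 2]] := by
  funext i j
  match i, j with
  | 0, 0 => rfl
  | 0, 1 => rfl
  | 0, 2 => rfl
  | 1, 0 => exact h 0 1
  | 1, 1 => rfl
  | 1, 2 => rfl
  | 2, 0 => exact h 0 2
  | 2, 1 => exact h 1 2
  | 2, 2 => rfl

lemma eq_vec_of_swap {w : Fin 3 → Fin 3 → ℝ} (h : ∀ i j, w j i = - w i j) :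
    w = ![![0, w 0 1, w 0 2], ![- w 0 1, 0, w 1 2], ![- w 0 2, - w 1 2, 0]] := by
  have h0 : ∀ i, w i i = 0 := fun i => by linarith [h i i]
  funext i j
  match i, j with
  | 0, 0 => exact h0 0
  | 0, 1 => rfl
  | 0, 2 => rfl
  | 1, 0 => exact h 0 1
  | 1, 1 => exact h0 1
  | 1, 2 => rfl
  | 2, 0 => exact h 0 2
  | 2, 1 => exact h 1 2
  | 2, 2 => exact h0 2

lemma eq_vec (A : Fin 3 → Fin 3 → ℝ) :
    A = ![![A 0 0, A 0 1, A 0 2], ![A 1 0, A 1 1, A 1 2], ![A 2 0, A 2 1, A 2 2]] := by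
  funext i j
  match i, j with
  | 0, 0 => rfl
  | 0, 1 => rfl
  | 0, 2 => rfl
  | 1, 0 => rfl
  | 1, 1 => rfl
  | 1, 2 => rfl
  | 2, 0 => rfl
  | 2, 1 => rfl
  | 2, 2 => rfl

lemma eq_vec_of_alternating {H : Fin 3 → Fin 3 → Fin 3 → ℝ} (h : ∀ i j k, H j i k = - H i j k)
    (h' : ∀ i j k, H i k j = - H i j k) : H =
      ![![![0, 0, 0], ![0, 0, H 0 1 2], ![0, - H 0 1 2, 0]],
        ![![0, 0, - H 0 1 2], ![0, 0, 0], ![H 0 1 2, 0, 0]],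
        ![![0, H 0 1 2, 0], ![- H 0 1 2, 0, 0], ![0, 0, 0]]] := by
  have e1 : ∀ i k, H i i k = 0 := fun i k => by linarith [h i i k]
  have e2 : ∀ i k, H i k k = 0 := fun i k => by linarith [h' i k k]
  have e3 : ∀ i k, H i k i = 0 := fun i k => by linarith [h' i i k, e1 i k]
  funext i j k
  match i, j, k with
  | 0, 0, k => rw [e1]; match k with | 0 => rfl | 1 => rfl | 2 => rfl
  | 1, 1, k => rw [e1]; match k with | 0 => rfl | 1 => rfl | 2 => rfl
  | 2, 2, k => rw [e1]; match k with | 0 => rfl | 1 => rfl | 2 => rfl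
  | 0, 1, 0 => exact e3 0 1
  | 0, 1, 1 => exact e2 0 1
  | 0, 1, 2 => rfl
  | 0, 2, 0 => exact e3 0 2
  | 0, 2, 1 => exact h' 0 1 2
  | 0, 2, 2 => exact e2 0 2
  | 1, 0, 0 => exact e2 1 0
  | 1, 0, 1 => exact e3 1 0
  | 1, 0, 2 => exact h 0 1 2
  | 1, 2, 0 => exact (by linarith [h' 1 0 2, h 0 1 2] : H 1 2 0 = H 0 1 2)
  | 1, 2, 1 => exact e3 1 2
  | 1, 2, 2 => exact e2 1 2
  | 2, 0, 0 => exact e2 2 0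
  | 2, 0, 1 => exact (by linarith [h' 0 1 2, h 0 2 1] : H 2 0 1 = H 0 1 2)
  | 2, 0, 2 => exact e3 2 0
  | 2, 1, 0 => exact (by linarith [h' 1 0 2, h 0 1 2, h 1 2 0] : H 2 1 0 = - H 0 1 2)
  | 2, 1, 1 => exact e2 2 1
  | 2, 1, 2 => exact e3 2 1

/-- One structure constant remains, that of `[η₁, η₂]` along `η₃`: the Heisenberg bracket, or zero
in the abelian case. -/
lemma eq_vec_of_central {C : Fin 3 → Fin 3 → Fin 3 → ℝ} (h : ∀ i j k, C j i k = - C i j k)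
    (hc : ∀ i k, C 2 i k = 0) (h0 : C 0 1 0 = 0 ∧ C 0 1 1 = 0) : C =
      ![![![0, 0, 0], ![0, 0, C 0 1 2], ![0, 0, 0]],
        ![![0, 0, - C 0 1 2], ![0, 0, 0], ![0, 0, 0]],
        ![![0, 0, 0], ![0, 0, 0], ![0, 0, 0]]] := by
  have e1 : ∀ i k, C i i k = 0 := fun i k => by linarith [h i i k]
  have e2 : ∀ i k, C i 2 k = 0 := fun i k => by linarith [h 2 i k, hc i k]
  funext i j k
  match i, j, k with
  | 0, 0, k => rw [e1]; match k with | 0 => rfl | 1 => rfl | 2 => rfl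
  | 1, 1, k => rw [e1]; match k with | 0 => rfl | 1 => rfl | 2 => rfl
  | 0, 1, 0 => exact h0.1
  | 0, 1, 1 => exact h0.2
  | 0, 1, 2 => rfl
  | 1, 0, 0 => exact (h 0 1 0).trans (by rw [h0.1, neg_zero]; rfl)
  | 1, 0, 1 => exact (h 0 1 1).trans (by rw [h0.2, neg_zero]; rfl)
  | 1, 0, 2 => exact h 0 1 2
  | 0, 2, k => rw [e2]; match k with | 0 => rfl | 1 => rfl | 2 => rfl
  | 1, 2, k => rw [e2]; match k with | 0 => rfl | 1 => rfl | 2 => rfl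
  | 2, 0, k => rw [hc]; match k with | 0 => rfl | 1 => rfl | 2 => rfl
  | 2, 1, k => rw [hc]; match k with | 0 => rfl | 1 => rfl | 2 => rfl
  | 2, 2, k => rw [hc]; match k with | 0 => rfl | 1 => rfl | 2 => rfl

set_option maxHeartbeats 4000000 in
/-- The evolution of `|DG|² + tr H²`, at the level of components. -/
lemma PointData.evolution {A A' s s' s'' w w' w'' : Fin 3 → Fin 3 → ℝ}
    {C C' H H' : Fin 3 → Fin 3 → Fin 3 → ℝ} (h : PointData A A' s s' s'' w w' w'' C C' H H')
    {L L' D D' Q Q' G G' B B' Sd wd : Fin 3 → Fin 3 → ℝ} {a m : Fin 3 → ℝ}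
    (hL : ∀ i j, L i j = s' i j - ∑ k, A i k * s k j - ∑ k, A j k * s i k)
    (hL' : ∀ i j, L' i j = s'' i j - ∑ k, (A' i k * s k j + A i k * s' k j)
      - ∑ k, (A' j k * s i k + A j k * s' i k))
    (hD : ∀ k l, D k l = w' k l - ∑ m, A k m * w m l - ∑ m, A l m * w k m)
    (hD' : ∀ k l, D' k l = w'' k l - ∑ m, (A' k m * w m l + A k m * w' m l)
      - ∑ m, (A' l m * w k m + A l m * w' k m))
    (hQ : ∀ i j, Q i j = 2 * ∑ k, w i k * w j k + ∑ k, ∑ l, H i k l * H j k l)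
    (hQ' : ∀ i j, Q' i j = 2 * ∑ k, (w' i k * w j k + w i k * w' j k)
      + ∑ k, ∑ l, (H' i k l * H j k l + H i k l * H' j k l))
    (hG : ∀ i j, G i j = L i j - ∑ k, s i k * s k j + ∑ k, ∑ l, C k i l * C k j l
      - 1 / 2 * ∑ k, ∑ l, C k l i * C k l j + 1 / 2 * Q i j)
    (hG' : ∀ i j, G' i j = L' i j - ∑ k, (s' i k * s k j + s i k * s' k j)
      + ∑ k, ∑ l, (C' k i l * C k j l + C k i l * C' k j l)
      - 1 / 2 * ∑ k, ∑ l, (C' k l i * C k l j + C k l i * C' k l j) + 1 / 2 * Q' i j)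
    (hB : ∀ k l, B k l = D k l - ∑ i, (s i k * w i l - s i l * w i k)
      + 1 / 2 * ∑ i, ∑ j, (C i j k * H i j l - C i j l * H i j k))
    (hB' : ∀ k l, B' k l = D' k l
      - ∑ i, ((s' i k * w i l + s i k * w' i l) - (s' i l * w i k + s i l * w' i k))
      + 1 / 2 * ∑ i, ∑ j, ((C' i j k * H i j l + C i j k * H' i j l)
        - (C' i j l * H i j k + C i j l * H' i j k)))
    (hm : ∀ k, m k = 1 / 2 * ∑ i, ∑ j, C i j k * w i j)
    (ha : ∀ j, a j = ∑ i, ∑ k, C i j k * s k i + 1 / 2 * ∑ k, ∑ l, w k l * H j k l)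
    (hS : ∀ k l, Sd k l = G' k l - ∑ n, A k n * G n l - ∑ n, A l n * G k n
      + ∑ n, a n * (C n k l + C n l k))
    (hw : ∀ k l, wd k l = B' k l - ∑ n, A k n * B n l + ∑ n, A l n * B n k - ∑ n, C k l n * m n
      - ∑ n, a n * H n k l) :
    2 * (∑ i, ∑ j, (s i j * Sd i j + w i j * wd i j))
        - 2 * (∑ i, ∑ k, G i k * ∑ j, (s i j * s k j + w i j * w k j)) =
      2 * (∑ i, ∑ j, (s' i j ^ 2 + s i j * s'' i j + w' i j ^ 2 + w i j * w'' i j))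
      - (2 * (∑ i, ∑ j, (L i j - (∑ k, s i k * s j k) + ∑ k, w i k * w j k) ^ 2)
        + 2 * (∑ i, ∑ j, (D i j + (∑ k, w k i * s k j) - ∑ k, w k j * s k i) ^ 2)
        + (∑ i, ∑ j, ∑ k, C i j k ^ 2) * ((∑ k, s k k) - 2 * s 2 2) ^ 2
        + 2 * (∑ i, ∑ j, ∑ k, C i j k ^ 2) * ((∑ k, s k 2 ^ 2) - s 2 2 ^ 2)
        + 2 * (∑ j, (∑ k, ∑ l, C k j l * s l k) ^ 2)
        + 2 * (∑ j, ((∑ k, ∑ l, C k j l * s l k) + ∑ k, ∑ l, w k l * H j k l) ^ 2)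
        + 2 * (∑ l, (∑ i, ∑ j, w i j * C i j l) ^ 2)
        + 1 / 3 * (∑ i, ∑ j, ∑ k, H i j k ^ 2) * (∑ k, s k k) ^ 2) := by
  -- Here `L`, `D`, `Q`, `G`, `B`, `m`, `a` stand for `lapShape`, `divFlux`, `Hsq`, `rhsG`,
  -- `potVer`, `potMixed`, `rhsA`; primes are derivatives along `V`, while `Sd` and `wd` are the
  -- time derivatives of the corrected `s` and `w`. The second sum on the left comes from the
  -- variation of the Gram matrix.
  obtain ⟨hs, hs', hs'', hw0, hw', hw'', hH1, hH2, hC1, hC2, hC3, hCe, hHe⟩ := h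
  have gs := eq_vec_of_symm hs''
  have gw := eq_vec_of_swap hw0
  have gw' := eq_vec_of_swap hw'
  have gw'' := eq_vec_of_swap hw''
  have gA := eq_vec A
  have gA' := eq_vec A'
  have gH := eq_vec_of_alternating hH1 hH2
  have gC := eq_vec_of_central hC1 hC2 hC3
  clear hs'' hw0 hw' hw'' hH1 hH2 hC1 hC2 hC3
  -- The entries become independent variables. The arrays `s`, `s'`, `C'`, `H'` get none of their
  -- own: the hypotheses express them through the others, and the Jacobi identity and closedness
  -- enter in this way.
  generalize s'' 0 0 = x00, s'' 0 1 = x01, s'' 0 2 = x02, s'' 1 1 = x11, s'' 1 2 = x12,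
    s'' 2 2 = x22 at gs
  generalize w 0 1 = w01, w 0 2 = w02, w 1 2 = w12 at gw
  generalize w' 0 1 = y01, w' 0 2 = y02, w' 1 2 = y12 at gw'
  generalize w'' 0 1 = z01, w'' 0 2 = z02, w'' 1 2 = z12 at gw''
  generalize A 0 0 = a00, A 0 1 = a01, A 0 2 = a02, A 1 0 = a10, A 1 1 = a11, A 1 2 = a12,
    A 2 0 = a20, A 2 1 = a21, A 2 2 = a22 at gA
  generalize A' 0 0 = b00, A' 0 1 = b01, A' 0 2 = b02, A' 1 0 = b10, A' 1 1 = b11, A' 1 2 = b12,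
    A' 2 0 = b20, A' 2 1 = b21, A' 2 2 = b22 at gA'
  generalize H 0 1 2 = h at gH
  generalize C 0 1 2 = c at gC
  simp only [hS, hw, hB', hB, hG', hG, hQ', hQ, ha, hm, hL', hL, hD, hD', hCe, hHe, hs, hs',
    Fin.sum_univ_three]
  clear hS hw hB' hB hG' hG hQ' hQ ha hm hL' hL hD hD' hCe hHe hs hs'
  subst gs gw gw' gw'' gA gA' gH gC
  simp only [Matrix.cons_val]
  ring

end Algebra

/-! ### Derivatives along `V` of the frame components, and the pointwise identity. -/

section FrameEvolution

set_option linter.unusedSectionVars false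

open scoped Topology

variable {EK : Type*} [NormedAddCommGroup EK] [NormedSpace ℝ EK] [CompleteSpace EK]
  {K : Type*} [TopologicalSpace K] [Group K] [ChartedSpace EK K] [LieGroup 𝓘(ℝ, EK) ∞ K]
  {M : Type*} [TopologicalSpace M] [ChartedSpace (EuclideanSpace ℝ (Fin 1)) M]
  [IsManifold 𝓘(ℝ, EuclideanSpace ℝ (Fin 1)) ∞ M]
  {EP : Type*} [NormedAddCommGroup EP] [NormedSpace ℝ EP] [CompleteSpace EP]
  {P : Type*} [TopologicalSpace P] [ChartedSpace EP P] [MulAction Kᵐᵒᵖ P]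
  [IsManifold 𝓘(ℝ, EP) ∞ P] {π : P → M}

lemma HasAlong.self {X : VField EP P} {f : P → ℝ} {d : ℝ} {p : P} (h : HasAlong X f d p) :
    HasAlong X f (along X f p) p := ⟨h.1, rfl⟩

namespace AdaptedFrame

variable {b : BilinField EP P} {U : Set M}
  (F : AdaptedFrame K (EuclideanSpace ℝ (Fin 1)) π b 1 3 U) (H : ThreeForm EP P)
  (hπ : IsPrincipalBundle EK K (EuclideanSpace ℝ (Fin 1)) EP π) (hb : IsInvMetric K b)
  (hH : IsInvForm K H)

lemma struc_central {p : P} (hc : IsCentralAt F p) (i k : Fin 3) : F.struc 2 i k p = 0 := by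
  simp [struc, ev₂, hc i]

include hπ hb

lemma struc_zero (hK : IsNilpotentLieGroup (E := EK) K) {p : P} (hp : p ∈ π ⁻¹' U)
    (hc : IsCentralAt F p) : F.struc 0 1 0 p = 0 ∧ F.struc 0 1 1 p = 0 := by
  refine brk_coeff_eq_zero hK hπ F.isOpen F.ver_smooth F.ver_invariant hp
    (fun i => F.ver_vertical i p hp) ?_ hc (F.brk_ver_ver hπ hb hp 0 1)
  refine linearIndependent_of_orthonormal (V := TangentSpace 𝓘(ℝ, EP) p)
    ((ContinuousLinearMap.coeLM ℝ).comp (b p).toLinearMap) fun i j => ?_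
  simpa using F.ver_orthonormal i j p hp

lemma SBframe_eq {p : P} (hp : p ∈ π ⁻¹' U) (hH : IsInvForm K H) : SBframe F H p =
    2 * (∑ i, ∑ j, (F.lapShape i j p - (∑ k, F.shape i k p * F.shape j k p)
        + ∑ k, F.flux H i k p * F.flux H j k p) ^ 2)
      + 2 * (∑ i, ∑ j, (F.divFlux H i j p + (∑ k, F.flux H k i p * F.shape k j p)
        - ∑ k, F.flux H k j p * F.shape k i p) ^ 2)
      + (∑ i, ∑ j, ∑ k, F.struc i j k p ^ 2) * ((∑ k, F.shape k k p) - 2 * F.shape 2 2 p) ^ 2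
      + 2 * (∑ i, ∑ j, ∑ k, F.struc i j k p ^ 2)
        * ((∑ k, F.shape k 2 p ^ 2) - F.shape 2 2 p ^ 2)
      + 2 * (∑ j, (∑ k, ∑ l, F.struc k j l p * F.shape l k p) ^ 2)
      + 2 * (∑ j, ((∑ k, ∑ l, F.struc k j l p * F.shape l k p)
        + ∑ k, ∑ l, F.flux H k l p * F.fluxVer H j k l p) ^ 2)
      + 2 * (∑ l, (∑ i, ∑ j, F.flux H i j p * F.struc i j l p) ^ 2)
      + 1 / 3 * (∑ i, ∑ j, ∑ k, F.fluxVer H i j k p ^ 2) * (∑ k, F.shape k k p) ^ 2 := by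
  have hc : ∀ i j : Fin 3, SmoothOn EP (fun _ : P => if i = j then (1 : ℝ) else 0) (π ⁻¹' U) :=
    fun _ _ => SmoothOn.const _ _
  have hDH : ∀ i j, F.DH H (F.hor 0) (F.hor 0) (F.ver i) (F.ver j) p = F.divFlux H i j p :=
    fun i j => by
    rw [F.DH_lincomb H hπ hb hH (hc i) (hc j) (fun q _ => F.sum_ite_smul_ver i q)
      (fun q _ => F.sum_ite_smul_ver j q) hp]
    simp
  have hDG : ∀ k j, F.DG (F.hor 0) (brk (F.ver k) (F.ver j)) (F.ver k) p =
      ∑ l, F.struc k j l p * F.shape l k p := fun k j => by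
    rw [F.DG_lincomb hπ hb (F.smooth_struc hπ hb k j) (hc k)
      (fun q hq => F.brk_ver_ver hπ hb hq k j) (fun q _ => F.sum_ite_smul_ver k q) hp]
    simp
  have hbr : F.normSqBrk p = ∑ i, ∑ j, ∑ k, F.struc i j k p ^ 2 := by
    simp only [normSqBrk, ev₂, F.brk_ver_ver hπ hb hp, F.ev₂_ver_lincomb hp, sq]
  simp only [SBframe, hDH, hDG, hbr, F.lapG_ver hπ hb _ _ hp, F.DG_ver hπ hb _ _ hp,
    F.Hsq_hor_ver]
  rfl

include hH

lemma pointData (hK : IsNilpotentLieGroup (E := EK) K)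
    (hcl : ∀ (W : Set P) (X Y Z V : VField EP P), IsOpen W →
      SmoothFieldOn X W → SmoothFieldOn Y W → SmoothFieldOn Z W → SmoothFieldOn V W →
      ∀ p ∈ W, extD₃ (ev₃ H) X Y Z V p = 0) {p : P} (hp : p ∈ π ⁻¹' U) (hc : IsCentralAt F p) :
    PointData (fun i j => F.conn i j p) (fun i j => along (F.hor 0) (F.conn i j) p)
      (fun i j => F.shape i j p) (fun i j => along (F.hor 0) (F.shape i j) p)
      (fun i j => along (F.hor 0) (along (F.hor 0) (F.shape i j)) p)
      (fun i j => F.flux H i j p) (fun i j => along (F.hor 0) (F.flux H i j) p)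
      (fun i j => along (F.hor 0) (along (F.hor 0) (F.flux H i j)) p)
      (fun i j k => F.struc i j k p) (fun i j k => along (F.hor 0) (F.struc i j k) p)
      (fun i j k => F.fluxVer H i j k p) (fun i j k => along (F.hor 0) (F.fluxVer H i j k) p) where
  s_eq _ _ := rfl
  s'_eq i j :=
    have hW := hπ.isOpen_preimage F.isOpen
    (((F.smooth_conn hπ hb i j).hasAlong hW hp (F.hor 0)).add
      ((F.smooth_conn hπ hb j i).hasAlong hW hp (F.hor 0))).neg.2
  s''_symm i j := by rw [F.shape_symm]
  w_swap i j := F.flux_swap H i j p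
  w'_swap i j := by
    rw [show F.flux H j i = - F.flux H i j from funext fun q => F.flux_swap H i j q,
      along_eq_mvfderiv, mvfderiv_neg]
    rfl
  w''_swap i j := by
    have h1 : along (F.hor 0) (F.flux H j i) = - along (F.hor 0) (F.flux H i j) := funext fun q => by
      rw [show F.flux H j i = - F.flux H i j from funext fun q => F.flux_swap H i j q,
        along_eq_mvfderiv, mvfderiv_neg]
      rfl
    rw [h1, along_eq_mvfderiv, mvfderiv_neg]
    rfl
  H_swap i j k := form_swap H _ _ _
  H_swap' i j k := form_swap' H _ _ _
  C_swap i j k := F.struc_swap i j k p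
  C_central i k := F.struc_central hc i k
  C_zero := F.struc_zero hπ hb hK hp hc
  C'_eq i j k := F.along_struc hπ hb i j k hp
  H'_eq i j k := F.along_fluxVer H hπ hb hH hcl i j k hp

omit hH in
lemma hasAlong_lapShape (i j : Fin 3) {p : P} (hp : p ∈ π ⁻¹' U) :
    HasAlong (F.hor 0) (F.lapShape i j) (along (F.hor 0) (along (F.hor 0) (F.shape i j)) p
      - ∑ k, (along (F.hor 0) (F.conn i k) p * F.shape k j p
        + F.conn i k p * along (F.hor 0) (F.shape k j) p)
      - ∑ k, (along (F.hor 0) (F.conn j k) p * F.shape i k p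
        + F.conn j k p * along (F.hor 0) (F.shape i k) p)) p := by
  have hW := hπ.isOpen_preimage F.isOpen
  have ha := fun i j => (F.smooth_conn hπ hb i j).hasAlong hW hp (F.hor 0)
  have hs := fun i j => (F.smooth_shape hπ hb i j).hasAlong hW hp (F.hor 0)
  exact ((((F.smooth_shape hπ hb i j).along hW (F.hor_smooth 0)).hasAlong hW hp (F.hor 0)).sub
    (HasAlong.sum_univ fun k => (ha i k).mul (hs k j))).sub
    (HasAlong.sum_univ fun k => (ha j k).mul (hs i k))

lemma hasAlong_divFlux (k l : Fin 3) {p : P} (hp : p ∈ π ⁻¹' U) :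
    HasAlong (F.hor 0) (F.divFlux H k l) (along (F.hor 0) (along (F.hor 0) (F.flux H k l)) p
      - ∑ m, (along (F.hor 0) (F.conn k m) p * F.flux H m l p
        + F.conn k m p * along (F.hor 0) (F.flux H m l) p)
      - ∑ m, (along (F.hor 0) (F.conn l m) p * F.flux H k m p
        + F.conn l m p * along (F.hor 0) (F.flux H k m) p)) p := by
  have hW := hπ.isOpen_preimage F.isOpen
  have ha := fun i j => (F.smooth_conn hπ hb i j).hasAlong hW hp (F.hor 0)
  have hs := fun i j => (F.smooth_flux H hπ hH i j).hasAlong hW hp (F.hor 0)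
  exact ((((F.smooth_flux H hπ hH k l).along hW (F.hor_smooth 0)).hasAlong hW hp (F.hor 0)).sub
    (HasAlong.sum_univ fun m => (ha k m).mul (hs m l))).sub
    (HasAlong.sum_univ fun m => (ha l m).mul (hs k m))

omit hb in
lemma hasAlong_Hsq_ver (i j : Fin 3) {p : P} (hp : p ∈ π ⁻¹' U) :
    HasAlong (F.hor 0) (F.Hsq H (F.ver i) (F.ver j))
      (2 * ∑ k, (along (F.hor 0) (F.flux H i k) p * F.flux H j k p
          + F.flux H i k p * along (F.hor 0) (F.flux H j k) p)
        + ∑ k, ∑ l, (along (F.hor 0) (F.fluxVer H i k l) p * F.fluxVer H j k l p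
          + F.fluxVer H i k l p * along (F.hor 0) (F.fluxVer H j k l) p)) p := by
  have hW := hπ.isOpen_preimage F.isOpen
  have hs := fun i j => (F.smooth_flux H hπ hH i j).hasAlong hW hp (F.hor 0)
  have hv := fun i j k => (F.smooth_fluxVer H hπ hH i j k).hasAlong hW hp (F.hor 0)
  exact (((HasAlong.sum_univ fun k => (hs i k).mul (hs j k)).const_mul 2).add
    (HasAlong.sum_univ fun k => HasAlong.sum_univ fun l => (hv i k l).mul (hv j k l))).congrOn
    hW hp fun q _ => F.Hsq_ver H i j q

lemma hasAlong_rhsG (i j : Fin 3) {p : P} (hp : p ∈ π ⁻¹' U) :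
    HasAlong (F.hor 0) (F.rhsG H (F.ver i) (F.ver j)) (along (F.hor 0) (F.lapShape i j) p
      - ∑ k, (along (F.hor 0) (F.shape i k) p * F.shape k j p
        + F.shape i k p * along (F.hor 0) (F.shape k j) p)
      + ∑ k, ∑ l, (along (F.hor 0) (F.struc k i l) p * F.struc k j l p
        + F.struc k i l p * along (F.hor 0) (F.struc k j l) p)
      - 1 / 2 * ∑ k, ∑ l, (along (F.hor 0) (F.struc k l i) p * F.struc k l j p
        + F.struc k l i p * along (F.hor 0) (F.struc k l j) p)
      + 1 / 2 * along (F.hor 0) (F.Hsq H (F.ver i) (F.ver j)) p) p := by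
  have hW := hπ.isOpen_preimage F.isOpen
  have hs := fun i j => (F.smooth_shape hπ hb i j).hasAlong hW hp (F.hor 0)
  have hc := fun i j k => (F.smooth_struc hπ hb i j k).hasAlong hW hp (F.hor 0)
  have h1 := F.hasAlong_lapShape hπ hb i j hp
  have h2 := F.hasAlong_Hsq_ver H hπ hH i j hp
  exact ((((h1.self.sub
    (HasAlong.sum_univ fun k => (hs i k).mul (hs k j))).add
    (HasAlong.sum_univ fun k => HasAlong.sum_univ fun l => (hc k i l).mul (hc k j l))).sub
    ((HasAlong.sum_univ fun k => HasAlong.sum_univ fun l =>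
      (hc k l i).mul (hc k l j)).const_mul (1 / 2))).add
    (h2.self.const_mul (1 / 2))).congrOn hW hp
    fun q hq => F.rhsG_ver H hπ hb i j hq

lemma hasAlong_potVer (k l : Fin 3) {p : P} (hp : p ∈ π ⁻¹' U) :
    HasAlong (F.hor 0) (F.potVer H k l) (along (F.hor 0) (F.divFlux H k l) p
      - ∑ i, ((along (F.hor 0) (F.shape i k) p * F.flux H i l p
          + F.shape i k p * along (F.hor 0) (F.flux H i l) p)
        - (along (F.hor 0) (F.shape i l) p * F.flux H i k p
          + F.shape i l p * along (F.hor 0) (F.flux H i k) p))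
      + 1 / 2 * ∑ i, ∑ j, ((along (F.hor 0) (F.struc i j k) p * F.fluxVer H i j l p
          + F.struc i j k p * along (F.hor 0) (F.fluxVer H i j l) p)
        - (along (F.hor 0) (F.struc i j l) p * F.fluxVer H i j k p
          + F.struc i j l p * along (F.hor 0) (F.fluxVer H i j k) p))) p := by
  have hW := hπ.isOpen_preimage F.isOpen
  have hs := fun i j => (F.smooth_shape hπ hb i j).hasAlong hW hp (F.hor 0)
  have hw := fun i j => (F.smooth_flux H hπ hH i j).hasAlong hW hp (F.hor 0)
  have hc := fun i j k => (F.smooth_struc hπ hb i j k).hasAlong hW hp (F.hor 0)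
  have hv := fun i j k => (F.smooth_fluxVer H hπ hH i j k).hasAlong hW hp (F.hor 0)
  have h1 := F.hasAlong_divFlux H hπ hb hH k l hp
  exact (h1.self.sub (HasAlong.sum_univ fun i =>
    ((hs i k).mul (hw i l)).sub ((hs i l).mul (hw i k)))).add
    ((HasAlong.sum_univ fun i => HasAlong.sum_univ fun j =>
      ((hc i j k).mul (hv i j l)).sub ((hc i j l).mul (hv i j k))).const_mul (1 / 2))

/-- The energy density `|DG|² + tr H²` in components, as a function on the total space. -/
noncomputable def density : P → ℝ := fun p =>
  ∑ i, ∑ j, (F.shape i j p * F.shape i j p + F.flux H i j p * F.flux H i j p)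

omit hπ hb hH

lemma smooth_density (hπ : IsPrincipalBundle EK K (EuclideanSpace ℝ (Fin 1)) EP π)
    (hb : IsInvMetric K b) (hH : IsInvForm K H) : SmoothOn EP (F.density H) (π ⁻¹' U) :=
  SmoothOn.sum_univ fun i => SmoothOn.sum_univ fun j =>
    ((F.smooth_shape hπ hb i j).mul (F.smooth_shape hπ hb i j)).add
      ((F.smooth_flux H hπ hH i j).mul (F.smooth_flux H hπ hH i j))

lemma inv_density (hπ : IsPrincipalBundle EK K (EuclideanSpace ℝ (Fin 1)) EP π)
    (hb : IsInvMetric K b) (hH : IsInvForm K H) : InvFun K (F.density H) (π ⁻¹' U) :=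
  fun a p hp => by
    simp only [density, F.inv_shape hπ hb _ _ a p hp, F.inv_flux H hH _ _ a p hp]

lemma density_eq (hπ : IsPrincipalBundle EK K (EuclideanSpace ℝ (Fin 1)) EP π)
    (hb : IsInvMetric K b) {p : P} (hp : p ∈ π ⁻¹' U) :
    F.density H p = F.normSqDG p + F.trHsq H p := by
  simp only [density, F.normSqDG_eq hπ hb hp, F.trHsq_eq H, sq, Finset.sum_add_distrib]

lemma along_along_density (hπ : IsPrincipalBundle EK K (EuclideanSpace ℝ (Fin 1)) EP π)
    (hb : IsInvMetric K b) (hH : IsInvForm K H) {p : P} (hp : p ∈ π ⁻¹' U) :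
    along (F.hor 0) (along (F.hor 0) (F.density H)) p =
      2 * (∑ i, ∑ j, (along (F.hor 0) (F.shape i j) p ^ 2
        + F.shape i j p * along (F.hor 0) (along (F.hor 0) (F.shape i j)) p
        + along (F.hor 0) (F.flux H i j) p ^ 2
        + F.flux H i j p * along (F.hor 0) (along (F.hor 0) (F.flux H i j)) p)) := by
  have hW := hπ.isOpen_preimage F.isOpen
  have hs : ∀ i j, ∀ q ∈ π ⁻¹' U, _ := fun i j q hq =>
    (F.smooth_shape hπ hb i j).hasAlong hW hq (F.hor 0)
  have hw : ∀ i j, ∀ q ∈ π ⁻¹' U, _ := fun i j q hq =>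
    (F.smooth_flux H hπ hH i j).hasAlong hW hq (F.hor 0)
  have hs' := fun i j =>
    ((F.smooth_shape hπ hb i j).along hW (F.hor_smooth 0)).hasAlong hW hp (F.hor 0)
  have hw' := fun i j =>
    ((F.smooth_flux H hπ hH i j).along hW (F.hor_smooth 0)).hasAlong hW hp (F.hor 0)
  have h1 : ∀ q ∈ π ⁻¹' U, along (F.hor 0) (F.density H) q = _ := fun q hq =>
    (HasAlong.sum_univ fun i => HasAlong.sum_univ fun j =>
      ((hs i j q hq).mul (hs i j q hq)).add ((hw i j q hq).mul (hw i j q hq))).2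
  refine ((HasAlong.sum_univ fun i => HasAlong.sum_univ fun j =>
    (((hs' i j).mul (hs i j p hp)).add ((hs i j p hp).mul (hs' i j))).add
      (((hw' i j).mul (hw i j p hp)).add ((hw i j p hp).mul (hw' i j)))).congrOn hW hp h1).2.trans ?_
  simp only [Finset.mul_sum]
  exact Finset.sum_congr rfl fun i _ => Finset.sum_congr rfl fun j _ => by ring

/-- The pointwise identity behind the evolution of `|DG|² + tr H²`. -/
lemma evolution (hπ : IsPrincipalBundle EK K (EuclideanSpace ℝ (Fin 1)) EP π)
    (hb : IsInvMetric K b) (hH : IsInvForm K H) (hK : IsNilpotentLieGroup (E := EK) K)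
    (hcl : ∀ (W : Set P) (X Y Z V : VField EP P), IsOpen W →
      SmoothFieldOn X W → SmoothFieldOn Y W → SmoothFieldOn Z W → SmoothFieldOn V W →
      ∀ p ∈ W, extD₃ (ev₃ H) X Y Z V p = 0) {p : P} (hp : p ∈ π ⁻¹' U) (hc : IsCentralAt F p)
    {Sd wd : Fin 3 → Fin 3 → ℝ}
    (hS : ∀ k l, Sd k l = along (F.hor 0) (F.rhsG H (F.ver k) (F.ver l)) p
      - ∑ n, F.conn k n p * F.rhsG H (F.ver n) (F.ver l) p
      - ∑ n, F.conn l n p * F.rhsG H (F.ver k) (F.ver n) p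
      + ∑ n, F.rhsA H (F.hor 0) (F.ver n) p * (F.struc n k l p + F.struc n l k p))
    (hw : ∀ k l, wd k l = extD₂ (F.B H) (F.hor 0) (F.ver k) (F.ver l) p
      - ∑ n, F.rhsA H (F.hor 0) (F.ver n) p * F.fluxVer H n k l p) :
    2 * (∑ i, ∑ j, (F.shape i j p * Sd i j + F.flux H i j p * wd i j))
        - 2 * (∑ i, ∑ k, F.rhsG H (F.ver i) (F.ver k) p *
          ∑ j, (F.shape i j p * F.shape k j p + F.flux H i j p * F.flux H k j p)) =
      along (F.hor 0) (along (F.hor 0) (F.density H)) p - SBframe F H p := by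
  rw [F.along_along_density H hπ hb hH hp, F.SBframe_eq H hπ hb hp hH]
  exact (F.pointData H hπ hb hH hK hcl hp hc).evolution
    (L := fun i j => F.lapShape i j p) (L' := fun i j => along (F.hor 0) (F.lapShape i j) p)
    (D := fun i j => F.divFlux H i j p) (D' := fun i j => along (F.hor 0) (F.divFlux H i j) p)
    (Q := fun i j => F.Hsq H (F.ver i) (F.ver j) p)
    (Q' := fun i j => along (F.hor 0) (F.Hsq H (F.ver i) (F.ver j)) p)
    (G := fun i j => F.rhsG H (F.ver i) (F.ver j) p)
    (G' := fun i j => along (F.hor 0) (F.rhsG H (F.ver i) (F.ver j)) p)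
    (B := fun i j => F.potVer H i j p) (B' := fun i j => along (F.hor 0) (F.potVer H i j) p)
    (a := fun n => F.rhsA H (F.hor 0) (F.ver n) p) (m := fun n => F.potMixed H n p)
    (fun _ _ => rfl) (fun i j => (F.hasAlong_lapShape hπ hb i j hp).2)
    (fun _ _ => rfl) (fun i j => (F.hasAlong_divFlux H hπ hb hH i j hp).2)
    (fun i j => F.Hsq_ver H i j p) (fun i j => (F.hasAlong_Hsq_ver H hπ hH i j hp).2)
    (fun i j => F.rhsG_ver H hπ hb i j hp) (fun i j => (F.hasAlong_rhsG H hπ hb hH i j hp).2)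
    (fun _ _ => rfl) (fun i j => (F.hasAlong_potVer H hπ hb hH i j hp).2)
    (fun _ => rfl) (fun j => by rw [F.rhsA_ver H hπ hb j hp, Hsq_hor_ver])
    hS (fun k l => by rw [hw, F.extD_B H hπ hb hH hp])

end AdaptedFrame

end FrameEvolution

/-! ### Lie derivatives of bilinear forms. -/

section LieDerivative

set_option linter.unusedSectionVars false

open scoped Topology

variable {EP : Type*} [NormedAddCommGroup EP] [NormedSpace ℝ EP] [CompleteSpace EP]
  {P : Type*} [TopologicalSpace P] [ChartedSpace EP P] [IsManifold 𝓘(ℝ, EP) ∞ P]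

/-- The Lie derivative of a bilinear form, `(L_X b)(Y, Z)`. -/
noncomputable def lieD (b : BilinField EP P) (X Y Z : VField EP P) : P → ℝ := fun p =>
  along X (ev₂ b Y Z) p - ev₂ b (brk X Y) Z p - ev₂ b Y (brk X Z) p

variable {b : BilinField EP P} {W : Set P} (hW : IsOpen W) {p : P} (hp : p ∈ W)
include hW hp

/-- The derivatives of the coefficients produced by `X(b(Y, Z))` cancel those produced by the
brackets. -/
lemma lieD_lincomb {ι : Type*} [Fintype ι] {X : VField EP P} {e : ι → VField EP P}
    (he : ∀ i, SmoothFieldOn (e i) W) (hbs : ∀ i j, SmoothOn EP (ev₂ b (e i) (e j)) W)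
    {f g : ι → P → ℝ} (hf : ∀ i, SmoothOn EP (f i) W)
    (hg : ∀ i, SmoothOn EP (g i) W) {Y Z : VField EP P}
    (hY : ∀ q ∈ W, Y q = ∑ i, f i q • e i q) (hZ : ∀ q ∈ W, Z q = ∑ i, g i q • e i q) :
    lieD b X Y Z p = ∑ k, ∑ l, f k p * g l p * lieD b X (e k) (e l) p := by
  have hs : ∀ c : ι → P → ℝ, ∀ q, ∑ i, c i q • e i q = (∑ i, c i • e i) q := fun c q => by simp
  have h1 : along X (ev₂ b Y Z) p = ∑ k, ∑ l, ((along X (f k) p * g l p + f k p * along X (g l) p)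
      * ev₂ b (e k) (e l) p + f k p * g l p * along X (ev₂ b (e k) (e l)) p) := by
    refine ((HasAlong.sum_univ fun k => HasAlong.sum_univ fun l =>
      (((hf k).hasAlong hW hp X).mul ((hg l).hasAlong hW hp X)).mul
        ((hbs k l).hasAlong hW hp X)).congrOn hW hp fun q hq => ?_).2
    simp only [ev₂, hY q hq, hZ q hq, map_sum, map_smul, sum_apply, smul_apply, smul_eq_mul,
      Finset.mul_sum]
    rw [Finset.sum_comm]
    exact Finset.sum_congr rfl fun k _ => Finset.sum_congr rfl fun l _ => by ring
  have h2 : ev₂ b (brk X Y) Z p = ∑ k, ∑ l, (along X (f k) p * g l p * ev₂ b (e k) (e l) p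
      + f k p * g l p * ev₂ b (brk X (e k)) (e l) p) := by
    simp only [ev₂]
    rw [brk_congr hW hp (fun _ _ => rfl) (fun q hq => (hY q hq).trans (hs f q)),
      brk_lincomb_right hW hp hf he, hZ p hp]
    simp only [map_sum, map_smul, map_add, sum_apply, add_apply, smul_apply, smul_eq_mul,
      Finset.mul_sum]
    rw [Finset.sum_comm]
    exact Finset.sum_congr rfl fun k _ => Finset.sum_congr rfl fun l _ => by ring
  have h3 : ev₂ b Y (brk X Z) p = ∑ k, ∑ l, (f k p * along X (g l) p * ev₂ b (e k) (e l) p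
      + f k p * g l p * ev₂ b (e k) (brk X (e l)) p) := by
    simp only [ev₂]
    rw [brk_congr hW hp (fun _ _ => rfl) (fun q hq => (hZ q hq).trans (hs g q)),
      brk_lincomb_right hW hp hg he, hY p hp]
    simp only [map_sum, map_smul, map_add, sum_apply, smul_apply, smul_eq_mul,
      Finset.mul_sum, Finset.sum_add_distrib]
    rw [Finset.sum_comm]
    congr 1
    · exact Finset.sum_congr rfl fun k _ => Finset.sum_congr rfl fun l _ => by ring
    · rw [Finset.sum_comm]
      exact Finset.sum_congr rfl fun k _ => Finset.sum_congr rfl fun l _ => by ring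
  simp only [lieD, h1, h2, h3, ← Finset.sum_sub_distrib]
  exact Finset.sum_congr rfl fun k _ => Finset.sum_congr rfl fun l _ => by ring

/-- The Lie derivative is not tensorial in `X`, but the extra terms involve only the derivatives of
the coefficients along `Y` and `Z`. These vanish for invariant coefficients and vertical `Y`, `Z`,
which is the case of interest. -/
lemma lieD_lincomb_left {ι : Type*} [Fintype ι] {X Y Z : VField EP P} {e : ι → VField EP P}
    (he : ∀ i, SmoothFieldOn (e i) W) {c : ι → P → ℝ} (hc : ∀ i, SmoothOn EP (c i) W)
    (hX : ∀ q ∈ W, X q = ∑ i, c i q • e i q) (hY : ∀ i, along Y (c i) p = 0)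
    (hZ : ∀ i, along Z (c i) p = 0) :
    lieD b X Y Z p = ∑ i, c i p * lieD b (e i) Y Z p := by
  have hs : ∀ q, ∑ i, c i q • e i q = (∑ i, c i • e i) q := fun q => by simp
  have h1 : along X (ev₂ b Y Z) p = ∑ i, c i p * along (e i) (ev₂ b Y Z) p := by
    have : ∀ w : TangentSpace 𝓘(ℝ, EP) p, w = ∑ i, c i p • e i p →
        mvfderiv 𝓘(ℝ, EP) (ev₂ b Y Z) p w = ∑ i, c i p * mvfderiv 𝓘(ℝ, EP) (ev₂ b Y Z) p (e i p) := by
      rintro w rfl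
      rw [map_sum]
      exact Finset.sum_congr rfl fun i _ => map_smul _ _ _
    exact this _ (hX p hp)
  have h2 : ∀ Y' : VField EP P, (∀ i, along Y' (c i) p = 0) →
      brk X Y' p = ∑ i, c i p • brk (e i) Y' p := fun Y' hY' => by
    rw [brk_congr hW hp (fun q hq => (hX q hq).trans (hs q)) (fun _ _ => rfl),
      brk_lincomb_left hW hp hc he]
    simp only [hY', neg_zero, zero_smul, zero_add]
  simp only [lieD, ev₂, h2 Y hY, h2 Z hZ]
  rw [h1]
  simp only [map_sum, map_smul, sum_apply, smul_apply, smul_eq_mul, mul_sub,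
    Finset.sum_sub_distrib]

end LieDerivative

/-! ### The energy density in a frame adapted to a different metric. -/

section ChangeOfFrame

set_option linter.unusedSectionVars false

open scoped Topology

/-- The squared norm of a bilinear form in a basis with Gram matrix `G`. -/
noncomputable def gramNormSq (G X : Matrix (Fin 3) (Fin 3) ℝ) : ℝ :=
  ∑ i, ∑ j, ∑ k, ∑ l, G⁻¹ i k * G⁻¹ j l * (X i j * X k l)

/-- Orthonormality of the new basis reads `q G qᵀ = 1`, that is `G⁻¹ = qᵀ q`, which turns a sum of
squares into a contraction with `G⁻¹`. Only the square of `c` appears, so the sign of a unit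
horizontal vector is immaterial. -/
lemma sum_sq_eq_gramNormSq {G X X' q : Matrix (Fin 3) (Fin 3) ℝ} {c : ℝ}
    (hq : ∀ i j, ∑ k, ∑ l, q i k * q j l * G k l = if i = j then 1 else 0)
    (hX : ∀ i j, X' i j = c * ∑ k, ∑ l, q i k * q j l * X k l) :
    ∑ i, ∑ j, X' i j * X' i j = c ^ 2 * gramNormSq G X := by
  have h1 : q * (G * q.transpose) = 1 := by
    ext i j
    rw [Matrix.one_apply, ← hq i j]
    simp only [Matrix.mul_apply, Matrix.transpose_apply, Finset.mul_sum]
    exact Finset.sum_congr rfl fun k _ => Finset.sum_congr rfl fun l _ => by ring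
  have h2 : G⁻¹ = q.transpose * q := by
    refine Matrix.inv_eq_right_inv ?_
    rw [← Matrix.mul_assoc]
    exact mul_eq_one_comm.1 h1
  have h3 : ∀ i k, G⁻¹ i k = ∑ m, q m i * q m k := fun i k => by
    rw [h2, Matrix.mul_apply]; rfl
  simp only [gramNormSq, h3, hX]
  simp only [Finset.sum_mul, Finset.mul_sum]
  simp only [Fin.sum_univ_three]
  ring

variable {EK : Type*} [NormedAddCommGroup EK] [NormedSpace ℝ EK]
  {K : Type*} [TopologicalSpace K] [Group K] [ChartedSpace EK K]
  {M : Type*} [TopologicalSpace M] [ChartedSpace (EuclideanSpace ℝ (Fin 1)) M]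
  [IsManifold 𝓘(ℝ, EuclideanSpace ℝ (Fin 1)) ∞ M]
  {EP : Type*} [NormedAddCommGroup EP] [NormedSpace ℝ EP] [CompleteSpace EP]
  {P : Type*} [TopologicalSpace P] [ChartedSpace EP P] [MulAction Kᵐᵒᵖ P]
  [IsManifold 𝓘(ℝ, EP) ∞ P] {π : P → M}

namespace AdaptedFrame

variable {b b' : BilinField EP P} {U U' : Set M}
  (F : AdaptedFrame K (EuclideanSpace ℝ (Fin 1)) π b 1 3 U)
  (F' : AdaptedFrame K (EuclideanSpace ℝ (Fin 1)) π b' 1 3 U') (H' : ThreeForm EP P)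
  (hπ : IsPrincipalBundle EK K (EuclideanSpace ℝ (Fin 1)) EP π) (hb : IsInvMetric K b)
  (hb' : IsInvMetric K b')

/-- Orthonormality kills the derivative of `b(η_i, η_j)`. Unlike `shape`, the Lie derivative is also
meaningful in frames that are not orthonormal. -/
lemma shape_eq_lieD (hπ : IsPrincipalBundle EK K (EuclideanSpace ℝ (Fin 1)) EP π)
    (hb : IsInvMetric K b) (i j : Fin 3) {p : P} (hp : p ∈ π ⁻¹' U) :
    F.shape i j p = lieD b (F.hor 0) (F.ver i) (F.ver j) p := by
  have hW := hπ.isOpen_preimage F.isOpen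
  have : along (F.hor 0) (ev₂ b (F.ver i) (F.ver j)) p = 0 :=
    along_eq_zero_of_const hW hp fun q hq => F.ver_orthonormal i j q hq
  simp only [lieD, this, shape, conn, ev₂, hb.symm p (F.ver i p)]
  ring

/-- The Gram matrix of the vertical vectors for another metric. -/
noncomputable def gram (b' : BilinField EP P) (p : P) : Matrix (Fin 3) (Fin 3) ℝ :=
  fun i j => b' p (F.ver i p) (F.ver j p)

/-- The coefficients of the vertical part of the first frame vector for another metric. -/
noncomputable def vertCoeff (b' : BilinField EP P) (p : P) : Fin 3 → ℝ :=
  (F.gram b' p)⁻¹.mulVec fun i => b' p (F.hor 0 p) (F.ver i p)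

/-- The squared length of the horizontal part of the first frame vector for another metric. -/
noncomputable def horSq (b' : BilinField EP P) (p : P) : ℝ :=
  b' p (F.hor 0 p) (F.hor 0 p) - ∑ i, F.vertCoeff b' p i * b' p (F.hor 0 p) (F.ver i p)

/-- The derivative of the metric on the vertical vectors along the horizontal part of the first
frame vector, for another metric. -/
noncomputable def shapeFor (b' : BilinField EP P) (p : P) : Matrix (Fin 3) (Fin 3) ℝ := fun k l =>
  lieD b' (F.hor 0) (F.ver k) (F.ver l) p
    - ∑ m, F.vertCoeff b' p m * lieD b' (F.ver m) (F.ver k) (F.ver l) p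

/-- The components of the contraction of a three-form with the horizontal part of the first frame
vector, for another metric. -/
noncomputable def fluxFor (b' : BilinField EP P) (H' : ThreeForm EP P) (p : P) :
    Matrix (Fin 3) (Fin 3) ℝ := fun k l =>
  F.flux H' k l p - ∑ m, F.vertCoeff b' p m * F.fluxVer H' m k l p

/-- The energy density for another metric and three-form, in terms of a fixed frame. -/
noncomputable def densityFor (b' : BilinField EP P) (H' : ThreeForm EP P) (p : P) : ℝ :=
  (F.horSq b' p)⁻¹ * (gramNormSq (F.gram b' p) (F.shapeFor b' p)
    + gramNormSq (F.gram b' p) (F.fluxFor b' H' p))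

include hb' in
lemma gram_posDef {p : P} (hp : p ∈ π ⁻¹' U) : (F.gram b' p).PosDef := by
  have hli : LinearIndependent ℝ fun i => F.ver i p :=
    linearIndependent_of_orthonormal (V := TangentSpace 𝓘(ℝ, EP) p)
      ((ContinuousLinearMap.coeLM ℝ).comp (b p).toLinearMap) fun i j => by
        simpa using F.ver_orthonormal i j p hp
  refine Matrix.PosDef.of_dotProduct_mulVec_pos ?_ fun x hx => ?_
  · ext i j
    simp [gram, hb'.symm p (F.ver j p)]
  · have h0 : ∑ i, x i • F.ver i p ≠ 0 := fun h =>
      hx (funext (Fintype.linearIndependent_iff.1 hli x h))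
    have := hb'.pos p _ h0
    suffices e : star x ⬝ᵥ (F.gram b' p).mulVec x =
        b' p (∑ i, x i • F.ver i p) (∑ i, x i • F.ver i p) by rw [e]; exact this
    simp only [dotProduct, Matrix.mulVec, gram, map_sum, map_smul, sum_apply, smul_apply,
      smul_eq_mul, Finset.mul_sum, star_trivial]
    rw [Finset.sum_comm]
    exact Finset.sum_congr rfl fun k _ => Finset.sum_congr rfl fun l _ => by ring

include hb' in
-- This is the defining property of the coefficients: `V` minus their combination of the `η_m` is
-- `b'`-orthogonal to the vertical space.
lemma gram_mulVec {p : P} (hp : p ∈ π ⁻¹' U) (k : Fin 3) :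
    ∑ m, F.vertCoeff b' p m * b' p (F.ver m p) (F.ver k p) = b' p (F.hor 0 p) (F.ver k p) := by
  have hdet := (F.gram_posDef hb' hp).det_pos.ne'
  have h : (F.gram b' p).mulVec (F.vertCoeff b' p) = fun i => b' p (F.hor 0 p) (F.ver i p) := by
    rw [vertCoeff, Matrix.mulVec_mulVec, Matrix.mul_nonsing_inv _ (isUnit_iff_ne_zero.2 hdet),
      Matrix.one_mulVec]
  have := congrFun h k
  rw [← this]
  simp only [Matrix.mulVec, dotProduct, gram]
  exact Finset.sum_congr rfl fun m _ => by rw [hb'.symm p (F.ver k p), mul_comm]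

include hb' in
-- Positivity holds because `V`, a unit vector that is `b`-orthogonal to the `η_m`, is no
-- combination of them.
lemma horSq_pos {p : P} (hp : p ∈ π ⁻¹' U) : 0 < F.horSq b' p ∧
    F.horSq b' p = b' p (F.hor 0 p - ∑ m, F.vertCoeff b' p m • F.ver m p)
      (F.hor 0 p - ∑ m, F.vertCoeff b' p m • F.ver m p) := by
  have e : F.horSq b' p = b' p (F.hor 0 p - ∑ m, F.vertCoeff b' p m • F.ver m p)
      (F.hor 0 p - ∑ m, F.vertCoeff b' p m • F.ver m p) := by
    simp only [map_sub, map_sum, map_smul, sub_apply, sum_apply, smul_apply, smul_eq_mul, horSq,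
      F.gram_mulVec hb' hp, hb'.symm p _ (F.hor 0 p), sub_self, mul_zero,
      Finset.sum_const_zero, sub_zero]
  refine ⟨?_, e⟩
  rw [e]
  refine hb'.pos p _ fun h => ?_
  have h1 : b p (F.hor 0 p) (F.hor 0 p) = 1 := by simpa using F.hor_orthonormal 0 0 p hp
  rw [sub_eq_zero] at h
  have h2 : b p (F.hor 0 p) (∑ m, F.vertCoeff b' p m • F.ver m p) = 0 := by
    simp only [map_sum, map_smul, F.hor_horizontal 0 p hp _ (F.ver_vertical _ p hp), smul_zero,
      Finset.sum_const_zero]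
  rw [← h, h1] at h2
  exact one_ne_zero h2

include hπ hb hb' in
/-- The energy density in terms of a frame that is adapted to another metric. -/
lemma density_eq_densityFor {p : P} (hp : p ∈ π ⁻¹' U) (hp' : p ∈ π ⁻¹' U') :
    F'.density H' p = F.densityFor b' H' p := by
  have hU := F.isOpen.inter F'.isOpen
  have hW := hπ.isOpen_preimage hU
  have hl : π ⁻¹' (U ∩ U') ⊆ π ⁻¹' U := Set.preimage_mono Set.inter_subset_left
  have hr : π ⁻¹' (U ∩ U') ⊆ π ⁻¹' U' := Set.preimage_mono Set.inter_subset_right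
  have hpp : p ∈ π ⁻¹' (U ∩ U') := ⟨hp, hp'⟩
  have hes : ∀ a, SmoothFieldOn (F.all a) (π ⁻¹' (U ∩ U')) := by
    rintro (α | i)
    exacts [(F.hor_smooth α).mono hl, (F.ver_smooth i).mono hl]
  have hei : ∀ a, InvariantFieldOn K (F.all a) (π ⁻¹' (U ∩ U')) := by
    rintro (α | i)
    exacts [(F.hor_invariant α).mono hl, (F.ver_invariant i).mono hl]
  let c : Fin 1 ⊕ Fin 3 → P → ℝ := fun a => ev₂ b (F'.hor 0) (F.all a)
  let q : Fin 3 → Fin 3 → P → ℝ := fun i m => ev₂ b (F'.ver i) (F.ver m)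
  have hcs : ∀ a, SmoothOn EP (c a) (π ⁻¹' (U ∩ U')) := fun a =>
    hb.smooth _ _ _ hW ((F'.hor_smooth 0).mono hr) (hes a)
  have hci : ∀ a, InvFun K (c a) (π ⁻¹' (U ∩ U')) := fun a =>
    hb.invFun ((F'.hor_invariant 0).mono hr) (hei a)
  have hqs : ∀ i m, SmoothOn EP (q i m) (π ⁻¹' (U ∩ U')) := fun i m =>
    hb.smooth _ _ _ hW ((F'.ver_smooth i).mono hr) ((F.ver_smooth m).mono hl)
  have hV : ∀ x ∈ π ⁻¹' (U ∩ U'), F'.hor 0 x = ∑ a, c a x • F.all a x := fun x hx => by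
    simp only [Fintype.sum_sum_type, Fin.sum_univ_one]
    exact F.expand hb (hl hx) (F'.hor 0 x)
  have he : ∀ i, ∀ x ∈ π ⁻¹' (U ∩ U'), F'.ver i x = ∑ m, q i m x • F.ver m x := fun i x hx =>
    F.expand_vertical hb (hl hx) (F'.ver_vertical i x (hr hx))
  set c0 := c (Sum.inl 0) p with hc0
  have hVp : F'.hor 0 p = c0 • F.hor 0 p + ∑ m, c (Sum.inr m) p • F.ver m p := by
    rw [hV p hpp]
    simp only [Fintype.sum_sum_type, Fin.sum_univ_one]
    rfl
  -- the vertical coefficients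
  have hcm : ∀ m, c (Sum.inr m) p = - c0 * F.vertCoeff b' p m := by
    have h1 : ∀ k, c0 * b' p (F.hor 0 p) (F.ver k p)
        + ∑ m, c (Sum.inr m) p * b' p (F.ver m p) (F.ver k p) = 0 := fun k => by
      have := F'.hor_horizontal 0 p hp' _ (F.ver_vertical k p hp)
      rw [hVp] at this
      simpa only [map_add, map_sum, map_smul, add_apply, sum_apply, smul_apply, smul_eq_mul]
        using this
    have hdet := (F.gram_posDef hb' hp).det_pos.ne'
    have h2 : (F.gram b' p).mulVec (fun m => c (Sum.inr m) p + c0 * F.vertCoeff b' p m) = 0 := by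
      funext k
      have := h1 k
      rw [← F.gram_mulVec hb' hp k] at this
      simp only [Matrix.mulVec, dotProduct, gram, Pi.zero_apply]
      rw [← this, Finset.mul_sum, ← Finset.sum_add_distrib]
      exact Finset.sum_congr rfl fun m _ => by rw [hb'.symm p (F.ver k p)]; ring
    have h3 := Matrix.eq_zero_of_mulVec_eq_zero hdet h2
    intro m
    have := congrFun h3 m
    simp only [Pi.zero_apply] at this
    linarith
  have hVp' : F'.hor 0 p = c0 • (F.hor 0 p - ∑ m, F.vertCoeff b' p m • F.ver m p) := by
    rw [hVp, smul_sub, Finset.smul_sum, sub_eq_add_neg, ← Finset.sum_neg_distrib]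
    simp only [hcm, neg_mul, neg_smul, mul_smul]
  -- The horizontal vector of the second frame has `b'`-length one. This determines `c0` up to sign.
  have hr1 : c0 ^ 2 * F.horSq b' p = 1 := by
    have h1 : b' p (F'.hor 0 p) (F'.hor 0 p) = 1 := by simpa using F'.hor_orthonormal 0 0 p hp'
    rw [hVp', map_smul, map_smul, smul_apply, smul_eq_mul, smul_eq_mul,
      ← (F.horSq_pos hb' hp).2] at h1
    rw [← h1]; ring
  have hrinv : (F.horSq b' p)⁻¹ = c0 ^ 2 := (eq_inv_of_mul_eq_one_left hr1).symm
  have hq : ∀ i j, ∑ k, ∑ l, q i k p * q j l p * F.gram b' p k l = if i = j then 1 else 0 :=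
    fun i j => by
    rw [← F'.ver_orthonormal i j p hp', he i p hpp, he j p hpp]
    simp only [map_sum, map_smul, sum_apply, smul_apply, smul_eq_mul, gram, Finset.mul_sum]
    rw [Finset.sum_comm]
    exact Finset.sum_congr rfl fun k _ => Finset.sum_congr rfl fun l _ => by ring
  have hshape : ∀ i j, F'.shape i j p =
      c0 * ∑ k, ∑ l, q i k p * q j l p * F.shapeFor b' p k l := fun i j => by
    rw [F'.shape_eq_lieD hπ hb' i j hp', lieD_lincomb hW hpp (fun m => (F.ver_smooth m).mono hl)
      (fun k l => hb'.smooth _ _ _ hW ((F.ver_smooth k).mono hl) ((F.ver_smooth l).mono hl))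
      (hqs i) (hqs j) (he i) (he j), Finset.mul_sum]
    refine Finset.sum_congr rfl fun k _ => ?_
    rw [Finset.mul_sum]
    refine Finset.sum_congr rfl fun l _ => ?_
    -- The coefficients of the new horizontal field are invariant, hence constant along vertical
    -- fields. This makes the Lie derivative linear in that field.
    have hz : ∀ k a, along (F.ver k) (c a) p = 0 := fun k a =>
      hπ.along_vertical hU (hci a) (hcs a) hpp (F.ver_vertical k p hp)
    rw [lieD_lincomb_left hW hpp hes hcs hV (hz k) (hz l)]
    simp only [Fintype.sum_sum_type, Fin.sum_univ_one, all, Sum.elim_inl, Sum.elim_inr, hcm,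
      ← hc0, shapeFor]
    simp only [Fin.sum_univ_three]
    ring
  have hflux : ∀ i j, F'.flux H' i j p =
      c0 * ∑ k, ∑ l, q i k p * q j l p * F.fluxFor b' H' p k l := fun i j => by
    have hf : ∀ k l, H' p ![F'.hor 0 p, F.ver k p, F.ver l p] = c0 * F.fluxFor b' H' p k l :=
      fun k l => by
      rw [hV p hpp, form_lincomb]
      simp only [Fintype.sum_sum_type, Fin.sum_univ_one, all, Sum.elim_inl, Sum.elim_inr, hcm,
        ← hc0, fluxFor, flux, fluxVer, ev₃, Fin.sum_univ_three]
      ring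
    simp only [flux, ev₃, he i p hpp, he j p hpp, form_lincomb', form_lincomb'', hf,
      Finset.mul_sum]
    rw [Finset.sum_comm]
    exact Finset.sum_congr rfl fun k _ => Finset.sum_congr rfl fun l _ => by ring
  have n1 := sum_sq_eq_gramNormSq (X' := fun i j => F'.shape i j p) (q := fun i j => q i j p)
    hq hshape
  have n2 := sum_sq_eq_gramNormSq (X' := fun i j => F'.flux H' i j p) (q := fun i j => q i j p)
    hq hflux
  simp only [density, Finset.sum_add_distrib, densityFor, hrinv]
  rw [mul_add, ← n1, ← n2]

end AdaptedFrame

end ChangeOfFrame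

/-! ### Calculus in time and one coordinate; smooth families of matrices. -/

section TwoVariables

open scoped Topology

variable {f : ℝ × ℝ → ℝ} {J I : Set ℝ}

lemma contDiffOn_deriv_snd (hJ : IsOpen J) (hI : IsOpen I) (hf : ContDiffOn ℝ ∞ f (J ×ˢ I)) :
    ContDiffOn ℝ ∞ (fun z : ℝ × ℝ => deriv (fun y => f (z.1, y)) z.2) (J ×ˢ I) := by
  have ho := hJ.prod hI
  have h1 : ContDiffOn ℝ ∞ (fun z => fderiv ℝ f z (0, 1)) (J ×ˢ I) :=
    (hf.fderiv_of_isOpen ho (by simp)).clm_apply contDiffOn_const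
  refine h1.congr fun z hz => ?_
  have hd : HasFDerivAt f (fderiv ℝ f z) (z.1, z.2) :=
    ((hf.contDiffAt (ho.mem_nhds hz)).differentiableAt (by simp)).hasFDerivAt
  exact (hd.comp_hasDerivAt z.2 ((hasDerivAt_const z.2 z.1).prodMk (hasDerivAt_id z.2))).deriv

/-- Interchange of partial derivatives. -/
lemma hasDerivAt_deriv_snd (hJ : IsOpen J) (hI : IsOpen I) (hf : ContDiffOn ℝ ∞ f (J ×ˢ I))
    {t x : ℝ} (ht : t ∈ J) (hx : x ∈ I) :
    HasDerivAt (fun s => deriv (fun y => f (s, y)) x)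
      (deriv (fun y => deriv (fun s => f (s, y)) t) x) t ∧
    DifferentiableAt ℝ (fun y => deriv (fun s => f (s, y)) t) x := by
  have ho := hJ.prod hI
  have hd : ∀ z ∈ J ×ˢ I, HasFDerivAt f (fderiv ℝ f z) (z.1, z.2) := fun z hz =>
    ((hf.contDiffAt (ho.mem_nhds hz)).differentiableAt (by simp)).hasFDerivAt
  have e2 : ∀ s ∈ J, deriv (fun y => f (s, y)) x = fderiv ℝ f (s, x) (0, 1) := fun s hs =>
    ((hd (s, x) ⟨hs, hx⟩).comp_hasDerivAt x
      ((hasDerivAt_const x s).prodMk (hasDerivAt_id x))).deriv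
  have e1 : ∀ y ∈ I, deriv (fun s => f (s, y)) t = fderiv ℝ f (t, y) (1, 0) := fun y hy =>
    ((hd (t, y) ⟨ht, hy⟩).comp_hasDerivAt t
      ((hasDerivAt_id t).prodMk (hasDerivAt_const t y))).deriv
  have hdd : HasFDerivAt (fderiv ℝ f) (fderiv ℝ (fderiv ℝ f) (t, x)) (t, x) :=
    (((hf.fderiv_of_isOpen ho (m := ∞) (by simp)).contDiffAt
      (ho.mem_nhds ⟨ht, hx⟩)).differentiableAt (by simp)).hasFDerivAt
  have hv : ∀ v : ℝ × ℝ, HasFDerivAt (fun z => fderiv ℝ f z v)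
      ((fderiv ℝ (fderiv ℝ f) (t, x)).flip v) (t, x) := fun v =>
    ((ContinuousLinearMap.apply ℝ ℝ v).hasFDerivAt.comp (t, x) hdd).congr_fderiv (by ext <;> rfl)
  have d2 : HasDerivAt (fun s => fderiv ℝ f (s, x) (0, 1))
      (fderiv ℝ (fderiv ℝ f) (t, x) (1, 0) (0, 1)) t :=
    show HasDerivAt _ ((fderiv ℝ (fderiv ℝ f) (t, x)).flip (0, 1) (1, 0)) t from
    HasFDerivAt.comp_hasDerivAt (l := fun z => fderiv ℝ f z (0, 1)) (f := fun s => (s, x)) t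
      (hv (0, 1)) ((hasDerivAt_id t).prodMk (hasDerivAt_const t x))
  have d1 : HasDerivAt (fun y => fderiv ℝ f (t, y) (1, 0))
      (fderiv ℝ (fderiv ℝ f) (t, x) (0, 1) (1, 0)) x :=
    show HasDerivAt _ ((fderiv ℝ (fderiv ℝ f) (t, x)).flip (1, 0) (0, 1)) x from
    HasFDerivAt.comp_hasDerivAt (l := fun z => fderiv ℝ f z (1, 0)) (f := fun y => (t, y)) x
      (hv (1, 0)) ((hasDerivAt_const x t).prodMk (hasDerivAt_id x))
  have hsymm : IsSymmSndFDerivAt ℝ f (t, x) :=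
    (hf.contDiffAt (ho.mem_nhds ⟨ht, hx⟩)).isSymmSndFDerivAt (by
      rw [minSmoothness_of_isRCLikeNormedField]; exact WithTop.coe_le_coe.2 le_top)
  have d1' := d1.congr_of_eventuallyEq (Filter.eventuallyEq_of_mem (hI.mem_nhds hx) e1)
  refine ⟨?_, d1'.differentiableAt⟩
  rw [d1'.deriv, hsymm.eq]
  exact d2.congr_of_eventuallyEq (Filter.eventuallyEq_of_mem (hJ.mem_nhds ht) e2)

lemma contDiffOn_sum_univ {E ι : Type*} [NormedAddCommGroup E] [NormedSpace ℝ E] [Fintype ι]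
    {f : ι → E → ℝ} {s : Set E} (h : ∀ i, ContDiffOn ℝ ∞ (f i) s) :
    ContDiffOn ℝ ∞ (fun x => ∑ i, f i x) s :=
  ContDiffOn.sum fun i _ => h i

lemma contDiffOn_det {E : Type*} [NormedAddCommGroup E] [NormedSpace ℝ E] {s : Set E}
    {A : E → Matrix (Fin 3) (Fin 3) ℝ} (h : ∀ i j, ContDiffOn ℝ ∞ (fun x => A x i j) s) :
    ContDiffOn ℝ ∞ (fun x => (A x).det) s := by
  simp only [Matrix.det_apply]
  refine ContDiffOn.sum fun τ _ => ContDiffOn.const_smul _ ?_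
  exact contDiffOn_prod fun i _ => h _ _

/-- The entries of the inverse of a smooth family of invertible matrices are smooth. -/
lemma contDiffOn_inv_apply {E : Type*} [NormedAddCommGroup E] [NormedSpace ℝ E] {s : Set E}
    {A : E → Matrix (Fin 3) (Fin 3) ℝ} (h : ∀ i j, ContDiffOn ℝ ∞ (fun x => A x i j) s)
    (hd : ∀ x ∈ s, (A x).det ≠ 0) (i j : Fin 3) :
    ContDiffOn ℝ ∞ (fun x => (A x)⁻¹ i j) s := by
  simp only [Matrix.inv_def, Matrix.smul_apply, Matrix.adjugate_apply, Ring.inverse_eq_inv',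
    smul_eq_mul]
  refine ((contDiffOn_det h).inv hd).mul (contDiffOn_det fun k l => ?_)
  by_cases hk : k = j
  · subst hk
    simp only [Matrix.updateRow_self]
    exact contDiffOn_const
  · simp only [Matrix.updateRow_ne hk]
    exact h k l

/-- The derivative of the inverse matrix, at a point where the matrix is the identity. -/
lemma hasDerivAt_inv_apply {A : ℝ → Matrix (Fin 3) (Fin 3) ℝ} {Γ : Matrix (Fin 3) (Fin 3) ℝ} {t : ℝ}
    (hA : ∀ i j, HasDerivAt (fun s => A s i j) (Γ i j) t) (h1 : A t = 1)
    (hd : ∀ᶠ s in 𝓝 t, (A s).det ≠ 0)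
    (hi : ∀ i j, DifferentiableAt ℝ (fun s => (A s)⁻¹ i j) t) (i j : Fin 3) :
    HasDerivAt (fun s => (A s)⁻¹ i j) (- Γ i j) t := by
  -- Differentiate `A A⁻¹ = 1`; since `A t = 1`, the product rule reads `Γ + (A⁻¹)' = 0`.
  have e : (fun s => ∑ k, A s i k * (A s)⁻¹ k j) =ᶠ[𝓝 t]
      fun _ => (1 : Matrix (Fin 3) (Fin 3) ℝ) i j := by
    filter_upwards [hd] with s hs
    rw [← Matrix.mul_nonsing_inv (A s) (isUnit_iff_ne_zero.2 hs), Matrix.mul_apply]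
  have d := HasDerivAt.fun_sum (u := Finset.univ) fun k _ =>
    (hA i k).mul (hi k j).hasDerivAt
  have d0 := d.unique ((hasDerivAt_const t _).congr_of_eventuallyEq e)
  simp only [h1, inv_one, Matrix.one_apply, mul_ite, mul_one, mul_zero, ite_mul, one_mul, zero_mul,
    Finset.sum_add_distrib, Finset.sum_ite_eq, Finset.sum_ite_eq', Finset.mem_univ, if_true] at d0
  have := (hi i j).hasDerivAt
  rwa [eq_neg_of_add_eq_zero_right d0] at this

set_option maxRecDepth 10000 in
/-- The derivative of the squared norm of a symmetric or antisymmetric bilinear form, when the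
metric varies. -/
lemma hasDerivAt_gramNormSq {A X : ℝ → Matrix (Fin 3) (Fin 3) ℝ} {Γ X₀ X' : Matrix (Fin 3) (Fin 3) ℝ}
    {t ε : ℝ} (hA : ∀ i j, HasDerivAt (fun s => (A s)⁻¹ i j) (- Γ i j) t) (h1 : A t = 1)
    (hX : ∀ i j, HasDerivAt (fun s => X s i j) (X' i j) t) (hX₀ : ∀ i j, X t i j = X₀ i j)
    (hε : ε * ε = 1) (hs : ∀ i j, X₀ j i = ε * X₀ i j) :
    HasDerivAt (fun s => gramNormSq (A s) (X s))
      (2 * (∑ i, ∑ j, X₀ i j * X' i j) - 2 * ∑ i, ∑ k, Γ i k * ∑ j, X₀ i j * X₀ k j) t := by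
  have d : HasDerivAt (fun s => gramNormSq (A s) (X s)) (∑ i, ∑ j, ∑ k, ∑ l,
      ((-Γ i k * (A t)⁻¹ j l + (A t)⁻¹ i k * -Γ j l) * (X t i j * X t k l)
        + (A t)⁻¹ i k * (A t)⁻¹ j l * (X' i j * X t k l + X t i j * X' k l))) t :=
    HasDerivAt.fun_sum (u := Finset.univ) fun i _ =>
    HasDerivAt.fun_sum (u := Finset.univ) fun j _ =>
    HasDerivAt.fun_sum (u := Finset.univ) fun k _ =>
    HasDerivAt.fun_sum (u := Finset.univ) fun l _ =>
      ((hA i k).mul (hA j l)).mul ((hX i j).mul (hX k l))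
  refine d.congr_deriv ?_
  -- Varying the metric in either index contributes the same amount: transposing `X₀` twice gives
  -- the factor `ε² = 1`.
  have hsum : ∑ j, ∑ l, Γ j l * ∑ i, X₀ i j * X₀ i l = ∑ i, ∑ k, Γ i k * ∑ j, X₀ i j * X₀ k j := by
    refine Finset.sum_congr rfl fun j _ => Finset.sum_congr rfl fun l _ => ?_
    congr 1
    refine Finset.sum_congr rfl fun i _ => ?_
    rw [hs j i, hs l i]
    linear_combination (X₀ j i * X₀ l i) * hε
  have hsum' : 2 * ∑ i, ∑ k, Γ i k * ∑ j, X₀ i j * X₀ k j =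
      ∑ j, ∑ l, Γ j l * ∑ i, X₀ i j * X₀ i l + ∑ i, ∑ k, Γ i k * ∑ j, X₀ i j * X₀ k j := by
    rw [hsum]; ring
  rw [hsum']
  have hd1 : ∀ i : Fin 3, (1 : Matrix (Fin 3) (Fin 3) ℝ) i i = 1 := Matrix.one_apply_eq
  have h01 : (1 : Matrix (Fin 3) (Fin 3) ℝ) 0 1 = 0 := Matrix.one_apply_ne (by decide)
  have h02 : (1 : Matrix (Fin 3) (Fin 3) ℝ) 0 2 = 0 := Matrix.one_apply_ne (by decide)
  have h10 : (1 : Matrix (Fin 3) (Fin 3) ℝ) 1 0 = 0 := Matrix.one_apply_ne (by decide)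
  have h12 : (1 : Matrix (Fin 3) (Fin 3) ℝ) 1 2 = 0 := Matrix.one_apply_ne (by decide)
  have h20 : (1 : Matrix (Fin 3) (Fin 3) ℝ) 2 0 = 0 := Matrix.one_apply_ne (by decide)
  have h21 : (1 : Matrix (Fin 3) (Fin 3) ℝ) 2 1 = 0 := Matrix.one_apply_ne (by decide)
  simp only [h1, inv_one, hX₀, Fin.sum_univ_three, hd1, h01, h02, h10, h12, h20, h21, mul_zero,
    zero_mul, mul_one, one_mul, add_zero, zero_add]
  ring

end TwoVariables

/-! ### Time-dependent invariant functions along a slice. -/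

section TimeDependence

set_option linter.unusedSectionVars false

open scoped Topology

lemma differentiableAt_fst_of_contDiffOn {f : ℝ × ℝ → ℝ} {J I : Set ℝ} (hJ : IsOpen J)
    (hI : IsOpen I) (hf : ContDiffOn ℝ ∞ f (J ×ˢ I)) {t x : ℝ} (ht : t ∈ J) (hx : x ∈ I) :
    DifferentiableAt ℝ (fun s => f (s, x)) t :=
  DifferentiableAt.comp (g := f) (f := fun s => (s, x)) t
    ((hf.contDiffAt ((hJ.prod hI).mem_nhds ⟨ht, hx⟩)).differentiableAt (by simp))
    (differentiableAt_id.prodMk (differentiableAt_const x))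

variable {EK : Type*} [NormedAddCommGroup EK] [NormedSpace ℝ EK]
  {K : Type*} [TopologicalSpace K] [Group K] [ChartedSpace EK K]
  {M : Type*} [TopologicalSpace M] [ChartedSpace (EuclideanSpace ℝ (Fin 1)) M]
  {EP : Type*} [NormedAddCommGroup EP] [NormedSpace ℝ EP]
  {P : Type*} [TopologicalSpace P] [ChartedSpace EP P] [MulAction Kᵐᵒᵖ P]
  {π : P → M}

namespace Slice

variable {U : Set M} {z : M → ℝ} {σ : ℝ → P} {I : Set ℝ} (h : Slice K EP π U z σ I)
  (hπ : IsPrincipalBundle EK K (EuclideanSpace ℝ (Fin 1)) EP π)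

include hπ h in
/-- Translation of a slice by a group element. -/
lemma translate (a : K) : Slice K EP π U z (fun x => MulOpposite.op a • σ x) I where
  isOpen := h.isOpen
  isOpen_coord := h.isOpen_coord
  smooth_coord := h.smooth_coord
  smooth_section := (hπ.contMDiff_act a).comp_contMDiffOn h.smooth_section
  coord_mem := h.coord_mem
  section_mem x hx := hπ.act_mem a (h.section_mem x hx)
  coord_section x hx := by rw [hπ.proj_act, h.coord_section x hx]
  exists_act p hp := by
    obtain ⟨c, hc⟩ := h.exists_act p hp
    exact ⟨a⁻¹ * c, by simpa [smul_smul] using hc⟩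

include h

lemma contDiffOn_time {J : Set ℝ} {f : ℝ → P → ℝ}
    (hf : ContMDiffOn (𝓘(ℝ, ℝ).prod 𝓘(ℝ, EP)) 𝓘(ℝ, ℝ) ∞ (fun y : ℝ × P => f y.1 y.2)
      (J ×ˢ (π ⁻¹' U))) :
    ContDiffOn ℝ ∞ (fun y : ℝ × ℝ => f y.1 (σ y.2)) (J ×ˢ I) := by
  have h1 : ContMDiffOn 𝓘(ℝ, ℝ × ℝ) (𝓘(ℝ, ℝ).prod 𝓘(ℝ, EP)) ∞
      (fun y : ℝ × ℝ => (y.1, σ y.2)) (J ×ˢ I) :=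
    contDiff_fst.contMDiff.contMDiffOn.prodMk
      (h.smooth_section.comp contDiff_snd.contMDiff.contMDiffOn fun y hy => hy.2)
  exact contMDiffOn_iff_contDiffOn.1 (hf.comp h1 fun y hy => ⟨hy.1, h.section_mem _ hy.2⟩)

include hπ

lemma along_section {f : P → ℝ} (hf : InvFun K f (π ⁻¹' U)) {x : ℝ} (hx : x ∈ I)
    (hd : DifferentiableAt ℝ (f ∘ σ) x) (Y : VField EP P) :
    along Y f (σ x) = deriv (f ∘ σ) x * along Y (z ∘ π) (σ x) := by
  have := h.along_eq hπ hf (h.section_mem x hx) (by rwa [h.coord_section x hx]) Y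
  rwa [h.coord_section x hx] at this

variable {J : Set ℝ} (hJ : IsOpen J) {f : ℝ → P → ℝ}
  (hs : ContDiffOn ℝ ∞ (fun y : ℝ × ℝ => f y.1 (σ y.2)) (J ×ˢ I))
  (hi : ∀ t ∈ J, InvFun K (f t) (π ⁻¹' U))
include hJ hs hi

lemma along_time {t x : ℝ} (ht : t ∈ J) (hx : x ∈ I) (Y : VField EP P) :
    along Y (f t) (σ x) = deriv (fun y => f t (σ y)) x * along Y (z ∘ π) (σ x) :=
  h.along_section hπ (hi t ht) hx (DifferentiableAt.comp (g := fun y : ℝ × ℝ => f y.1 (σ y.2))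
    (f := fun y => (t, y)) x ((hs.contDiffAt
      ((hJ.prod h.isOpen_coord).mem_nhds ⟨ht, hx⟩)).differentiableAt (by simp))
    ((differentiableAt_const t).prodMk differentiableAt_id)) Y

/-- The derivative along an invariant field commutes with the derivative in time. -/
lemma hasDerivAt_along {t x : ℝ} (ht : t ∈ J) (hx : x ∈ I) (Y : VField EP P) :
    HasDerivAt (fun s => along Y (f s) (σ x))
      (along Y (fun q => deriv (fun s => f s q) t) (σ x)) t := by
  obtain ⟨h1, h2⟩ := hasDerivAt_deriv_snd hJ h.isOpen_coord hs ht hx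
  -- The time derivative of an invariant family is invariant, so both derivatives along `Y` are
  -- coordinate derivatives times the same factor, and the claim becomes equality of mixed partials.
  have hinv : InvFun K (fun q => deriv (fun s => f s q) t) (π ⁻¹' U) := fun a q hq =>
    (Filter.eventuallyEq_of_mem (hJ.mem_nhds ht) fun s hs' => hi s hs' a q hq).deriv_eq
  rw [h.along_section hπ hinv hx h2]
  exact (h1.mul_const _).congr_of_eventuallyEq (Filter.eventuallyEq_of_mem (hJ.mem_nhds ht)
    fun s hs' => h.along_time hπ hJ hs hi hs' hx Y)

lemma contDiffOn_along_time [CompleteSpace EP] [IsManifold 𝓘(ℝ, EP) ∞ P] {Y : VField EP P}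
    (hY : SmoothFieldOn Y (π ⁻¹' U)) :
    ContDiffOn ℝ ∞ (fun y : ℝ × ℝ => along Y (f y.1) (σ y.2)) (J ×ˢ I) := by
  have h1 : ContDiffOn ℝ ∞ (fun x => along Y (z ∘ π) (σ x)) I :=
    h.contDiffOn_comp_section ((h.smoothOn_coord hπ).along (hπ.isOpen_preimage h.isOpen) hY)
  exact ((contDiffOn_deriv_snd hJ h.isOpen_coord hs).mul
    (h1.comp contDiffOn_snd fun y hy => hy.2)).congr fun y hy =>
      h.along_time hπ hJ hs hi hy.1 hy.2 Y

end Slice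

end TimeDependence

/-! ### Vertical and horizontal parts for a second metric. -/

section VerticalPart

set_option linter.unusedSectionVars false

variable {EK : Type*} [NormedAddCommGroup EK] [NormedSpace ℝ EK]
  {K : Type*} [TopologicalSpace K] [Group K] [ChartedSpace EK K]
  {M : Type*} [TopologicalSpace M] [ChartedSpace (EuclideanSpace ℝ (Fin 1)) M]
  [IsManifold 𝓘(ℝ, EuclideanSpace ℝ (Fin 1)) ∞ M]
  {EP : Type*} [NormedAddCommGroup EP] [NormedSpace ℝ EP] [CompleteSpace EP]
  {P : Type*} [TopologicalSpace P] [ChartedSpace EP P] [MulAction Kᵐᵒᵖ P]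
  [IsManifold 𝓘(ℝ, EP) ∞ P] {π : P → M}

/-- The condition behind the choice has one solution: the difference of two is vertical and
orthogonal to every vertical vector, hence to itself. -/
lemma vertPart_eq {b : BilinField EP P} (hb : IsInvMetric K b) {p : P}
    {Z w : TangentSpace 𝓘(ℝ, EP) p}
    (hw : mfderiv 𝓘(ℝ, EP) 𝓘(ℝ, EuclideanSpace ℝ (Fin 1)) π p w = 0)
    (hZ : ∀ u : TangentSpace 𝓘(ℝ, EP) p,
      mfderiv 𝓘(ℝ, EP) 𝓘(ℝ, EuclideanSpace ℝ (Fin 1)) π p u = 0 → b p (Z - w) u = 0) :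
    vertPart (EuclideanSpace ℝ (Fin 1)) π b p Z = w := by
  have hs := Classical.epsilon_spec (p := fun w : TangentSpace 𝓘(ℝ, EP) p =>
    mfderiv 𝓘(ℝ, EP) 𝓘(ℝ, EuclideanSpace ℝ (Fin 1)) π p w = 0 ∧
    ∀ u : TangentSpace 𝓘(ℝ, EP) p,
      mfderiv 𝓘(ℝ, EP) 𝓘(ℝ, EuclideanSpace ℝ (Fin 1)) π p u = 0 → b p (Z - w) u = 0) ⟨w, hw, hZ⟩
  change mfderiv 𝓘(ℝ, EP) 𝓘(ℝ, EuclideanSpace ℝ (Fin 1)) π p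
    (vertPart (EuclideanSpace ℝ (Fin 1)) π b p Z) = 0 ∧ ∀ u : TangentSpace 𝓘(ℝ, EP) p,
      mfderiv 𝓘(ℝ, EP) 𝓘(ℝ, EuclideanSpace ℝ (Fin 1)) π p u = 0 →
        b p (Z - vertPart (EuclideanSpace ℝ (Fin 1)) π b p Z) u = 0 at hs
  generalize vertPart (EuclideanSpace ℝ (Fin 1)) π b p Z = w' at hs
  have hv : mfderiv 𝓘(ℝ, EP) 𝓘(ℝ, EuclideanSpace ℝ (Fin 1)) π p (w' - w) = 0 := by
    rw [map_sub, hs.1, hw, sub_zero]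
  by_contra hne
  refine (hb.pos p (w' - w) (sub_ne_zero.2 hne)).ne' ?_
  have e : b p (w' - w) = b p (Z - w) - b p (Z - w') := by
    rw [← map_sub]
    exact congrArg (b p) (by abel)
  rw [e, sub_apply, hs.2 _ hv, hZ _ hv, sub_zero]

namespace AdaptedFrame

variable {b b' : BilinField EP P} {U : Set M}
  (F : AdaptedFrame K (EuclideanSpace ℝ (Fin 1)) π b 1 3 U)
  (hπ : IsPrincipalBundle EK K (EuclideanSpace ℝ (Fin 1)) EP π) (hb : IsInvMetric K b)
  (hb' : IsInvMetric K b')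

include hb hb' in
lemma vertPart_hor {p : P} (hp : p ∈ π ⁻¹' U) :
    vertPart (EuclideanSpace ℝ (Fin 1)) π b' p (F.hor 0 p) =
      ∑ m, F.vertCoeff b' p m • F.ver m p := by
  refine vertPart_eq hb' ?_ fun u hu => ?_
  · simp only [map_sum, map_smul, F.ver_vertical _ p hp, smul_zero, Finset.sum_const_zero]
  · rw [F.expand_vertical hb hp hu]
    simp only [map_sub, map_sum, map_smul, sub_apply, sum_apply, smul_apply, smul_eq_mul,
      F.gram_mulVec hb' hp, sub_self, mul_zero, Finset.sum_const_zero]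

include hb hb' in
lemma horPart_hor {p : P} (hp : p ∈ π ⁻¹' U) :
    b' p (horPart (EuclideanSpace ℝ (Fin 1)) π b' p (F.hor 0 p))
      (horPart (EuclideanSpace ℝ (Fin 1)) π b' p (F.hor 0 p)) = F.horSq b' p := by
  rw [(F.horSq_pos hb' hp).2, horPart, F.vertPart_hor hb hb' hp]

/-- For the metric to which the frame is adapted the comparison data are trivial, which removes most
terms from the product rules at the reference time. -/
lemma gram_self {p : P} (hp : p ∈ π ⁻¹' U) : F.gram b p = 1 := by
  ext i j
  rw [Matrix.one_apply]
  exact F.ver_orthonormal i j p hp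

lemma vertCoeff_self {p : P} (hp : p ∈ π ⁻¹' U) (i : Fin 3) : F.vertCoeff b p i = 0 := by
  simp only [vertCoeff, F.hor_horizontal 0 p hp _ (F.ver_vertical _ p hp)]
  exact congrFun (Matrix.mulVec_zero _) i

lemma horSq_self {p : P} (hp : p ∈ π ⁻¹' U) : F.horSq b p = 1 := by
  simp only [horSq, F.vertCoeff_self hp, zero_mul, Finset.sum_const_zero, sub_zero]
  simpa using F.hor_orthonormal 0 0 p hp

lemma fluxFor_self (H : ThreeForm EP P) {p : P} (hp : p ∈ π ⁻¹' U) (k l : Fin 3) :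
    F.fluxFor b H p k l = F.flux H k l p := by
  simp only [fluxFor, F.vertCoeff_self hp, zero_mul, Finset.sum_const_zero, sub_zero]

include hπ hb

lemma shapeFor_self {p : P} (hp : p ∈ π ⁻¹' U) (k l : Fin 3) :
    F.shapeFor b p k l = F.shape k l p := by
  simp only [shapeFor, F.vertCoeff_self hp, zero_mul, Finset.sum_const_zero, sub_zero,
    F.shape_eq_lieD hπ hb k l hp]

/-- Brackets do not depend on a metric, so their coefficients can be taken for the fixed `b`. All
dependence on `b'` is through its Gram matrix and the derivative of that matrix along `V`. -/
lemma lieD_hor_ver {p : P} (hp : p ∈ π ⁻¹' U) (k l : Fin 3) :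
    lieD b' (F.hor 0) (F.ver k) (F.ver l) p = along (F.hor 0) (ev₂ b' (F.ver k) (F.ver l)) p
      - ∑ n, F.conn k n p * F.gram b' p n l - ∑ n, F.conn l n p * F.gram b' p k n := by
  simp only [lieD, ev₂, F.brk_hor_ver hπ hb hp, map_sum, map_smul, sum_apply, smul_apply,
    smul_eq_mul, gram]

include hb'

lemma lieD_ver_ver {p : P} (hp : p ∈ π ⁻¹' U) (m k l : Fin 3) :
    lieD b' (F.ver m) (F.ver k) (F.ver l) p =
      - ∑ n, F.struc m k n p * F.gram b' p n l - ∑ n, F.struc m l n p * F.gram b' p k n := by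
  have h0 : along (F.ver m) (ev₂ b' (F.ver k) (F.ver l)) p = 0 :=
    hπ.along_vertical F.isOpen (hb'.invFun (F.ver_invariant k) (F.ver_invariant l))
      (hb'.smooth _ _ _ (hπ.isOpen_preimage F.isOpen) (F.ver_smooth k) (F.ver_smooth l)) hp
      (F.ver_vertical m p hp)
  simp only [lieD, h0]
  simp only [ev₂, F.brk_ver_ver hπ hb hp, map_sum, map_smul, sum_apply, smul_apply,
    smul_eq_mul, gram, zero_sub]

end AdaptedFrame

end VerticalPart

/-! ### Joint smoothness in time and coordinate, for a fixed frame. -/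

section FrameInTime

set_option linter.unusedSectionVars false

open scoped Topology

variable {EK : Type*} [NormedAddCommGroup EK] [NormedSpace ℝ EK]
  {K : Type*} [TopologicalSpace K] [Group K] [ChartedSpace EK K]
  {M : Type*} [TopologicalSpace M] [ChartedSpace (EuclideanSpace ℝ (Fin 1)) M]
  [IsManifold 𝓘(ℝ, EuclideanSpace ℝ (Fin 1)) ∞ M]
  {EP : Type*} [NormedAddCommGroup EP] [NormedSpace ℝ EP] [CompleteSpace EP]
  {P : Type*} [TopologicalSpace P] [ChartedSpace EP P] [MulAction Kᵐᵒᵖ P]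
  [IsManifold 𝓘(ℝ, EP) ∞ P] {π : P → M}

namespace AdaptedFrame

variable {b : BilinField EP P} {U U' : Set M}
  (F : AdaptedFrame K (EuclideanSpace ℝ (Fin 1)) π b 1 3 U)
  {J : Set ℝ} {gbar : ℝ → BilinField EP P} {Hbar : ℝ → ThreeForm EP P}
  {z : M → ℝ} {σ : ℝ → P} {I : Set ℝ}

section Smoothness

variable (hsub : U' ⊆ U) (h : Slice K EP π U' z σ I)
  (hπ : IsPrincipalBundle EK K (EuclideanSpace ℝ (Fin 1)) EP π)
include hsub h hπ

lemma contDiffOn_metric (hg : IsInvariantMetricFamily K J gbar) {X Y : VField EP P}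
    (hX : SmoothFieldOn X (π ⁻¹' U)) (hY : SmoothFieldOn Y (π ⁻¹' U)) :
    ContDiffOn ℝ ∞ (fun y : ℝ × ℝ => gbar y.1 (σ y.2) (X (σ y.2)) (Y (σ y.2))) (J ×ˢ I) :=
  have hl : π ⁻¹' U' ⊆ π ⁻¹' U := Set.preimage_mono hsub
  h.contDiffOn_time (f := fun t => ev₂ (gbar t) X Y)
    (hg.smooth _ _ _ (hπ.isOpen_preimage h.isOpen) (hX.mono hl) (hY.mono hl))

lemma contDiffOn_form (hH : IsInvariantClosedThreeFormFamily K J Hbar) {X Y Z : VField EP P}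
    (hX : SmoothFieldOn X (π ⁻¹' U)) (hY : SmoothFieldOn Y (π ⁻¹' U))
    (hZ : SmoothFieldOn Z (π ⁻¹' U)) :
    ContDiffOn ℝ ∞ (fun y : ℝ × ℝ => ev₃ (Hbar y.1) X Y Z (σ y.2)) (J ×ˢ I) :=
  have hl : π ⁻¹' U' ⊆ π ⁻¹' U := Set.preimage_mono hsub
  h.contDiffOn_time (f := fun t => ev₃ (Hbar t) X Y Z)
    (hH.smooth _ _ _ _ (hπ.isOpen_preimage h.isOpen) (hX.mono hl) (hY.mono hl) (hZ.mono hl))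

lemma contDiffOn_fixed {f : P → ℝ} (hf : SmoothOn EP f (π ⁻¹' U)) :
    ContDiffOn ℝ ∞ (fun y : ℝ × ℝ => f (σ y.2)) (J ×ˢ I) :=
  (h.contDiffOn_comp_section (hf.mono (Set.preimage_mono hsub))).comp contDiffOn_snd
    fun _ hy => hy.2

variable (hg : IsInvariantMetricFamily K J gbar)
include hg

lemma contDiffOn_gram (i j : Fin 3) :
    ContDiffOn ℝ ∞ (fun y : ℝ × ℝ => F.gram (gbar y.1) (σ y.2) i j) (J ×ˢ I) :=
  contDiffOn_metric hsub h hπ hg (F.ver_smooth i) (F.ver_smooth j)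

lemma contDiffOn_gram_inv (i j : Fin 3) :
    ContDiffOn ℝ ∞ (fun y : ℝ × ℝ => (F.gram (gbar y.1) (σ y.2))⁻¹ i j) (J ×ˢ I) :=
  contDiffOn_inv_apply (F.contDiffOn_gram hsub h hπ hg)
    (fun _ hy => (F.gram_posDef (hg.isInvMetric hy.1)
      (hsub (h.section_mem _ hy.2))).det_pos.ne') i j

lemma contDiffOn_vertCoeff (i : Fin 3) :
    ContDiffOn ℝ ∞ (fun y : ℝ × ℝ => F.vertCoeff (gbar y.1) (σ y.2) i) (J ×ˢ I) :=
  contDiffOn_sum_univ fun j => (F.contDiffOn_gram_inv hsub h hπ hg i j).mul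
    (contDiffOn_metric hsub h hπ hg (F.hor_smooth 0) (F.ver_smooth j))

lemma contDiffOn_horSq :
    ContDiffOn ℝ ∞ (fun y : ℝ × ℝ => F.horSq (gbar y.1) (σ y.2)) (J ×ˢ I) :=
  (contDiffOn_metric hsub h hπ hg (F.hor_smooth 0) (F.hor_smooth 0)).sub
    (contDiffOn_sum_univ fun j => (F.contDiffOn_vertCoeff hsub h hπ hg j).mul
      (contDiffOn_metric hsub h hπ hg (F.hor_smooth 0) (F.ver_smooth j)))

lemma invFun_gram {t : ℝ} (ht : t ∈ J) (i j : Fin 3) :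
    InvFun K (ev₂ (gbar t) (F.ver i) (F.ver j)) (π ⁻¹' U') :=
  ((hg.isInvMetric ht).invFun (F.ver_invariant i) (F.ver_invariant j)).mono
    (Set.preimage_mono hsub)

variable (hJ : IsOpen J) (hb : IsInvMetric K b)
include hJ hb

lemma contDiffOn_lieD_hor (k l : Fin 3) :
    ContDiffOn ℝ ∞ (fun y : ℝ × ℝ => lieD (gbar y.1) (F.hor 0) (F.ver k) (F.ver l) (σ y.2))
      (J ×ˢ I) := by
  have h1 := h.contDiffOn_along_time hπ hJ (f := fun t => ev₂ (gbar t) (F.ver k) (F.ver l))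
    (F.contDiffOn_gram hsub h hπ hg k l) (fun t ht => F.invFun_gram hsub h hπ hg ht k l)
    ((F.hor_smooth 0).mono (Set.preimage_mono hsub))
  refine ((h1.sub (contDiffOn_sum_univ fun n => (contDiffOn_fixed hsub h hπ
    (F.smooth_conn hπ hb k n)).mul (F.contDiffOn_gram hsub h hπ hg n l))).sub
    (contDiffOn_sum_univ fun n => (contDiffOn_fixed hsub h hπ
    (F.smooth_conn hπ hb l n)).mul (F.contDiffOn_gram hsub h hπ hg k n))).congr fun y hy => ?_
  exact F.lieD_hor_ver hπ hb (hsub (h.section_mem _ hy.2)) k l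

lemma contDiffOn_lieD_ver (m k l : Fin 3) :
    ContDiffOn ℝ ∞ (fun y : ℝ × ℝ => lieD (gbar y.1) (F.ver m) (F.ver k) (F.ver l) (σ y.2))
      (J ×ˢ I) := by
  refine ((contDiffOn_sum_univ fun n => (contDiffOn_fixed hsub h hπ
    (F.smooth_struc hπ hb m k n)).mul (F.contDiffOn_gram hsub h hπ hg n l)).neg.sub
    (contDiffOn_sum_univ fun n => (contDiffOn_fixed hsub h hπ
    (F.smooth_struc hπ hb m l n)).mul (F.contDiffOn_gram hsub h hπ hg k n))).congr fun y hy => ?_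
  exact F.lieD_ver_ver hπ hb (hg.isInvMetric hy.1) (hsub (h.section_mem _ hy.2)) m k l

lemma contDiffOn_shapeFor (k l : Fin 3) :
    ContDiffOn ℝ ∞ (fun y : ℝ × ℝ => F.shapeFor (gbar y.1) (σ y.2) k l) (J ×ˢ I) :=
  (F.contDiffOn_lieD_hor hsub h hπ hg hJ hb k l).sub (contDiffOn_sum_univ fun m =>
    (F.contDiffOn_vertCoeff hsub h hπ hg m).mul (F.contDiffOn_lieD_ver hsub h hπ hg hJ hb m k l))

variable (hH : IsInvariantClosedThreeFormFamily K J Hbar)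
include hH

omit hJ hb in
lemma contDiffOn_fluxFor (k l : Fin 3) :
    ContDiffOn ℝ ∞ (fun y : ℝ × ℝ => F.fluxFor (gbar y.1) (Hbar y.1) (σ y.2) k l) (J ×ˢ I) :=
  (contDiffOn_form hsub h hπ hH (F.hor_smooth 0) (F.ver_smooth k) (F.ver_smooth l)).sub
    (contDiffOn_sum_univ fun m => (F.contDiffOn_vertCoeff hsub h hπ hg m).mul
      (contDiffOn_form hsub h hπ hH (F.ver_smooth m) (F.ver_smooth k) (F.ver_smooth l)))

lemma contDiffOn_densityFor :
    ContDiffOn ℝ ∞ (fun y : ℝ × ℝ => F.densityFor (gbar y.1) (Hbar y.1) (σ y.2)) (J ×ˢ I) := by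
  have hi := F.contDiffOn_gram_inv hsub h hπ hg
  have hs := F.contDiffOn_shapeFor hsub h hπ hg hJ hb
  have hf := F.contDiffOn_fluxFor hsub h hπ hg hH
  refine ((F.contDiffOn_horSq hsub h hπ hg).inv fun y hy => (F.horSq_pos (hg.isInvMetric hy.1)
    (hsub (h.section_mem _ hy.2))).1.ne').mul (ContDiffOn.add ?_ ?_)
  · exact contDiffOn_sum_univ fun i => contDiffOn_sum_univ fun j => contDiffOn_sum_univ fun k =>
      contDiffOn_sum_univ fun l => ((hi i k).mul (hi j l)).mul ((hs i j).mul (hs k l))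
  · exact contDiffOn_sum_univ fun i => contDiffOn_sum_univ fun j => contDiffOn_sum_univ fun k =>
      contDiffOn_sum_univ fun l => ((hi i k).mul (hi j l)).mul ((hf i j).mul (hf k l))

end Smoothness

end AdaptedFrame

end FrameInTime

/-! ### Time derivatives under the flow, in a frame frozen at time `t`. -/

section FlowDerivatives

set_option linter.unusedSectionVars false

open scoped Topology

variable {EK : Type*} [NormedAddCommGroup EK] [NormedSpace ℝ EK] [CompleteSpace EK]
  {K : Type*} [TopologicalSpace K] [Group K] [ChartedSpace EK K]
  [LieGroup 𝓘(ℝ, EK) ∞ K]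
  {M : Type*} [TopologicalSpace M] [ChartedSpace (EuclideanSpace ℝ (Fin 1)) M]
  [IsManifold 𝓘(ℝ, EuclideanSpace ℝ (Fin 1)) ∞ M]
  {EP : Type*} [NormedAddCommGroup EP] [NormedSpace ℝ EP] [CompleteSpace EP]
  {P : Type*} [TopologicalSpace P] [ChartedSpace EP P] [MulAction Kᵐᵒᵖ P]
  [IsManifold 𝓘(ℝ, EP) ∞ P] {π : P → M}

namespace AdaptedFrame

variable {U U' : Set M} {J : Set ℝ} {gbar : ℝ → BilinField EP P} {Hbar : ℝ → ThreeForm EP P}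
  {t : ℝ} (F : AdaptedFrame K (EuclideanSpace ℝ (Fin 1)) π (gbar t) 1 3 U)
  {z : M → ℝ} {σ : ℝ → P} {I : Set ℝ}
  (hsub : U' ⊆ U) (h : Slice K EP π U' z σ I)
  (hπ : IsPrincipalBundle EK K (EuclideanSpace ℝ (Fin 1)) EP π) (hJ : IsOpen J)
  (hg : IsInvariantMetricFamily K J gbar) (ht : t ∈ J)
  (hflow : SatisfiesFlowEquations K (EuclideanSpace ℝ (Fin 1)) π 1 3 J gbar Hbar)
  {x : ℝ} (hx : x ∈ I)
include hsub h hπ hJ hg ht hflow hx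

lemma hasDerivAt_gram (i j : Fin 3) :
    HasDerivAt (fun s => F.gram (gbar s) (σ x) i j) (F.rhsG (Hbar t) (F.ver i) (F.ver j) (σ x))
      t := by
  have hd := (differentiableAt_fst_of_contDiffOn hJ h.isOpen_coord
    (F.contDiffOn_gram hsub h hπ hg i j) ht hx).hasDerivAt
  exact hd.congr_deriv ((hflow t ht U F (σ x) (hsub (h.section_mem x hx))).1 i j)

lemma hasDerivAt_gram_inv (i j : Fin 3) :
    HasDerivAt (fun s => (F.gram (gbar s) (σ x))⁻¹ i j)
      (- F.rhsG (Hbar t) (F.ver i) (F.ver j) (σ x)) t :=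
  have hp := hsub (h.section_mem x hx)
  hasDerivAt_inv_apply (Γ := fun i j => F.rhsG (Hbar t) (F.ver i) (F.ver j) (σ x))
    (F.hasDerivAt_gram hsub h hπ hJ hg ht hflow hx) (F.gram_self hp)
    (Filter.eventually_of_mem (hJ.mem_nhds ht) fun _ hs =>
      (F.gram_posDef (hg.isInvMetric hs) hp).det_pos.ne')
    (fun i j => differentiableAt_fst_of_contDiffOn hJ h.isOpen_coord
      (F.contDiffOn_gram_inv hsub h hπ hg i j) ht hx) i j

/-- The vertical part of the fixed vector `V` represents the connection applied to `V`, so its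
derivative is `(∂A/∂t) V`. Pairing with the `η_i`, orthonormal at time `t`, reads off its
components. -/
lemma hasDerivAt_vertCoeff (i : Fin 3) :
    HasDerivAt (fun s => F.vertCoeff (gbar s) (σ x) i)
      (F.rhsA (Hbar t) (F.hor 0) (F.ver i) (σ x)) t := by
  have hp := hsub (h.section_mem x hx)
  have hb := hg.isInvMetric ht
  have hd := fun i => (differentiableAt_fst_of_contDiffOn hJ h.isOpen_coord
    (F.contDiffOn_vertCoeff hsub h hπ hg i) ht hx).hasDerivAt
  refine (hd i).congr_deriv ?_
  rw [← (hflow t ht U F (σ x) hp).2.1 0 i]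
  have e : (fun s => vertPart (EuclideanSpace ℝ (Fin 1)) π (gbar s) (σ x) (F.hor 0 (σ x)))
      =ᶠ[𝓝 t] fun s => ∑ m, F.vertCoeff (gbar s) (σ x) m • F.ver m (σ x) :=
    Filter.eventuallyEq_of_mem (hJ.mem_nhds ht) fun s hs =>
      F.vertPart_hor hb (hg.isInvMetric hs) hp
  -- All vectors lie in the one tangent space at `σ x`; the derivative is taken in its model space
  -- `EP`.
  have d : deriv (fun s => vertPart (EuclideanSpace ℝ (Fin 1)) π (gbar s) (σ x) (F.hor 0 (σ x))) t
      = ∑ m, deriv (fun s => F.vertCoeff (gbar s) (σ x) m) t • F.ver m (σ x) :=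
    HasDerivAt.deriv (F := EP) (HasDerivAt.congr_of_eventuallyEq (F := EP)
      (HasDerivAt.fun_sum (F := EP) (u := Finset.univ) fun m _ =>
        HasDerivAt.smul_const (F := EP) (hd m) (F.ver m (σ x))) e)
  rw [d, F.ev₂_ver_lincomb_left hp]

lemma hasDerivAt_horSq :
    HasDerivAt (fun s => F.horSq (gbar s) (σ x)) (1 / 2 * F.density (Hbar t) (σ x)) t := by
  have hp := hsub (h.section_mem x hx)
  have hb := hg.isInvMetric ht
  have hd := (differentiableAt_fst_of_contDiffOn hJ h.isOpen_coord
    (F.contDiffOn_horSq hsub h hπ hg) ht hx).hasDerivAt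
  refine hd.congr_deriv ?_
  rw [F.density_eq (Hbar t) hπ hb hp, ← F.rhsg_hor (Hbar t) hπ hb hp,
    ← (hflow t ht U F (σ x) hp).2.2.1 0 0]
  exact (Filter.eventuallyEq_of_mem (hJ.mem_nhds ht) fun s hs =>
    (F.horPart_hor hb (hg.isInvMetric hs) hp).symm).deriv_eq

lemma hasDerivAt_flux (hH : IsInvariantClosedThreeFormFamily K J Hbar) (k l : Fin 3) :
    HasDerivAt (fun s => F.flux (Hbar s) k l (σ x))
      (extD₂ (F.B (Hbar t)) (F.hor 0) (F.ver k) (F.ver l) (σ x)) t := by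
  have hd := (differentiableAt_fst_of_contDiffOn hJ h.isOpen_coord
    (contDiffOn_form hsub h hπ hH (F.hor_smooth 0) (F.ver_smooth k) (F.ver_smooth l))
    ht hx).hasDerivAt
  exact hd.congr_deriv ((hflow t ht U F (σ x) (hsub (h.section_mem x hx))).2.2.2
    (Sum.inl 0) (Sum.inr k) (Sum.inr l))

/-- The vertical coefficients vanish at time `t`, so only their derivatives contribute; they account
for the motion of the horizontal space. -/
lemma hasDerivAt_fluxFor (hH : IsInvariantClosedThreeFormFamily K J Hbar) (k l : Fin 3) :
    HasDerivAt (fun s => F.fluxFor (gbar s) (Hbar s) (σ x) k l)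
      (extD₂ (F.B (Hbar t)) (F.hor 0) (F.ver k) (F.ver l) (σ x)
        - ∑ n, F.rhsA (Hbar t) (F.hor 0) (F.ver n) (σ x) * F.fluxVer (Hbar t) n k l (σ x)) t := by
  have hp := hsub (h.section_mem x hx)
  have d := (F.hasDerivAt_flux hsub h hπ hJ hg ht hflow hx hH k l).sub
    (HasDerivAt.fun_sum (u := Finset.univ) fun m _ =>
      (F.hasDerivAt_vertCoeff hsub h hπ hJ hg ht hflow hx m).mul
        (differentiableAt_fst_of_contDiffOn hJ h.isOpen_coord
          (contDiffOn_form hsub h hπ hH (F.ver_smooth m) (F.ver_smooth k) (F.ver_smooth l))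
          ht hx).hasDerivAt)
  refine d.congr_deriv ?_
  simp only [F.vertCoeff_self hp, zero_mul, add_zero]
  rfl

/-- The horizontal part of `V` moves with velocity `-∑ a_n η_n`, where `a_n` is `rhsA` on `η_n`. The
Lie derivative of the metric along `η_n` is `-(C n k l + C n l k)`, whence the plus sign of the last
sum. -/
lemma hasDerivAt_shapeFor (k l : Fin 3) :
    HasDerivAt (fun s => F.shapeFor (gbar s) (σ x) k l)
      (along (F.hor 0) (F.rhsG (Hbar t) (F.ver k) (F.ver l)) (σ x)
      - ∑ n, F.conn k n (σ x) * F.rhsG (Hbar t) (F.ver n) (F.ver l) (σ x)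
      - ∑ n, F.conn l n (σ x) * F.rhsG (Hbar t) (F.ver k) (F.ver n) (σ x)
      + ∑ n, F.rhsA (Hbar t) (F.hor 0) (F.ver n) (σ x)
        * (F.struc n k l (σ x) + F.struc n l k (σ x))) t := by
  have hp := hsub (h.section_mem x hx)
  have hb := hg.isInvMetric ht
  have hG := F.hasDerivAt_gram hsub h hπ hJ hg ht hflow hx
  have d1 := h.hasDerivAt_along hπ hJ (f := fun t => ev₂ (gbar t) (F.ver k) (F.ver l))
    (F.contDiffOn_gram hsub h hπ hg k l) (fun t ht => F.invFun_gram hsub h hπ hg ht k l) ht hx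
    (F.hor 0)
  -- The equation for `∂G/∂t` holds on the whole domain of the frame, so it may be inserted before
  -- differentiating along `V`.
  have e1 : along (F.hor 0) (fun q => deriv (fun s => ev₂ (gbar s) (F.ver k) (F.ver l) q) t) (σ x)
      = along (F.hor 0) (F.rhsG (Hbar t) (F.ver k) (F.ver l)) (σ x) :=
    along_congr rfl (Filter.eventuallyEq_of_mem ((hπ.isOpen_preimage F.isOpen).mem_nhds hp)
      fun q hq => (hflow t ht U F q hq).1 k l)
  rw [e1] at d1
  have d2 : HasDerivAt (fun s => lieD (gbar s) (F.hor 0) (F.ver k) (F.ver l) (σ x)) _ t :=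
    ((d1.sub (HasDerivAt.fun_sum (u := Finset.univ) fun n _ =>
      (hG n l).const_mul (F.conn k n (σ x)))).sub
      (HasDerivAt.fun_sum (u := Finset.univ) fun n _ =>
        (hG k n).const_mul (F.conn l n (σ x)))).congr_of_eventuallyEq
    (Filter.Eventually.of_forall fun s => F.lieD_hor_ver hπ hb hp k l)
  have d := d2.sub (HasDerivAt.fun_sum (u := Finset.univ) fun m _ =>
      (F.hasDerivAt_vertCoeff hsub h hπ hJ hg ht hflow hx m).mul
        (differentiableAt_fst_of_contDiffOn hJ h.isOpen_coord
          (F.contDiffOn_lieD_ver hsub h hπ hg hJ hb m k l) ht hx).hasDerivAt)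
  refine d.congr_deriv ?_
  simp only [F.vertCoeff_self hp, zero_mul, add_zero, F.lieD_ver_ver hπ hb hb hp,
    F.gram_self hp, Matrix.one_apply, mul_ite, mul_one, mul_zero, Finset.sum_ite_eq,
    Finset.sum_ite_eq', Finset.mem_univ, if_true]
  rw [sub_eq_add_neg (_ - _ - _), ← Finset.sum_neg_distrib]
  congr 1
  exact Finset.sum_congr rfl fun n _ => by ring

lemma densityFor_self {p : P} (hp : p ∈ π ⁻¹' U) :
    F.densityFor (gbar t) (Hbar t) p = F.density (Hbar t) p :=
  (F.density_eq_densityFor F (Hbar t) hπ (hg.isInvMetric ht) (hg.isInvMetric ht) hp hp).symm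

/-- The evolution of the energy density in a fixed frame. -/
lemma hasDerivAt_densityFor
    (hK : IsNilpotentLieGroup (E := EK) K) (hH : IsInvariantClosedThreeFormFamily K J Hbar)
    (hc : IsCentralAt F (σ x)) :
    HasDerivAt (fun s => F.densityFor (gbar s) (Hbar s) (σ x))
      (along (F.hor 0) (along (F.hor 0) (F.density (Hbar t))) (σ x)
        - 1 / 2 * F.density (Hbar t) (σ x) ^ 2 - SBframe F (Hbar t) (σ x)) t := by
  have hp := hsub (h.section_mem x hx)
  have hb := hg.isInvMetric ht
  have hi := F.hasDerivAt_gram_inv hsub h hπ hJ hg ht hflow hx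
  have n1 := hasDerivAt_gramNormSq
    (Γ := fun i j => F.rhsG (Hbar t) (F.ver i) (F.ver j) (σ x)) (X₀ := fun i j => F.shape i j (σ x))
    (ε := 1) hi (F.gram_self hp) (F.hasDerivAt_shapeFor hsub h hπ hJ hg ht hflow hx)
    (F.shapeFor_self hπ hb hp) (by norm_num) fun i j => by rw [one_mul, F.shape_symm]
  have n2 := hasDerivAt_gramNormSq
    (Γ := fun i j => F.rhsG (Hbar t) (F.ver i) (F.ver j) (σ x))
    (X₀ := fun i j => F.flux (Hbar t) i j (σ x))
    (ε := -1) hi (F.gram_self hp) (F.hasDerivAt_fluxFor hsub h hπ hJ hg ht hflow hx hH)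
    (F.fluxFor_self (Hbar t) hp) (by norm_num) fun i j => by rw [F.flux_swap, neg_one_mul]
  -- At time `t` the reciprocal of `horSq` has value `1` and derivative `-½` times the density;
  -- multiplied by the density this is the quadratic term.
  have n0 := (F.hasDerivAt_horSq hsub h hπ hJ hg ht hflow hx).fun_inv
    (by rw [F.horSq_self hp]; exact one_ne_zero)
  have ev := F.evolution (Hbar t) hπ hb (hH.isInvForm ht) hK (hH.closed t ht) hp hc
    (fun _ _ => rfl) (fun _ _ => rfl)
  have hN : gramNormSq (F.gram (gbar t) (σ x)) (F.shapeFor (gbar t) (σ x))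
      + gramNormSq (F.gram (gbar t) (σ x)) (F.fluxFor (gbar t) (Hbar t) (σ x))
      = F.density (Hbar t) (σ x) := by
    have := F.densityFor_self (Hbar := Hbar) hsub h hπ hJ hg ht hflow hx hp
    rwa [densityFor, F.horSq_self hp, inv_one, one_mul] at this
  refine (n0.mul (n1.add n2)).congr_deriv ?_
  have hN' : ((fun s => gramNormSq (F.gram (gbar s) (σ x)) (F.shapeFor (gbar s) (σ x)))
      + fun s => gramNormSq (F.gram (gbar s) (σ x)) (F.fluxFor (gbar s) (Hbar s) (σ x))) t
      = F.density (Hbar t) (σ x) := hN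
  rw [hN', F.horSq_self hp]
  simp only [mul_add, Finset.sum_add_distrib] at ev ⊢
  linear_combination ev

end AdaptedFrame

end FlowDerivatives

/-! ### Descent to the base: energy, Laplacian and their evolution. -/

section BaseFunctions

set_option linter.unusedSectionVars false

open scoped Topology

/-- Existence of an admissible frame is essential: without one, every real number satisfies the
condition from which `frameValue` is chosen. -/
lemma frameValue_eq {K : Type*} [TopologicalSpace K] [Group K]
    {EM : Type*} [NormedAddCommGroup EM] [NormedSpace ℝ EM]
    {M : Type*} [TopologicalSpace M] [ChartedSpace EM M]
    {EP : Type*} [NormedAddCommGroup EP] [NormedSpace ℝ EP]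
    {P : Type*} [TopologicalSpace P] [ChartedSpace EP P] [MulAction Kᵐᵒᵖ P]
    [IsManifold 𝓘(ℝ, EP) ∞ P] {π : P → M} {b : BilinField EP P} {m n : ℕ}
    {adm : ∀ U : Set M, AdaptedFrame K EM π b m n U → P → Prop}
    {val : ∀ U : Set M, AdaptedFrame K EM π b m n U → P → ℝ} {x : M} {c : ℝ}
    (h : ∀ (U : Set M) (F : AdaptedFrame K EM π b m n U) (p : P),
      π p ∈ U → π p = x → adm U F p → val U F p = c)
    (hex : ∃ (U : Set M) (F : AdaptedFrame K EM π b m n U) (p : P),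
      π p ∈ U ∧ π p = x ∧ adm U F p) :
    frameValue K EM π b m n adm val x = c := by
  obtain ⟨U, F, p, h1, h2, h3⟩ := hex
  rw [← h U F p h1 h2 h3]
  exact (Classical.epsilon_spec (p := fun c : ℝ => ∀ (U : Set M)
    (F : AdaptedFrame K EM π b m n U) (p : P),
    π p ∈ U → π p = x → adm U F p → val U F p = c) ⟨c, h⟩ U F p h1 h2 h3).symm

variable {K : Type*} [TopologicalSpace K] [Group K] [ChartedSpace (EuclideanSpace ℝ (Fin 3)) K]
  [LieGroup 𝓘(ℝ, EuclideanSpace ℝ (Fin 3)) ∞ K]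
  {M : Type*} [TopologicalSpace M] [ChartedSpace (EuclideanSpace ℝ (Fin 1)) M]
  [IsManifold 𝓘(ℝ, EuclideanSpace ℝ (Fin 1)) ∞ M]
  {P : Type*} [TopologicalSpace P] [ChartedSpace (EuclideanSpace ℝ (Fin 4)) P]
  [MulAction Kᵐᵒᵖ P] [IsManifold 𝓘(ℝ, EuclideanSpace ℝ (Fin 4)) ∞ P] {π : P → M}
  (hK : IsNilpotentLieGroup (E := EuclideanSpace ℝ (Fin 3)) K)
  (hπ : IsPrincipalBundle (EuclideanSpace ℝ (Fin 3)) K (EuclideanSpace ℝ (Fin 1))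
    (EuclideanSpace ℝ (Fin 4)) π)

include hπ in
lemma IsPrincipalBundle.surjective : Function.Surjective π := fun x => by
  obtain ⟨U, φ, ψ, -, hx, -, -, h1, -⟩ := hπ.locally_trivial x
  exact ⟨φ (x, 1), (h1 x hx 1).1⟩

include hπ in
lemma Slice.proj_section {U : Set M} {z : M → ℝ} {σ : ℝ → P} {I : Set ℝ}
    (h : Slice K (EuclideanSpace ℝ (Fin 4)) π U z σ I) {y : M} (hy : y ∈ U) : π (σ (z y)) = y := by
  obtain ⟨p, rfl⟩ := hπ.surjective y
  obtain ⟨a, ha⟩ := h.exists_act p hy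
  have := congrArg π ha
  rw [hπ.proj_act] at this
  exact this.symm

namespace AdaptedFrame

variable {b b' : BilinField (EuclideanSpace ℝ (Fin 4)) P} {U : Set M}
  (F : AdaptedFrame K (EuclideanSpace ℝ (Fin 1)) π b 1 3 U)
  {H : ThreeForm (EuclideanSpace ℝ (Fin 4)) P}
include hK hπ

/-- Every frame for `b'` is compared with the one frame `F`, adapted to `b`. This shows that the
energy is well defined and gives its values at all times through a frame chosen at one time. -/
lemma energy_eq_densityFor (hb : IsInvMetric K b) (hb' : IsInvMetric K b') (hH : IsInvForm K H)
    {p : P} (hp : p ∈ π ⁻¹' U) :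
    energy K (EuclideanSpace ℝ (Fin 1)) π 1 3 b' H (π p) = F.densityFor b' H p := by
  refine frameValue_eq (fun U' F' q hq hqp _ => ?_) ?_
  · obtain ⟨a, rfl⟩ := hπ.exists_act_of_proj_eq hqp.symm
    have hp' : p ∈ π ⁻¹' U' := by rwa [Set.mem_preimage, ← hqp]
    rw [← F'.density_eq H hπ hb' hq, F'.inv_density H hπ hb' hH a p hp',
      F.density_eq_densityFor F' H hπ hb hb' hp hp']
  · obtain ⟨U', F', hp', -⟩ := exists_adaptedFrame hK hπ hb' p
    exact ⟨U', F', p, hp', rfl, trivial⟩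

lemma energy_eq_density (hb : IsInvMetric K b) (hH : IsInvForm K H) {p : P} (hp : p ∈ π ⁻¹' U) :
    energy K (EuclideanSpace ℝ (Fin 1)) π 1 3 b H (π p) = F.density H p := by
  rw [F.energy_eq_densityFor hK hπ hb hb hH hp, F.density_eq_densityFor F H hπ hb hb hp hp]

omit hK in
lemma lap_eq {f : M → ℝ} {p : P} (hp : p ∈ π ⁻¹' U) :
    F.lap f p = along (F.hor 0) (along (F.hor 0) (f ∘ π)) p := by
  have h0 : along (F.nabla (F.hor 0) (F.hor 0)) (f ∘ π) p = 0 := by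
    unfold along
    rw [F.nabla_hor hπ hp]
    exact map_zero _
  simp only [lap, Fin.sum_univ_one, h0, sub_zero]

omit hK in
/-- Unit horizontal fields are unique up to sign. -/
lemma along_along_eq (hb : IsInvMetric K b) {U' : Set M}
    (F' : AdaptedFrame K (EuclideanSpace ℝ (Fin 1)) π b 1 3 U') {f : P → ℝ}
    (hf : SmoothOn (EuclideanSpace ℝ (Fin 4)) f (π ⁻¹' U)) {p : P} (hp : p ∈ π ⁻¹' U)
    (hp' : p ∈ π ⁻¹' U') :
    along (F'.hor 0) (along (F'.hor 0) f) p = along (F.hor 0) (along (F.hor 0) f) p := by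
  have hW := hπ.isOpen_preimage (F.isOpen.inter F'.isOpen)
  have hl : π ⁻¹' (U ∩ U') ⊆ π ⁻¹' U := Set.preimage_mono Set.inter_subset_left
  have hr : π ⁻¹' (U ∩ U') ⊆ π ⁻¹' U' := Set.preimage_mono Set.inter_subset_right
  have hpp : p ∈ π ⁻¹' (U ∩ U') := ⟨hp, hp'⟩
  let κ : P → ℝ := ev₂ b (F'.hor 0) (F.hor 0)
  have hκ : SmoothOn (EuclideanSpace ℝ (Fin 4)) κ (π ⁻¹' (U ∩ U')) :=
    hb.smooth _ _ _ hW ((F'.hor_smooth 0).mono hr) ((F.hor_smooth 0).mono hl)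
  have hV : ∀ q ∈ π ⁻¹' (U ∩ U'), F'.hor 0 q = κ q • F.hor 0 q := fun q hq => by
    have := F.expand hb (hl hq) (F'.hor 0 q)
    simp only [F'.hor_horizontal 0 q (hr hq) _ (F.ver_vertical _ q (hl hq)), zero_smul,
      Finset.sum_const_zero, add_zero] at this
    exact this
  have hκκ : ∀ q ∈ π ⁻¹' (U ∩ U'), κ q * κ q = 1 := fun q hq => by
    have h1 : b q (F'.hor 0 q) (F'.hor 0 q) = 1 := by
      simpa using F'.hor_orthonormal 0 0 q (hr hq)
    have h2 : b q (F.hor 0 q) (F.hor 0 q) = 1 := by simpa using F.hor_orthonormal 0 0 q (hl hq)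
    rw [hV q hq, map_smul, map_smul, smul_apply, h2, smul_eq_mul, smul_eq_mul, mul_one] at h1
    exact h1
  have hal : ∀ g : P → ℝ, ∀ q ∈ π ⁻¹' (U ∩ U'), along (F'.hor 0) g q = κ q * along (F.hor 0) g q :=
    fun g q hq => by
    unfold along
    rw [hV q hq]
    exact map_smul (mfderiv 𝓘(ℝ, EuclideanSpace ℝ (Fin 4)) 𝓘(ℝ, ℝ) g q) _ _
  -- Differentiating `κ² = 1` shows that `κ` is constant along `V`, so the second derivative along
  -- `κ V` is `κ²` times that along `V`.
  have hκ0 : along (F.hor 0) κ p = 0 := by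
    have d := hκ.hasAlong hW hpp (F.hor 0)
    have := (d.mul d).2.symm.trans (along_eq_zero_of_const hW hpp hκκ)
    have h2 : κ p * along (F.hor 0) κ p = 0 := by linarith
    rcases mul_eq_zero.1 h2 with h3 | h3
    · have := hκκ p hpp
      rw [h3, zero_mul] at this
      exact absurd this zero_ne_one
    · exact h3
  have hff := ((hf.mono hl).along hW ((F.hor_smooth 0).mono hl)).hasAlong hW hpp (F.hor 0)
  rw [hal _ p hpp, (((hκ.hasAlong hW hpp (F.hor 0)).mul hff).congrOn hW hpp (hal f)).2, hκ0,
    zero_mul, zero_add, ← mul_assoc, hκκ p hpp, one_mul]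

/-- The value does not change along the fibre by invariance, nor with the frame because unit
horizontal fields agree up to sign. -/
lemma laplacian_eq (hb : IsInvMetric K b) {f : M → ℝ}
    (hf : SmoothOn (EuclideanSpace ℝ (Fin 4)) (f ∘ π) (π ⁻¹' U)) {p : P} (hp : p ∈ π ⁻¹' U) :
    laplacian K (EuclideanSpace ℝ (Fin 1)) π 1 3 b f (π p) =
      along (F.hor 0) (along (F.hor 0) (f ∘ π)) p := by
  refine frameValue_eq (fun U' F' q hq hqp _ => ?_) ?_
  · obtain ⟨a, rfl⟩ := hπ.exists_act_of_proj_eq hqp.symm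
    have hqU : MulOpposite.op a • p ∈ π ⁻¹' U := hπ.act_mem a hp
    have hfi : InvFun K (f ∘ π) (π ⁻¹' U) := fun a q _ => by simp [hπ.proj_act]
    have h1 := hπ.invFun_along F.isOpen (F.hor_invariant 0) hf hfi
    have h2 := hπ.invFun_along F.isOpen (F.hor_invariant 0)
      (hf.along (hπ.isOpen_preimage F.isOpen) (F.hor_smooth 0)) h1
    rw [F'.lap_eq hπ hq, F.along_along_eq hπ hb F' hf hqU hq, h2 a p hp]
  · obtain ⟨U', F', hp', -⟩ := exists_adaptedFrame hK hπ hb p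
    exact ⟨U', F', p, hp', rfl, trivial⟩

end AdaptedFrame

variable {J : Set ℝ} (hJ : IsOpen J) {gbar : ℝ → BilinField (EuclideanSpace ℝ (Fin 4)) P}
  {Hbar : ℝ → ThreeForm (EuclideanSpace ℝ (Fin 4)) P}
  (hg : IsInvariantMetricFamily K J gbar) (hH : IsInvariantClosedThreeFormFamily K J Hbar)
include hK hπ hJ hg hH

/-- Near a given point, one frame adapted at time `t` expresses the energy at all times in `J`.
Smoothness is that of `densityFor` as a function of time and coordinate. -/
lemma contMDiffOn_energy :
    ContMDiffOn (𝓘(ℝ, ℝ).prod 𝓘(ℝ, EuclideanSpace ℝ (Fin 1))) 𝓘(ℝ, ℝ) ∞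
      (fun y : ℝ × M => energy K (EuclideanSpace ℝ (Fin 1)) π 1 3 (gbar y.1) (Hbar y.1) y.2)
      (J ×ˢ Set.univ) := by
  rintro ⟨t, y⟩ ⟨ht, -⟩
  obtain ⟨p, rfl⟩ := hπ.surjective y
  have hb := hg.isInvMetric ht
  obtain ⟨U, F, hp, -⟩ := exists_adaptedFrame hK hπ hb p
  obtain ⟨U', z, σ, I, hpU', hsub, h⟩ := hπ.exists_slice_subset F.isOpen hp
  have h1 : ContMDiffOn (𝓘(ℝ, ℝ).prod 𝓘(ℝ, EuclideanSpace ℝ (Fin 1))) 𝓘(ℝ, ℝ × ℝ) ∞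
      (fun y : ℝ × M => (y.1, z y.2)) (J ×ˢ U') :=
    contMDiffOn_fst.prodMk_space (h.smooth_coord.comp contMDiffOn_snd fun y hy => hy.2)
  have h2 := (F.contDiffOn_densityFor hsub h hπ hg hJ hb hH).contMDiffOn.comp h1
    fun y hy => ⟨hy.1, h.coord_mem _ hy.2⟩
  have h3 := h2.congr (f₁ := fun y : ℝ × M =>
    energy K (EuclideanSpace ℝ (Fin 1)) π 1 3 (gbar y.1) (Hbar y.1) y.2) fun y hy => by
      have := F.energy_eq_densityFor hK hπ hb (hg.isInvMetric hy.1) (hH.isInvForm hy.1)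
        (hsub (h.section_mem _ (h.coord_mem _ hy.2)))
      rwa [h.proj_section hπ hy.2] at this
  exact (h3.contMDiffAt ((hJ.prod h.isOpen).mem_nhds ⟨ht, hpU'⟩)).contMDiffWithinAt

/-- The equation holds with `SBframe` for every frame that is central at `p`; this freedom is what
makes `S_B` well defined. -/
lemma hasDerivAt_energy
    (hflow : SatisfiesFlowEquations K (EuclideanSpace ℝ (Fin 1)) π 1 3 J gbar Hbar)
    {t : ℝ} (ht : t ∈ J) {U : Set M}
    (F : AdaptedFrame K (EuclideanSpace ℝ (Fin 1)) π (gbar t) 1 3 U) {p : P} (hp : p ∈ π ⁻¹' U)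
    (hc : IsCentralAt F p) :
    HasDerivAt (fun s => energy K (EuclideanSpace ℝ (Fin 1)) π 1 3 (gbar s) (Hbar s) (π p))
      (laplacian K (EuclideanSpace ℝ (Fin 1)) π 1 3 (gbar t)
          (energy K (EuclideanSpace ℝ (Fin 1)) π 1 3 (gbar t) (Hbar t)) (π p)
        - 1 / 2 * energy K (EuclideanSpace ℝ (Fin 1)) π 1 3 (gbar t) (Hbar t) (π p) ^ 2
        - SBframe F (Hbar t) p) t := by
  have hb := hg.isInvMetric ht
  have hf := hH.isInvForm ht
  have hW := hπ.isOpen_preimage F.isOpen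
  obtain ⟨U', z, σ, I, hpU', hsub, h⟩ := hπ.exists_slice_subset F.isOpen hp
  obtain ⟨a, ha⟩ := h.exists_act p hpU'
  -- The slice is moved so that it passes through `p`, the point at which the last frame vector is
  -- central.
  have h' := h.translate hπ a
  have hx := h'.coord_mem _ hpU'
  have hu : ∀ q ∈ π ⁻¹' U, (energy K (EuclideanSpace ℝ (Fin 1)) π 1 3 (gbar t) (Hbar t) ∘ π) q
      = F.density (Hbar t) q := fun q hq => F.energy_eq_density hK hπ hb hf hq
  have d := F.hasDerivAt_densityFor hsub h' hπ hJ hg ht hflow hx hK hH (by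
    rwa [← ha])
  simp only [← ha] at d
  rw [F.laplacian_eq hK hπ hb ((F.smooth_density (Hbar t) hπ hb hf).congr hu) hp,
    F.energy_eq_density hK hπ hb hf hp]
  have e1 : along (F.hor 0) (along (F.hor 0)
      (energy K (EuclideanSpace ℝ (Fin 1)) π 1 3 (gbar t) (Hbar t) ∘ π)) p
      = along (F.hor 0) (along (F.hor 0) (F.density (Hbar t))) p :=
    along_congr rfl (Filter.eventuallyEq_of_mem (hW.mem_nhds hp) fun q hq =>
      along_congr rfl (Filter.eventuallyEq_of_mem (hW.mem_nhds hq) hu))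
  rw [e1]
  exact d.congr_of_eventuallyEq (Filter.eventuallyEq_of_mem (hJ.mem_nhds ht) fun s hs =>
    F.energy_eq_densityFor hK hπ hb (hg.isInvMetric hs) (hH.isInvForm hs) hp)

end BaseFunctions

end GRFlow

theorem proposition3p6
    {K : Type*} [TopologicalSpace K] [ChartedSpace (EuclideanSpace ℝ (Fin 3)) K] [Group K]
    [LieGroup 𝓘(ℝ, EuclideanSpace ℝ (Fin 3)) ∞ K]
    (hK : GRFlow.IsNilpotentLieGroup (E := EuclideanSpace ℝ (Fin 3)) K)
    {M : Type*} [TopologicalSpace M] [ChartedSpace (EuclideanSpace ℝ (Fin 1)) M]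
    [IsManifold 𝓘(ℝ, EuclideanSpace ℝ (Fin 1)) ∞ M]
    {P : Type*} [TopologicalSpace P] [ChartedSpace (EuclideanSpace ℝ (Fin 4)) P]
    [IsManifold 𝓘(ℝ, EuclideanSpace ℝ (Fin 4)) ∞ P]
    [MulAction Kᵐᵒᵖ P] (π : P → M)
    (hπ : GRFlow.IsPrincipalBundle (EuclideanSpace ℝ (Fin 3)) K (EuclideanSpace ℝ (Fin 1))
      (EuclideanSpace ℝ (Fin 4)) π)
    (J : Set ℝ) (hJ : IsOpen J)
    (gbar : ℝ → GRFlow.BilinField (EuclideanSpace ℝ (Fin 4)) P)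
    (Hbar : ℝ → GRFlow.ThreeForm (EuclideanSpace ℝ (Fin 4)) P)
    (hg : GRFlow.IsInvariantMetricFamily K J gbar)
    (hH : GRFlow.IsInvariantClosedThreeFormFamily K J Hbar)
    (hflow : GRFlow.SatisfiesFlowEquations K (EuclideanSpace ℝ (Fin 1)) π 1 3 J gbar Hbar) :
    let u : ℝ → M → ℝ := fun t =>
      GRFlow.energy K (EuclideanSpace ℝ (Fin 1)) π 1 3 (gbar t) (Hbar t)
    ContMDiffOn (𝓘(ℝ, ℝ).prod 𝓘(ℝ, EuclideanSpace ℝ (Fin 1))) 𝓘(ℝ, ℝ) ∞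
      (fun z : ℝ × M => u z.1 z.2) (J ×ˢ Set.univ) ∧
    ∀ t ∈ J, ∀ x : M,
      HasDerivAt (fun s => u s x)
        (GRFlow.laplacian K (EuclideanSpace ℝ (Fin 1)) π 1 3 (gbar t) (u t) x
          - 1 / 2 * u t x ^ 2
          - GRFlow.SB K (EuclideanSpace ℝ (Fin 1)) π (gbar t) (Hbar t) x) t := by
  refine ⟨GRFlow.contMDiffOn_energy hK hπ hJ hg hH, fun t ht x => ?_⟩
  obtain ⟨p, rfl⟩ := hπ.surjective x
  obtain ⟨U, F, hp, hc⟩ := GRFlow.exists_adaptedFrame hK hπ (hg.isInvMetric ht) p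
  have d := GRFlow.hasDerivAt_energy hK hπ hJ hg hH hflow ht F hp hc
  -- Every admissible frame over the same base point gives the same time derivative with the same
  -- remaining terms. Uniqueness of derivatives forces the values of `SBframe` to coincide.
  have hS : GRFlow.SB K (EuclideanSpace ℝ (Fin 1)) π (gbar t) (Hbar t) (π p)
      = GRFlow.SBframe F (Hbar t) p := by
    refine GRFlow.frameValue_eq (fun U' F' q hq hqp hc' => ?_) ⟨U, F, p, hp, rfl, hc⟩
    have d' := GRFlow.hasDerivAt_energy hK hπ hJ hg hH hflow ht F' hq hc'
    rw [hqp] at d'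
    exact sub_right_injective (d'.unique d)
  rw [hS]
  exact d
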